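/- **Setting.** For an integer $d\ge 1$ let $\widehat{S_d}$ be the extended affine symmetric group, i.e. the group of permutations $w$ of $\mathbb{Z}$ with $w(i+d)=w(i)+d$ for all $i$ (and let $\widehat{S_0}$ be the trivial group); let $\tau(i)=i+1$ and $a(w)=\frac1d\sum_{i=1}^d (w(i)-i)$ (with $a(w)=0$ if $d=0$). The elements with $a(w)=0$ form the affine symmetric group $\widetilde{S_d}$, which for $d\ge 2$ is a Coxeter group of type $\widetilde{A}_{d-1}$ with the generators $s_i$ ($s_i$ sends $j$ to $j+1$ if $j\equiv i$, to $j-1$ if $j\equiv i+1$ mod $d$, and fixes all other $j$), and which is trivial for $d\le 1$. Its length $\ell$, Bruhat order $\le$ and Kazhdan–Lusztig polynomials $P_{y,w}\in\mathbb{Z}[q]$ are extended to $\widehat{S_d}$ by $\ell(w)=\ell(\tau^{-a(w)}w)$; $y\le w$ iff $a(y)=a(w)$ and $\tau^{-a(y)}y\le\tau^{-a(w)}w$; $P_{y,w}=P_{\tau^{-a(y)}y,\tau^{-a(w)}w}$ if $a(y)=a(w)$, and $P_{y,w}=0$ otherwise. Let $n,n'\ge 1$, and let $(b_i)_{i\in\mathbb{Z}}$,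 $(c_j)_{j\in\mathbb{Z}}$ be tuples of nonnegative integers, periodic with periods $n$ and $n'$ respectively, with $\sum_{i=1}^n b_i=\sum_{j=1}^{n'}c_j=d$. Let $M_{(b_i),n;(c_j),n'}$ be the set of $\mathbb{Z}\times\mathbb{Z}$-matrices $\mathbf{m}=(m_{i,j})$ with entries in $\mathbb{N}$ such that $m_{i+n,j+n'}=m_{i,j}$, $\sum_j m_{i,j}=b_i$ and $\sum_i m_{i,j}=c_j$ for all $i,j$. Choose consecutive blocks (intervals) $B_i$ of $\mathbb{Z}$ with $|B_i|=b_i$ and $C_j$ with $|C_j|=c_j$. The matrix $\mathbf{m}$ corresponds to the double coset $\{w\in\widehat{S_d}: |w(B_i)\cap C_j|=m_{i,j}\ \forall i,j\}$ of the parabolic subgroups preserving all $C_j$, respectively all $B_i$; let $w_{\mathbf{m}}$ be its longest element. Put $\ell(\mathbf{m})=\ell(w_{\mathbf{m}})$, $\mathbf{m}\le\mathbf{m}'\Leftrightarrow w_{\mathbf{m}}\le w_{\mathbf{m}'}$, $P_{\mathbf{m},\mathbf{m}'}=P_{w_{\mathbf{m}},w_{\mathbf{m}'}}$ (none of which depends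 on the choice of the blocks), and let $(P^{\langle -1\rangle}_{\mathbf{m},\mathbf{m}'})$ be the inverse of the unitriangular matrix $(P_{\mathbf{m},\mathbf{m}'})$ indexed by the poset $M_{(b_i),n;(c_j),n'}$. Write $m_{\le i,\ge j}=\sum_{i'\le i,\,j'\ge j}m_{i',j'}$, a finite sum. For $\mathbf{m}\le\mathbf{m}'$, the pair $(i,j)\in\mathbb{Z}\times\mathbb{Z}$ is *cancellable* for $[\mathbf{m},\mathbf{m}']$ if $m_{i,j}\ge 1$, $m_{\le i-1,\ge j}=m'_{\le i-1,\ge j}$ and $m_{\le i,\ge j+1}=m'_{\le i,\ge j+1}$. **Proposition.** Suppose that $\mathbf{m}\le\mathbf{m}'$ in $M_{(b_i),n;(c_j),n'}$ and that $(i,j)$ is cancellable for $[\mathbf{m},\mathbf{m}']$. Let $\mathbf{e}$ be the matrix with $e_{i+kn,j+kn'}=1$ for all $k\in\mathbb{Z}$ and all other entries zero. Let $\widetilde{b}_r=b_r-1$ if $r\equiv i$ mod $n$ and $\widetilde b_r=b_r$ otherwise, and let $\widetilde{c}_s=c_s-1$ if $s\equiv j$ mod $n'$ and $\widetilde c_s=c_s$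 otherwise. 1. For any $\mathbf{m}^1\in[\mathbf{m},\mathbf{m}']$, (a) $m^1_{i,j}\ge m_{i,j}$, (b) $m^1_{\le i-1,\ge j}=m_{\le i-1,\ge j}$, and (c) $m^1_{\le i,\ge j+1}=m_{\le i,\ge j+1}$. Hence $(i,j)$ is cancellable for any sub-interval of $[\mathbf{m},\mathbf{m}']$. 2. The map $\mathbf{m}^1\mapsto\mathbf{m}^1-\mathbf{e}$ is an isomorphism of posets from $[\mathbf{m},\mathbf{m}']$ onto the interval $[\mathbf{m}-\mathbf{e},\mathbf{m}'-\mathbf{e}]$ of $M_{(\widetilde b_r),n;(\widetilde c_s),n'}$, and it reduces all lengths by the same amount. 3. For any $\mathbf{m}^1,\mathbf{m}^2\in[\mathbf{m},\mathbf{m}']$, $P_{\mathbf{m}^1,\mathbf{m}^2}=P_{\mathbf{m}^1-\mathbf{e},\mathbf{m}^2-\mathbf{e}}$. 4. For any $\mathbf{m}^1,\mathbf{m}^2\in[\mathbf{m},\mathbf{m}']$, $P^{\langle -1\rangle}_{\mathbf{m}^1,\mathbf{m}^2}=P^{\langle -1\rangle}_{\mathbf{m}^1-\mathbf{e},\mathbf{m}^2-\mathbf{e}}$.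 -/

import Mathlib

noncomputable section

namespace AffineKL

/-! ### Length, Bruhat order and Kazhdan-Lusztig polynomials of a Coxeter group

`W` is a group and `S` its set of Coxeter generators. -/

section Coxeter

variable {W : Type*} [Group W]

/-- The length of `w`: the least number of factors in an expression of `w` as a product of
elements of `S`. -/
def wordLength (S : Set W) (w : W) : ℕ :=
  sInf {k : ℕ | ∃ l : List W, (∀ s ∈ l, s ∈ S) ∧ l.prod = w ∧ l.length = k}

/-- The reflections: the conjugates of the generators. -/
def reflections (S : Set W) : Set W :=
  {t | ∃ s ∈ S, ∃ u : W, t = u * s * u⁻¹}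

/-- Bruhat order: the reflexive transitive closure of the relation `x → x t`, for `t` a reflection
with `ℓ(x) < ℓ(x t)`. -/
def BruhatLE (S : Set W) : W → W → Prop :=
  Relation.ReflTransGen
    (fun x y => ∃ t ∈ reflections S, y = x * t ∧ wordLength S x < wordLength S y)

/-- Strict Bruhat order. -/
def BruhatLT (S : Set W) (x y : W) : Prop := BruhatLE S x y ∧ x ≠ y

theorem BruhatLE.eq_or_length_lt {S : Set W} {x y : W} (h : BruhatLE S x y) :
    x = y ∨ wordLength S x < wordLength S y := by
  induction h with
  | refl => exact Or.inl rfl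
  | tail _ hstep ih =>
    obtain ⟨t, _, _, hlt⟩ := hstep
    rcases ih with rfl | h
    · exact Or.inr hlt
    · exact Or.inr (h.trans hlt)

theorem BruhatLT.length_lt {S : Set W} {x y : W} (h : BruhatLT S x y) :
    wordLength S x < wordLength S y :=
  h.1.eq_or_length_lt.resolve_left h.2

theorem BruhatLE.length_le {S : Set W} {x y : W} (h : BruhatLE S x y) :
    wordLength S x ≤ wordLength S y := by
  rcases h.eq_or_length_lt with rfl | h
  · exact le_rfl
  · exact h.le

open Classical in
/-- The `R`-polynomials: `R_{x,1} = δ_{x,1}` and, for `s` in `S` with `w s < w`,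
`R_{x,w} = R_{xs,ws}` if `x s < x` and `R_{x,w} = q R_{xs,ws} + (q - 1) R_{x,ws}` if `x s > x`.
(In a Coxeter group the result does not depend on the descent `s` that is used at each step.) -/
def rPoly (S : Set W) (x w : W) : Polynomial ℤ :=
  if h : ∃ s ∈ S, wordLength S (w * s) < wordLength S w then
    if wordLength S (x * h.choose) < wordLength S x then
      rPoly S (x * h.choose) (w * h.choose)
    else
      Polynomial.X * rPoly S (x * h.choose) (w * h.choose)
        + (Polynomial.X - 1) * rPoly S x (w * h.choose)
  else if x = w then 1 else 0
termination_by wordLength S w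
decreasing_by all_goals exact h.choose_spec.2

open Classical in
/-- The Kazhdan-Lusztig polynomials. They are determined by `P_{w,w} = 1`, `P_{x,w} = 0` unless
`x ≤ w`, and, for `x < w` and `N = ℓ(w) - ℓ(x)`, by `deg P_{x,w} ≤ (N - 1) / 2` together with
`q ^ N P_{x,w}(1 / q) = ∑_{x ≤ a ≤ w} R_{x,a} P_{a,w}`.
As the left-hand side has no terms of degree less than `(N + 1) / 2`, the polynomial `- P_{x,w}`
is the part of `∑_{x < a ≤ w} R_{x,a} P_{a,w}` in the degrees `k` with `2 k < N`. -/
def klPoly (S : Set W) (x w : W) : Polynomial ℤ :=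
  if x = w then 1
  else
    -∑ k ∈ (Finset.range (wordLength S w - wordLength S x)).filter
        (fun k => 2 * k < wordLength S w - wordLength S x),
      Polynomial.monomial k
        ((∑ᶠ (a : W) (_ : BruhatLT S x a ∧ BruhatLE S a w), rPoly S x a * klPoly S a w).coeff k)
termination_by wordLength S w - wordLength S x
decreasing_by
  rename_i h
  have h1 := h.1.length_lt
  have h2 := h.2.length_le
  omega

end Coxeter

/-! ### The extended affine symmetric group -/

/-- The translation `i ↦ i + k` of `ℤ`. -/
def shift (k : ℤ) : Equiv.Perm ℤ := Equiv.addRight k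

theorem perm_apply_inv (u : Equiv.Perm ℤ) (x : ℤ) : u (u⁻¹ x) = x := u.apply_symm_apply x

theorem perm_inv_apply (u : Equiv.Perm ℤ) (x : ℤ) : u⁻¹ (u x) = x := u.symm_apply_apply x

/-- The extended affine symmetric group: the permutations `w` of `ℤ` with `w (i + d) = w i + d`
for all `i`. For `d = 0` it is taken to be the trivial group. -/
def extAffSym (d : ℕ) : Subgroup (Equiv.Perm ℤ) where
  carrier := {w | (∀ i : ℤ, w (i + d) = w i + d) ∧ (d = 0 → w = 1)}
  mul_mem' := by
    rintro u v ⟨hu, hu0⟩ ⟨hv, hv0⟩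
    refine ⟨fun i => ?_, fun h => ?_⟩
    · rw [Equiv.Perm.mul_apply, Equiv.Perm.mul_apply, hv, hu]
    · rw [hu0 h, hv0 h, one_mul]
  one_mem' := ⟨fun _ => rfl, fun _ => rfl⟩
  inv_mem' := by
    rintro u ⟨hu, hu0⟩
    refine ⟨fun i => ?_, fun h => ?_⟩
    · apply u.injective
      rw [hu, perm_apply_inv, perm_apply_inv]
    · rw [hu0 h, inv_one]

theorem sum_comp_of_periodic {d : ℕ} {w : Equiv.Perm ℤ} (hw : w ∈ extAffSym d) {M : Type*}
    [AddCommMonoid M] (f : ℤ → M) (hf : Function.Periodic f (d : ℤ)) :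
    ∑ i ∈ Finset.Icc (1 : ℤ) d, f (w i) = ∑ i ∈ Finset.Icc (1 : ℤ) d, f i := by
  rcases Nat.eq_zero_or_pos d with rfl | hd
  · simp
  have hd0 : (0 : ℤ) < d := by exact_mod_cast hd
  have per : ∀ v ∈ extAffSym d, ∀ (k i : ℤ), v (i - k * d) = v i - k * d := by
    intro v hv k i
    have hp : Function.Periodic (fun x => v x - x) (d : ℤ) := fun x => by
      have := hv.1 x
      simp only
      rw [this]
      ring
    have h2 := hp.sub_zsmul_eq (x := i) k
    simp only [smul_eq_mul] at h2
    linarith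
  have hred : ∀ x : ℤ, toIocMod hd0 0 x = x - toIocDiv hd0 0 x * d := fun x => by
    simp [toIocMod]
  have hmem : ∀ x : ℤ, toIocMod hd0 0 x ∈ Finset.Icc (1 : ℤ) d := fun x => by
    have := toIocMod_mem_Ioc hd0 0 x
    rw [Set.mem_Ioc] at this
    rw [Finset.mem_Icc]
    omega
  have hfix : ∀ x ∈ Finset.Icc (1 : ℤ) d, ∀ k : ℤ, toIocMod hd0 0 (x - k * d) = x := by
    intro x hx k
    rw [Finset.mem_Icc] at hx
    have h1 : toIocMod hd0 0 (x - k * d) = toIocMod hd0 0 x := by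
      have := toIocMod_sub_zsmul hd0 0 x k
      simpa [smul_eq_mul] using this
    rw [h1, toIocMod_eq_self]
    rw [Set.mem_Ioc]
    omega
  have hw' : w⁻¹ ∈ extAffSym d := inv_mem hw
  refine Finset.sum_nbij' (fun i => toIocMod hd0 0 (w i)) (fun i => toIocMod hd0 0 (w⁻¹ i))
    (fun _ _ => hmem _) (fun _ _ => hmem _) ?_ ?_ ?_
  · intro i hi
    rw [hred (w i), per _ hw', perm_inv_apply, hfix i hi]
  · intro i hi
    rw [hred (w⁻¹ i), per _ hw, perm_apply_inv, hfix i hi]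
  · intro i _
    rw [hred (w i)]
    have := hf.sub_zsmul_eq (x := w i) (toIocDiv hd0 0 (w i))
    rw [smul_eq_mul] at this
    exact this.symm

theorem displacement_periodic {d : ℕ} {w : Equiv.Perm ℤ} (hw : w ∈ extAffSym d) :
    Function.Periodic (fun i => w i - i) (d : ℤ) := fun x => by
  have := hw.1 x
  simp only
  rw [this]
  ring

/-- The affine symmetric group: the `w` in the extended group such that
`w 1 + ⋯ + w d = 1 + ⋯ + d`. -/
def affSym (d : ℕ) : Subgroup (Equiv.Perm ℤ) where
  carrier := {w | w ∈ extAffSym d ∧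
    ∑ i ∈ Finset.Icc (1 : ℤ) d, w i = ∑ i ∈ Finset.Icc (1 : ℤ) d, i}
  mul_mem' := by
    rintro u v ⟨hu, hu1⟩ ⟨hv, hv1⟩
    refine ⟨mul_mem hu hv, ?_⟩
    have h := sum_comp_of_periodic hv _ (displacement_periodic hu)
    rw [Finset.sum_sub_distrib, Finset.sum_sub_distrib] at h
    simp only [Equiv.Perm.mul_apply]
    linarith
  one_mem' := ⟨one_mem _, rfl⟩
  inv_mem' := by
    rintro u ⟨hu, hu1⟩
    refine ⟨inv_mem hu, ?_⟩
    have h := sum_comp_of_periodic (inv_mem hu) _ (displacement_periodic hu)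
    rw [Finset.sum_sub_distrib, Finset.sum_sub_distrib] at h
    simp only [perm_apply_inv] at h
    linarith

/-- The Coxeter generators `s_i` of the affine symmetric group: `s_i` sends `j` to `j + 1` if
`j ≡ i`, to `j - 1` if `j ≡ i + 1`, and fixes all other `j` (congruences modulo `d`). There are
none if `d ≤ 1`. -/
def simples (d : ℕ) : Set (affSym d) :=
  {s | 2 ≤ d ∧ ∃ i : ℤ, ∀ j : ℤ,
    (s : Equiv.Perm ℤ) j =
      if j ≡ i [ZMOD d] then j + 1 else if j ≡ i + 1 [ZMOD d] then j - 1 else j}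

/-- The integer `a(w) = (1 / d) (∑_{i = 1}^d w i - ∑_{i = 1}^d i)`. The division is exact. -/
def offset {d : ℕ} (w : extAffSym d) : ℤ :=
  (∑ i ∈ Finset.Icc (1 : ℤ) d, (w : Equiv.Perm ℤ) i - ∑ i ∈ Finset.Icc (1 : ℤ) d, i) / d

theorem offset_mul {d : ℕ} (w : extAffSym d) :
    (d : ℤ) * offset w =
      ∑ i ∈ Finset.Icc (1 : ℤ) d, (w : Equiv.Perm ℤ) i - ∑ i ∈ Finset.Icc (1 : ℤ) d, i := by
  rw [offset]
  apply Int.mul_ediv_cancel'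
  rw [← (ZMod.intCast_zmod_eq_zero_iff_dvd _ d)]
  push_cast
  have hf : Function.Periodic (fun i : ℤ => (i : ZMod d)) (d : ℤ) := fun x => by simp
  rw [sum_comp_of_periodic w.2 _ hf, sub_self]

/-- The element `τ ^ (-a(w)) w` of the affine symmetric group, where `τ` is the translation by
one. -/
def affPart {d : ℕ} (w : extAffSym d) : affSym d :=
  ⟨shift (-offset w) * w, by
    have hs : ∀ i, (shift (-offset w) * (w : Equiv.Perm ℤ)) i
        = (w : Equiv.Perm ℤ) i - offset w := fun i => by
      simp [shift, sub_eq_add_neg]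
    refine ⟨⟨fun i => ?_, ?_⟩, ?_⟩
    · rw [hs, hs, w.2.1 i]
      ring
    · rintro rfl
      have h1 : offset w = 0 := by simp [offset]
      ext i
      rw [hs, h1, w.2.2 rfl]
      simp
    · have h := offset_mul w
      simp only [hs, Finset.sum_sub_distrib, Finset.sum_const, Int.card_Icc]
      simp only [add_sub_cancel_right, Int.toNat_natCast, nsmul_eq_mul]
      linarith⟩

/-- The length function of the extended affine symmetric group. -/
def extLength {d : ℕ} (w : extAffSym d) : ℕ := wordLength (simples d) (affPart w)

/-- The Bruhat order of the extended affine symmetric group. -/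
def ExtBruhatLE {d : ℕ} (y w : extAffSym d) : Prop :=
  offset y = offset w ∧ BruhatLE (simples d) (affPart y) (affPart w)

/-- The Kazhdan-Lusztig polynomials of the extended affine symmetric group. -/
def extKLPoly {d : ℕ} (y w : extAffSym d) : Polynomial ℤ :=
  if offset y = offset w then klPoly (simples d) (affPart y) (affPart w) else 0

/-! ### Periodic matrices -/

/-- The number `d = b_1 + ⋯ + b_n` attached to an `n`-periodic tuple `b`. -/
def total (n : ℕ) (b : ℤ → ℕ) : ℕ := ∑ i ∈ Finset.Icc (1 : ℤ) n, b i

/-- The set of matrices `M_{(b_i),n;(c_j),n'}`. -/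
@[ext]
structure AffMat (n : ℕ) (b : ℤ → ℕ) (n' : ℕ) (c : ℤ → ℕ) where
  /-- the entries -/
  entry : ℤ → ℤ → ℕ
  periodic : ∀ i j, entry (i + n) (j + n') = entry i j
  row_finite : ∀ i, {j | entry i j ≠ 0}.Finite
  row_sum : ∀ i, ∑ᶠ j, entry i j = b i
  col_finite : ∀ j, {i | entry i j ≠ 0}.Finite
  col_sum : ∀ j, ∑ᶠ i, entry i j = c j

/-- The largest element of the block `B_i` and all blocks to the left of it, blocks being
normalized so that `B_0` ends in `0`:
it is `b_1 + ⋯ + b_i` for `i ≥ 0` and `- (b_{i+1} + ⋯ + b_0)` for `i ≤ 0`. -/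
def blockEnd (b : ℤ → ℕ) (i : ℤ) : ℤ :=
  ∑ k ∈ Finset.Ioc 0 i, (b k : ℤ) - ∑ k ∈ Finset.Ioc i 0, (b k : ℤ)

/-- The block `B_i`: these are consecutive intervals of `ℤ` with `|B_i| = b_i`. -/
def block (b : ℤ → ℕ) (i : ℤ) : Finset ℤ := Finset.Ioc (blockEnd b (i - 1)) (blockEnd b i)

/-- The matrix `ψ(w)`, with `ψ(w)_{i,j} = |w(B_i) ∩ C_j|`. -/
def psi (b c : ℤ → ℕ) (w : Equiv.Perm ℤ) (i j : ℤ) : ℕ :=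
  ((block b i).image w ∩ block c j).card

namespace AffMat

variable {n : ℕ} {b : ℤ → ℕ} {n' : ℕ} {c : ℤ → ℕ}

/-- `w` is a longest element of the double coset corresponding to `m`, which is the fibre of `ψ`
over `m`. -/
def IsLongest (m : AffMat n b n' c) (w : extAffSym (total n b)) : Prop :=
  psi b c w = m.entry ∧
    ∀ v : extAffSym (total n b), psi b c v = m.entry → extLength v ≤ extLength w

open Classical in
/-- The longest element `w_m` of the double coset corresponding to `m`. -/
def longest (m : AffMat n b n' c) : extAffSym (total n b) :=
  if h : ∃ w, m.IsLongest w then h.choose else 1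

/-- The length `ℓ(m) = ℓ(w_m)`. -/
def length (m : AffMat n b n' c) : ℕ := extLength m.longest

/-- The order on matrices: `m ≤ m'` means `w_m ≤ w_{m'}` in Bruhat order. -/
instance : Preorder (AffMat n b n' c) where
  le m m' := ExtBruhatLE m.longest m'.longest
  le_refl _ := ⟨rfl, Relation.ReflTransGen.refl⟩
  le_trans _ _ _ h1 h2 := ⟨h1.1.trans h2.1, Relation.ReflTransGen.trans h1.2 h2.2⟩

theorem length_lt {m m' : AffMat n b n' c} (h : m < m') : m.length < m'.length := by
  obtain ⟨h1, h2⟩ := lt_iff_le_not_ge.mp h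
  rcases h1.2.eq_or_length_lt with he | hl
  · exact absurd ⟨h1.1.symm, he ▸ Relation.ReflTransGen.refl⟩ h2
  · exact hl

/-- The Kazhdan-Lusztig polynomials `P_{m,m'} = P_{w_m,w_{m'}}`. -/
def kl (m m' : AffMat n b n' c) : Polynomial ℤ := extKLPoly m.longest m'.longest

open Classical in
/-- The entries of the inverse of the matrix `(P_{m,m'})`. As the latter has entries `1` on the
diagonal and `0` unless `m ≤ m'`, the equation
`∑_{m ≤ x ≤ m'} P⁻¹_{m,x} P_{x,m'} = δ_{m,m'}` is the recursion below. -/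
def klInv (m m' : AffMat n b n' c) : Polynomial ℤ :=
  (if m = m' then 1 else 0)
    - ∑ᶠ (x : AffMat n b n' c) (_ : m ≤ x ∧ x < m'), klInv m x * kl x m'
termination_by m'.length
decreasing_by
  rename_i h
  exact length_lt h.2

/-- The sum `m_{≤ i, ≥ j}` of the entries in rows at most `i` and columns at least `j`. -/
def corner (m : AffMat n b n' c) (i j : ℤ) : ℕ :=
  ∑ᶠ p : ℤ × ℤ, if p.1 ≤ i ∧ j ≤ p.2 then m.entry p.1 p.2 else 0

/-- For `m ≤ m'`: the position `(i, j)` is cancellable for the interval `[m, m']`. -/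
structure Cancellable (m m' : AffMat n b n' c) (i j : ℤ) : Prop where
  one_le : 1 ≤ m.entry i j
  above : m.corner (i - 1) j = m'.corner (i - 1) j
  right : m.corner i (j + 1) = m'.corner i (j + 1)

end AffMat

open Classical in
/-- The matrix `e` with entries `1` at the positions `(i + k n, j + k n')`, `k` in `ℤ`, and `0`
elsewhere. -/
def unitMat (n n' : ℕ) (i j : ℤ) (r s : ℤ) : ℕ :=
  if ∃ k : ℤ, r = i + k * n ∧ s = j + k * n' then 1 else 0

/-- The tuple `b` with the entries in positions congruent to `i` modulo `n` lowered by one. (It is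
used when these entries are positive.) -/
def lower (n : ℕ) (b : ℤ → ℕ) (i : ℤ) (r : ℤ) : ℕ :=
  b r - if r ≡ i [ZMOD n] then 1 else 0

end AffineKL

end

namespace AffineKL

open Relation

/-! ### Periodic permutations -/

/-! Each matrix is represented by the unique permutation `w` in its double coset that is decreasing
on the blocks `B_i` and whose inverse is decreasing on the blocks `C_j`. The sums `m_{≤i,≥j}` are
values at block ends of the rank function `rk w p q`, the number of `r ≤ p` with `w r > q`. Ranks
can only grow along Bruhat order (`rk_le`); the converse is never needed. Hence the corner sums
occurring in cancellability are constant on the interval. They determine a position `a` in `B_i`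
which all longest elements of the interval send to one and the same `v` in `C_j`, with the same rank
there (`AffMat.Cancellable.exists_point`).

It remains to delete the point `(a, v)` and its translates, which lowers the period from `e + 1` to
`e`; `Skip` and `Infl` encode this relabelling. If `x ≤ u ≤ w`, and `x`, `w` agree at the point with
equal ranks, then `u` agrees with them too (`apply_eq_of_between`). So no reflection in a Bruhat
chain from `x` to `w` moves the class of `a`, and chains upstairs and downstairs correspond
(`reflTransGen_up_infl_iff`). The length drops by an amount that depends only on the point, the rank
and the offset (`permLength_infl`).

The `R`-polynomials agree by induction along a descent of `w` (`rPoly_infl`). A descent away from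
the point is a descent of the deletion. A descent next to the point moves the point and leaves the
deletion unchanged, unless `x ≰ w`, when both polynomials vanish. The Kazhdan-Lusztig polynomials
(`klPoly_infl`) and the inverse matrix (`AffMat.klInv_eq_of_orderIso`) follow from their recursions,
which involve only the interval.

Deletion keeps a permutation decreasing on blocks, so it takes the longest element of `m` to that of
`m - e` (`AffMat.infl_sub`). Insertion does so only under rank conditions at the cell of the point
(`Decr.infl`). Cancellability supplies them, and this gives surjectivity (`AffMat.exists_sub_eq`).

The Coxeter facts used (strong exchange, independence of the recursion for `R` from the chosen
descent, vanishing of `R_{x,w}` unless `x ≤ w`) are derived from the explicit action on `ℤ`. -/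

theorem modEq_iff_exists {d i j : ℤ} : i ≡ j [ZMOD d] ↔ ∃ k : ℤ, i = j + k * d := by
  rw [Int.modEq_comm, Int.modEq_iff_dvd]
  constructor
  · rintro ⟨k, hk⟩
    exact ⟨k, by linarith⟩
  · rintro ⟨k, hk⟩
    exact ⟨k, by linarith⟩

theorem mem_extAffSym_iff {d : ℕ} (hd : 0 < d) {w : Equiv.Perm ℤ} :
    w ∈ extAffSym d ↔ ∀ i, w (i + d) = w i + d :=
  ⟨fun h => h.1, fun h => ⟨h, fun h0 => absurd h0 hd.ne'⟩⟩

theorem map_add_mul {d : ℕ} {w : Equiv.Perm ℤ} (hw : w ∈ extAffSym d) (i k : ℤ) :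
    w (i + k * d) = w i + k * d := by
  have h := (displacement_periodic hw).int_mul k i
  simp only [Int.cast_id] at h
  linarith

theorem map_modEq_iff {d : ℕ} {w : Equiv.Perm ℤ} (hw : w ∈ extAffSym d) {i j : ℤ} :
    w i ≡ w j [ZMOD d] ↔ i ≡ j [ZMOD d] := by
  rw [modEq_iff_exists, modEq_iff_exists]
  refine exists_congr fun k => ?_
  rw [← map_add_mul hw, w.injective.eq_iff]

theorem shift_apply (k i : ℤ) : shift k i = i + k := rfl

theorem shift_mem_extAffSym {d : ℕ} (hd : 0 < d) (k : ℤ) : shift k ∈ extAffSym d := by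
  rw [mem_extAffSym_iff hd]
  intro i
  simp only [shift_apply]
  ring

/-! ### Reflections -/

/-- The map that exchanges `i + k d` and `j + k d` for all `k`. -/
def reflFun (d : ℕ) (i j x : ℤ) : ℤ :=
  if x ≡ i [ZMOD d] then x + (j - i) else if x ≡ j [ZMOD d] then x - (j - i) else x

theorem reflFun_involutive {d : ℕ} {i j : ℤ} (h : ¬ i ≡ j [ZMOD d]) :
    Function.Involutive (reflFun d i j) := by
  intro x
  unfold reflFun
  by_cases h1 : x ≡ i [ZMOD d]
  · have h2 : x + (j - i) ≡ j [ZMOD d] := by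
      have := h1.add_right (j - i)
      rwa [add_sub_cancel] at this
    have h3 : ¬ x + (j - i) ≡ i [ZMOD d] := fun h3 => h (h3.symm.trans h2)
    simp only [h1, h2, h3, if_true, if_false]
    ring
  · by_cases h2 : x ≡ j [ZMOD d]
    · have h3 : x - (j - i) ≡ i [ZMOD d] := by
        have := h2.sub_right (j - i)
        rwa [sub_sub_cancel] at this
      simp only [h1, h2, h3, if_true, if_false]
      ring
    · simp only [h1, h2, if_false]

open Classical in
/-- The affine reflection exchanging `i + k d` and `j + k d` for all `k` (the identity if `i` and
`j` are congruent modulo `d`). -/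
noncomputable def refl (d : ℕ) (i j : ℤ) : Equiv.Perm ℤ :=
  if h : 0 < d ∧ ¬ i ≡ j [ZMOD d] then (reflFun_involutive h.2).toPerm else 1

theorem refl_apply {d : ℕ} (hd : 0 < d) {i j : ℤ} (h : ¬ i ≡ j [ZMOD d]) (x : ℤ) :
    refl d i j x =
      if x ≡ i [ZMOD d] then x + (j - i) else if x ≡ j [ZMOD d] then x - (j - i) else x := by
  rw [refl, dif_pos ⟨hd, h⟩]
  rfl

theorem refl_mul_self (d : ℕ) (i j : ℤ) : refl d i j * refl d i j = 1 := by
  unfold refl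
  split_ifs with h
  · ext x
    exact reflFun_involutive h.2 x
  · simp

theorem refl_refl_apply (d : ℕ) (i j x : ℤ) : refl d i j (refl d i j x) = x := by
  rw [← Equiv.Perm.mul_apply, refl_mul_self, Equiv.Perm.one_apply]

theorem refl_left {d : ℕ} (hd : 0 < d) {i j : ℤ} (h : ¬ i ≡ j [ZMOD d]) : refl d i j i = j := by
  rw [refl_apply hd h, if_pos (Int.ModEq.refl _)]
  ring

theorem refl_right {d : ℕ} (hd : 0 < d) {i j : ℤ} (h : ¬ i ≡ j [ZMOD d]) : refl d i j j = i := by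
  have := refl_refl_apply d i j i
  rwa [refl_left hd h] at this

theorem refl_of_ne {d : ℕ} {i j x : ℤ} (hi : ¬ x ≡ i [ZMOD d]) (hj : ¬ x ≡ j [ZMOD d]) :
    refl d i j x = x := by
  unfold refl
  split_ifs with h
  · change reflFun d i j x = x
    rw [reflFun, if_neg hi, if_neg hj]
  · rfl

theorem refl_mem_extAffSym (d : ℕ) (i j : ℤ) : refl d i j ∈ extAffSym d := by
  by_cases h : 0 < d ∧ ¬ i ≡ j [ZMOD d]
  · rw [mem_extAffSym_iff h.1]
    intro x
    have hx : ∀ a, (x + d ≡ a [ZMOD d]) ↔ (x ≡ a [ZMOD d]) := fun a => by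
      simp [Int.ModEq]
    rw [refl_apply h.1 h.2, refl_apply h.1 h.2]
    simp only [hx]
    split_ifs <;> ring
  · rw [refl, dif_neg h]
    exact one_mem _

theorem refl_mem_affSym (d : ℕ) (i j : ℤ) : refl d i j ∈ affSym d := by
  have h := refl_mem_extAffSym d i j
  refine ⟨h, ?_⟩
  have h1 := sum_comp_of_periodic h _ (displacement_periodic h)
  simp only [refl_refl_apply, Finset.sum_sub_distrib] at h1
  linarith

theorem refl_add_mul {d : ℕ} (hd : 0 < d) {i j : ℤ} (h : ¬ i ≡ j [ZMOD d]) (k : ℤ) :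
    refl d (i + k * d) (j + k * d) = refl d i j := by
  have e : ∀ a : ℤ, a + k * d ≡ a [ZMOD d] := fun a => modEq_iff_exists.2 ⟨k, rfl⟩
  have h' : ¬ i + k * d ≡ j + k * d [ZMOD d] := fun h2 => h ((e i).symm.trans (h2.trans (e j)))
  ext x
  have e1 : (x ≡ i + k * d [ZMOD d]) ↔ (x ≡ i [ZMOD d]) :=
    ⟨fun h => h.trans (e i), fun h => h.trans (e i).symm⟩
  have e2 : (x ≡ j + k * d [ZMOD d]) ↔ (x ≡ j [ZMOD d]) :=
    ⟨fun h => h.trans (e j), fun h => h.trans (e j).symm⟩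
  rw [refl_apply hd h, refl_apply hd h']
  simp only [e1, e2, add_sub_add_right_eq_sub]

theorem refl_comm {d : ℕ} (i j : ℤ) : refl d i j = refl d j i := by
  by_cases h : 0 < d ∧ ¬ i ≡ j [ZMOD d]
  · have h' : ¬ j ≡ i [ZMOD d] := fun h2 => h.2 h2.symm
    ext x
    rw [refl_apply h.1 h.2, refl_apply h.1 h']
    split_ifs with h1 h2
    · exact absurd (h1.symm.trans h2) h.2
    · ring
    · ring
    · rfl
  · have h' : ¬ (0 < d ∧ ¬ j ≡ i [ZMOD d]) := fun h2 => h ⟨h2.1, fun h3 => h2.2 h3.symm⟩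
    rw [refl, refl, dif_neg h, dif_neg h']

/-- No side condition is needed: `w` preserves and reflects congruence modulo `d`, so the degenerate
case, in which a reflection is the identity, occurs on both sides at once. -/
theorem mul_refl {d : ℕ} {w : Equiv.Perm ℤ} (hw : w ∈ extAffSym d) (i j : ℤ) :
    w * refl d i j = refl d (w i) (w j) * w := by
  by_cases h : 0 < d ∧ ¬ i ≡ j [ZMOD d]
  · have h' : ¬ w i ≡ w j [ZMOD d] := fun h2 => h.2 ((map_modEq_iff hw).1 h2)
    ext x
    simp only [Equiv.Perm.mul_apply]
    rw [refl_apply h.1 h.2, refl_apply h.1 h']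
    simp only [map_modEq_iff hw]
    split_ifs with h1 h2
    · obtain ⟨k, rfl⟩ := modEq_iff_exists.1 h1
      rw [map_add_mul hw, show i + k * d + (j - i) = j + k * d by ring, map_add_mul hw]
      ring
    · obtain ⟨k, rfl⟩ := modEq_iff_exists.1 h2
      rw [map_add_mul hw, show j + k * d - (j - i) = i + k * d by ring, map_add_mul hw]
      ring
    · rfl
  · have h' : ¬ (0 < d ∧ ¬ w i ≡ w j [ZMOD d]) := fun h2 =>
      h ⟨h2.1, fun h3 => h2.2 ((map_modEq_iff hw).2 h3)⟩
    rw [refl, refl, dif_neg h, dif_neg h', mul_one, one_mul]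

/-- The reflection `refl d i j` as an element of the affine symmetric group. -/
noncomputable def reflA (d : ℕ) (i j : ℤ) : affSym d := ⟨refl d i j, refl_mem_affSym d i j⟩

theorem coe_mul_reflA {d : ℕ} (w : affSym d) (i j : ℤ) :
    ((w * reflA d i j : affSym d) : Equiv.Perm ℤ) = w * refl d i j := rfl

theorem mul_reflA_mul_reflA {d : ℕ} (w : affSym d) (i j : ℤ) :
    w * reflA d i j * reflA d i j = w := by
  apply Subtype.ext
  rw [coe_mul_reflA, coe_mul_reflA, mul_assoc, refl_mul_self, mul_one]

theorem not_modEq_succ {d : ℕ} (hd : 2 ≤ d) (p : ℤ) : ¬ p ≡ p + 1 [ZMOD d] := by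
  rw [modEq_iff_exists]
  rintro ⟨k, hk⟩
  have h1 : (d : ℤ) ∣ 1 := ⟨-k, by linarith⟩
  have h2 := Int.le_of_dvd one_pos h1
  omega

theorem reflA_succ_mem_simples {d : ℕ} (hd : 2 ≤ d) (p : ℤ) : reflA d p (p + 1) ∈ simples d := by
  refine ⟨hd, p, fun j => ?_⟩
  change refl d p (p + 1) j = _
  rw [refl_apply (by omega) (not_modEq_succ hd p)]
  simp

theorem mem_simples_iff {d : ℕ} {s : affSym d} :
    s ∈ simples d ↔ 2 ≤ d ∧ ∃ p : ℤ, s = reflA d p (p + 1) := by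
  constructor
  · rintro ⟨hd, p, h⟩
    refine ⟨hd, p, Subtype.ext (Equiv.ext fun j => ?_)⟩
    rw [h j]
    change _ = refl d p (p + 1) j
    rw [refl_apply (by omega) (not_modEq_succ hd p)]
    simp
  · rintro ⟨hd, p, rfl⟩
    exact reflA_succ_mem_simples hd p

/-! ### Generation by the simple reflections -/

theorem sum_Icc_add_of_periodic {d : ℕ} (hd : 0 < d) {f : ℤ → ℤ}
    (hf : Function.Periodic f (d : ℤ)) (k : ℤ) :
    ∑ i ∈ Finset.Icc (1 : ℤ) d, f (i + k) = ∑ i ∈ Finset.Icc (1 : ℤ) d, f i :=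
  sum_comp_of_periodic (shift_mem_extAffSym hd k) f hf

/-- The sum of the squares of the displacements over one period. -/
noncomputable def energy (d : ℕ) (w : Equiv.Perm ℤ) : ℤ := ∑ i ∈ Finset.Icc (1 : ℤ) d, (w i - i) ^ 2

/-- Reindexing by `s` turns the energy of `w s` into the sum of `(w i - s i) ^ 2`, and the
difference of the summands vanishes wherever `s i = i`. A descent therefore strictly lowers the
energy, which serves as the termination measure for sorting. -/
theorem energy_sub {d : ℕ} (hd : 2 ≤ d) {w : Equiv.Perm ℤ} (hw : w ∈ extAffSym d) (p : ℤ) :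
    energy d w - energy d (w * refl d p (p + 1)) = 2 * (w p - w (p + 1)) := by
  have hd0 : 0 < d := by omega
  set s := refl d p (p + 1) with hs
  have hsm : s ∈ extAffSym d := refl_mem_extAffSym d p (p + 1)
  have hne := not_modEq_succ hd p
  have e1 : energy d (w * s) = ∑ i ∈ Finset.Icc (1 : ℤ) d, (w i - s i) ^ 2 := by
    have hper : Function.Periodic (fun i => (w i - s i) ^ 2) (d : ℤ) := fun x => by
      simp only [hw.1 x, hsm.1 x]
      ring
    rw [← sum_comp_of_periodic hsm _ hper]
    simp only [energy, hs, refl_refl_apply, Equiv.Perm.mul_apply]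
  have hper : Function.Periodic (fun i => (s i - i) * (2 * w i - i - s i)) (d : ℤ) := fun x => by
    simp only [hw.1 x, hsm.1 x]
    ring
  have e2 : energy d w - energy d (w * s)
      = ∑ i ∈ Finset.Icc (1 : ℤ) d, (s i - i) * (2 * w i - i - s i) := by
    rw [e1, energy, ← Finset.sum_sub_distrib]
    exact Finset.sum_congr rfl fun i _ => by ring
  -- The period is shifted so that `p` and `p + 1` sit at the indices `1` and `2`, the only ones
  -- that contribute.
  rw [e2, ← sum_Icc_add_of_periodic hd0 hper (p - 1),
    Finset.sum_eq_add_of_mem (1 : ℤ) 2 (Finset.mem_Icc.2 (by omega))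
      (Finset.mem_Icc.2 (by omega)) (by norm_num)]
  · have h1 : (1 : ℤ) + (p - 1) = p := by ring
    have h2 : (2 : ℤ) + (p - 1) = p + 1 := by ring
    rw [h1, h2, hs, refl_left hd0 hne, refl_right hd0 hne]
    ring
  · intro x hx hx2
    rw [Finset.mem_Icc] at hx
    have key : ∀ a : ℤ, 1 ≤ a → a ≤ d → x ≠ a → ¬ x + (p - 1) ≡ a + (p - 1) [ZMOD d] := by
      intro a ha1 ha2 hne hmod
      have h3 := (Int.ModEq.add_right_cancel' _ hmod)
      rw [Int.modEq_iff_dvd] at h3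
      have h4 := Int.eq_zero_of_abs_lt_dvd h3 (by rw [abs_lt]; omega)
      omega
    have h1 := key 1 le_rfl (by omega) hx2.1
    have h2 := key 2 (by norm_num) (by omega) hx2.2
    rw [show (1 : ℤ) + (p - 1) = p by ring] at h1
    rw [show (2 : ℤ) + (p - 1) = p + 1 by ring] at h2
    rw [hs, refl_of_ne h1 h2]
    ring

theorem eq_add_of_strictMono {w : Equiv.Perm ℤ} (hw : StrictMono w) (i : ℤ) : w i = i + w 0 := by
  have hs : ∀ i, w (i + 1) = w i + 1 := by
    intro i
    have h1 : w i + 1 ≤ w (i + 1) := hw (lt_add_one i)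
    obtain ⟨j, hj⟩ := w.surjective (w i + 1)
    have h2 : i < j := hw.lt_iff_lt.1 (by omega)
    have h3 : w (i + 1) ≤ w j := hw.monotone (by omega)
    omega
  induction i using Int.induction_on with
  | zero => simp
  | succ i ih => rw [hs, ih]; ring
  | pred i ih =>
    have := hs (-(i : ℤ) - 1)
    rw [sub_add_cancel] at this
    linarith

/-- An increasing permutation of `ℤ` is a translation, and the normalisation of the sum over a
period forces the translation to be zero. -/
theorem eq_one_of_strictMono {d : ℕ} (w : affSym d) (h : StrictMono (w : Equiv.Perm ℤ)) :
    w = 1 := by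
  rcases Nat.eq_zero_or_pos d with rfl | hd
  · exact Subtype.ext (w.2.1.2 rfl)
  have h0 : (w : Equiv.Perm ℤ) 0 = 0 := by
    have h1 := w.2.2
    rw [Finset.sum_congr rfl fun i _ => eq_add_of_strictMono h i, Finset.sum_add_distrib,
      Finset.sum_const, Int.card_Icc] at h1
    simp only [add_sub_cancel_right, Int.toNat_natCast, nsmul_eq_mul, add_eq_left, mul_eq_zero]
      at h1
    omega
  apply Subtype.ext
  ext i
  rw [eq_add_of_strictMono h, h0]
  simp

theorem exists_descent {d : ℕ} {w : affSym d} (h : w ≠ 1) :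
    2 ≤ d ∧ ∃ p : ℤ, (w : Equiv.Perm ℤ) (p + 1) < (w : Equiv.Perm ℤ) p := by
  have h1 : ∃ p : ℤ, (w : Equiv.Perm ℤ) (p + 1) < (w : Equiv.Perm ℤ) p := by
    by_contra! h2
    refine h (eq_one_of_strictMono w (strictMono_int_of_lt_succ fun p => ?_))
    refine lt_of_le_of_ne (h2 p) fun h3 => ?_
    have := (w : Equiv.Perm ℤ).injective h3
    omega
  refine ⟨?_, h1⟩
  obtain ⟨p, hp⟩ := h1
  by_contra! hd
  interval_cases d
  · rw [w.2.1.2 rfl] at hp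
    simp at hp
  · have := w.2.1.1 p
    push_cast at this
    omega

/-- Bubble sort: only the identity has no descent, and removing a descent lowers the nonnegative
integer `energy`. -/
theorem exists_word {d : ℕ} (w : affSym d) :
    ∃ l : List (affSym d), (∀ s ∈ l, s ∈ simples d) ∧ l.prod = w := by
  induction hn : (energy d w).toNat using Nat.strong_induction_on generalizing w with
  | _ n ih =>
    by_cases h : w = 1
    · exact ⟨[], by simp, by simp [h]⟩
    · obtain ⟨hd, p, hp⟩ := exists_descent h
      have h1 := energy_sub hd w.2.1 p
      have h0 : 0 ≤ energy d ((w * reflA d p (p + 1) : affSym d) : Equiv.Perm ℤ) :=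
        Finset.sum_nonneg fun _ _ => sq_nonneg _
      rw [coe_mul_reflA] at h0
      obtain ⟨l, hl, hlp⟩ := ih _ (by rw [coe_mul_reflA]; omega) (w * reflA d p (p + 1)) rfl
      refine ⟨l ++ [reflA d p (p + 1)], ?_, ?_⟩
      · intro s hs
        rw [List.mem_append, List.mem_singleton] at hs
        rcases hs with hs | rfl
        · exact hl s hs
        · exact reflA_succ_mem_simples hd p
      · rw [List.prod_append, List.prod_singleton, hlp, mul_reflA_mul_reflA]

/-! ### The length function -/

/-- The length on the affine symmetric group. -/
noncomputable abbrev len {d : ℕ} (w : affSym d) : ℕ := wordLength (simples d) w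

theorem len_le {d : ℕ} {l : List (affSym d)} (hl : ∀ s ∈ l, s ∈ simples d) :
    len l.prod ≤ l.length :=
  Nat.sInf_le ⟨l, hl, rfl, rfl⟩

theorem exists_reduced {d : ℕ} (w : affSym d) :
    ∃ l : List (affSym d), (∀ s ∈ l, s ∈ simples d) ∧ l.prod = w ∧ l.length = len w := by
  obtain ⟨l, hl, hp⟩ := exists_word w
  exact Nat.sInf_mem (s := {k : ℕ | ∃ l : List (affSym d), (∀ s ∈ l, s ∈ simples d) ∧
    l.prod = w ∧ l.length = k}) ⟨_, l, hl, hp, rfl⟩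

theorem len_mul_le {d : ℕ} (v w : affSym d) : len (v * w) ≤ len v + len w := by
  obtain ⟨l, hl, hp, hn⟩ := exists_reduced v
  obtain ⟨l', hl', hp', hn'⟩ := exists_reduced w
  have := len_le (l := l ++ l') (by
    intro s hs
    rcases List.mem_append.1 hs with h | h
    · exact hl s h
    · exact hl' s h)
  rw [List.prod_append, hp, hp', List.length_append, hn, hn'] at this
  exact this

theorem len_one (d : ℕ) : len (1 : affSym d) = 0 := by
  have := len_le (d := d) (l := []) (by simp)
  simpa using this

theorem len_simple_le {d : ℕ} (hd : 2 ≤ d) (p : ℤ) : len (reflA d p (p + 1)) ≤ 1 := by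
  have := len_le (l := [reflA d p (p + 1)]) (by simp [reflA_succ_mem_simples hd p])
  simpa using this

/-- The pair `(i, j)` is followed through the suffixes of the word. The letter at which it becomes
inverted must exchange its two current values, hence is the conjugate of `refl d i j` by the suffix,
and deleting this letter multiplies the product by the reflection. -/
theorem strong_exchange {d : ℕ} (hd : 0 < d) {i j : ℤ} (hij : i < j)
    (hne : ¬ i ≡ j [ZMOD d]) (l : List (affSym d)) (hl : ∀ s ∈ l, s ∈ simples d)
    (h : ((l.prod : affSym d) : Equiv.Perm ℤ) j < ((l.prod : affSym d) : Equiv.Perm ℤ) i) :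
    ∃ l' : List (affSym d), (∀ s ∈ l', s ∈ simples d) ∧ l'.prod = l.prod * reflA d i j ∧
      l'.length < l.length := by
  induction l with
  | nil =>
    simp only [List.prod_nil, OneMemClass.coe_one, Equiv.Perm.one_apply] at h
    omega
  | cons s l ih =>
    have hl' : ∀ s ∈ l, s ∈ simples d := fun t ht => hl t (List.mem_cons_of_mem _ ht)
    set v : affSym d := l.prod with hv
    rcases lt_trichotomy ((v : Equiv.Perm ℤ) i) ((v : Equiv.Perm ℤ) j) with hlt | heq | hgt
    · obtain ⟨hd2, p, hp⟩ := mem_simples_iff.1 (hl s List.mem_cons_self)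
      have hpne := not_modEq_succ hd2 p
      refine ⟨l, hl', ?_, by simp⟩
      rw [List.prod_cons, ← hv]
      rw [List.prod_cons, ← hv, Subgroup.coe_mul, Equiv.Perm.mul_apply, Equiv.Perm.mul_apply, hp]
        at h
      change refl d p (p + 1) _ < refl d p (p + 1) _ at h
      have hvne : ¬ (v : Equiv.Perm ℤ) i ≡ (v : Equiv.Perm ℤ) j [ZMOD d] :=
        fun h2 => hne ((map_modEq_iff v.2.1).1 h2)
      -- A simple reflection reverses two incongruent values only if they are `p` and `p + 1` up to
      -- a common translation.
      have key : ∃ k : ℤ, (v : Equiv.Perm ℤ) i = p + k * d ∧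
          (v : Equiv.Perm ℤ) j = p + 1 + k * d := by
        rw [refl_apply hd hpne, refl_apply hd hpne] at h
        split_ifs at h with h1 h2 h3 h4 h5 h6 <;> try omega
        · obtain ⟨k, hk⟩ := modEq_iff_exists.1 h4
          exact ⟨k, by omega, by omega⟩
      obtain ⟨k, h1, h2⟩ := key
      apply Subtype.ext
      have e := mul_refl v.2.1 i j
      rw [h1, h2, refl_add_mul hd hpne] at e
      rw [Subgroup.coe_mul, Subgroup.coe_mul, mul_assoc]
      change _ = _ * (_ * refl d i j)
      rw [e, hp]
      change _ = refl d p (p + 1) * _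
      rw [← mul_assoc, refl_mul_self, one_mul]
    · exact absurd ((v : Equiv.Perm ℤ).injective heq) hij.ne
    · obtain ⟨l', h1, h2, h3⟩ := ih hl' hgt
      refine ⟨s :: l', ?_, ?_, by simpa using h3⟩
      · intro t ht
        rcases List.mem_cons.1 ht with rfl | ht
        · exact hl _ List.mem_cons_self
        · exact h1 t ht
      · rw [List.prod_cons, h2, List.prod_cons, mul_assoc]

theorem len_mul_reflA_lt {d : ℕ} (hd : 0 < d) {i j : ℤ} (hij : i < j) (hne : ¬ i ≡ j [ZMOD d])
    {w : affSym d} (h : (w : Equiv.Perm ℤ) j < (w : Equiv.Perm ℤ) i) :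
    len (w * reflA d i j) < len w := by
  obtain ⟨l, hl, hp, hn⟩ := exists_reduced w
  obtain ⟨l', h1, h2, h3⟩ := strong_exchange hd hij hne l hl (by rwa [hp])
  rw [hp] at h2
  have := len_le h1
  rw [h2] at this
  omega

theorem lt_len_mul_reflA {d : ℕ} (hd : 0 < d) {i j : ℤ} (hij : i < j) (hne : ¬ i ≡ j [ZMOD d])
    {w : affSym d} (h : (w : Equiv.Perm ℤ) i < (w : Equiv.Perm ℤ) j) :
    len w < len (w * reflA d i j) := by
  have := len_mul_reflA_lt hd hij hne (w := w * reflA d i j) (by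
    rw [coe_mul_reflA, Equiv.Perm.mul_apply, Equiv.Perm.mul_apply, refl_left hd hne,
      refl_right hd hne]
    exact h)
  rwa [mul_reflA_mul_reflA] at this

theorem len_lt_mul_reflA_iff {d : ℕ} (hd : 0 < d) {i j : ℤ} (hij : i < j)
    (hne : ¬ i ≡ j [ZMOD d]) {w : affSym d} :
    len w < len (w * reflA d i j) ↔ (w : Equiv.Perm ℤ) i < (w : Equiv.Perm ℤ) j := by
  refine ⟨fun h => ?_, lt_len_mul_reflA hd hij hne⟩
  by_contra! h2
  rcases h2.lt_or_eq with h2 | h2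
  · exact absurd (len_mul_reflA_lt hd hij hne h2) (by omega)
  · exact absurd ((w : Equiv.Perm ℤ).injective h2) hij.ne'

theorem len_mul_simple_lt_iff {d : ℕ} (hd : 2 ≤ d) {p : ℤ} {w : affSym d} :
    len (w * reflA d p (p + 1)) < len w ↔ (w : Equiv.Perm ℤ) (p + 1) < (w : Equiv.Perm ℤ) p := by
  refine ⟨fun h => ?_, len_mul_reflA_lt (by omega) (lt_add_one p) (not_modEq_succ hd p)⟩
  by_contra! h2
  rcases h2.lt_or_eq with h2 | h2
  · exact absurd (lt_len_mul_reflA (by omega) (lt_add_one p) (not_modEq_succ hd p) h2) (by omega)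
  · have := (w : Equiv.Perm ℤ).injective h2
    omega

theorem len_mul_simple_add_one {d : ℕ} (hd : 2 ≤ d) {p : ℤ} {w : affSym d}
    (h : (w : Equiv.Perm ℤ) (p + 1) < (w : Equiv.Perm ℤ) p) :
    len (w * reflA d p (p + 1)) + 1 = len w := by
  have h1 := (len_mul_simple_lt_iff hd).2 h
  have h2 := len_mul_le (w * reflA d p (p + 1)) (reflA d p (p + 1))
  rw [mul_reflA_mul_reflA] at h2
  have h3 := len_simple_le hd p
  omega

/-! ### Bruhat order -/

/-- For the converse, induction on `j - i`: conjugation by the simple reflection at `j - 1` brings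
the two indices closer together until they are adjacent. -/
theorem mem_reflections_iff {d : ℕ} {t : affSym d} :
    t ∈ reflections (simples d) ↔
      0 < d ∧ ∃ i j : ℤ, i < j ∧ ¬ i ≡ j [ZMOD d] ∧ t = reflA d i j := by
  constructor
  · rintro ⟨s, hs, u, rfl⟩
    obtain ⟨hd, p, rfl⟩ := mem_simples_iff.1 hs
    have hd0 : 0 < d := by omega
    refine ⟨hd0, ?_⟩
    have hne : ¬ (u : Equiv.Perm ℤ) p ≡ (u : Equiv.Perm ℤ) (p + 1) [ZMOD d] := fun h =>
      not_modEq_succ hd p ((map_modEq_iff u.2.1).1 h)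
    have e : u * reflA d p (p + 1) * u⁻¹
        = reflA d ((u : Equiv.Perm ℤ) p) ((u : Equiv.Perm ℤ) (p + 1)) := by
      rw [mul_inv_eq_iff_eq_mul]
      exact Subtype.ext (mul_refl u.2.1 p (p + 1))
    rcases lt_trichotomy ((u : Equiv.Perm ℤ) p) ((u : Equiv.Perm ℤ) (p + 1)) with h | h | h
    · exact ⟨_, _, h, hne, e⟩
    · exact absurd (h ▸ Int.ModEq.refl _) hne
    · exact ⟨_, _, h, fun h => hne h.symm, e.trans (Subtype.ext (refl_comm _ _))⟩
  · rintro ⟨hd, i, j, hij, hne, rfl⟩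
    have hd2 : 2 ≤ d := by
      by_contra! h
      have : d = 1 := by omega
      subst this
      exact hne (by simp [Int.ModEq])
    obtain ⟨n, hn⟩ : ∃ n : ℕ, j - i = n := ⟨(j - i).toNat, by omega⟩
    induction n using Nat.strong_induction_on generalizing i j with
    | _ n ih =>
      rcases eq_or_ne j (i + 1) with rfl | hj
      · exact ⟨_, reflA_succ_mem_simples hd2 i, 1, by simp⟩
      · set s := refl d (j - 1) (j - 1 + 1) with hs
        have hsn := not_modEq_succ hd2 (j - 1)
        have hsm : s ∈ extAffSym d := refl_mem_extAffSym _ _ _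
        have hsj : s j = j - 1 := by
          have := refl_right hd hsn
          rw [hs]
          rwa [sub_add_cancel] at this ⊢
        -- The index `i` moves only if it is congruent to `j - 1`, and then upwards; either way the
        -- distance to `j - 1` is smaller than `j - i`.
        have hsi : s i = i ∨ s i = i + 1 := by
          have hnj : ¬ i ≡ j - 1 + 1 [ZMOD d] := by rwa [sub_add_cancel]
          by_cases h : i ≡ j - 1 [ZMOD d]
          · right
            rw [hs, refl_apply hd hsn, if_pos h]
            ring
          · left
            exact refl_of_ne h hnj
        have hlt : s i < s j := by
          have hne2 : s i ≠ s j := fun h => hij.ne (s.injective h)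
          omega
        have hmod : ¬ s i ≡ s j [ZMOD d] := fun h => hne ((map_modEq_iff hsm).1 h)
        obtain ⟨s', hs', u, hu⟩ := ih ((s j - s i).toNat) (by omega) (s i) (s j) hlt hmod (by omega)
        refine ⟨s', hs', reflA d (j - 1) (j - 1 + 1) * u, ?_⟩
        rw [mul_inv_rev, ← mul_assoc, mul_assoc _ u s', mul_assoc _ (u * s') u⁻¹, ← hu,
          eq_mul_inv_iff_mul_eq]
        apply Subtype.ext
        change refl d i j * s = s * refl d (s i) (s j)
        rw [mul_refl hsm, hs, refl_refl_apply, refl_refl_apply]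

/-- The relation generating the Bruhat order, on permutations of `ℤ`. -/
def Up (d : ℕ) (x y : Equiv.Perm ℤ) : Prop :=
  ∃ i j : ℤ, i < j ∧ ¬ i ≡ j [ZMOD d] ∧ x i < x j ∧ y = x * refl d i j

theorem Up.mem {d : ℕ} {x y : Equiv.Perm ℤ} (h : Up d x y) (hx : x ∈ extAffSym d) :
    y ∈ extAffSym d := by
  obtain ⟨i, j, -, -, -, rfl⟩ := h
  exact mul_mem hx (refl_mem_extAffSym d i j)

theorem mem_of_reflTransGen_up {d : ℕ} {x y : Equiv.Perm ℤ} (h : ReflTransGen (Up d) x y)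
    (hx : x ∈ extAffSym d) : y ∈ extAffSym d := by
  induction h with
  | refl => exact hx
  | tail _ h ih => exact h.mem ih

theorem up_coe_iff {d : ℕ} (hd : 0 < d) {x y : affSym d} :
    Up d (x : Equiv.Perm ℤ) y ↔
      ∃ t ∈ reflections (simples d), y = x * t ∧ wordLength (simples d) x <
        wordLength (simples d) y := by
  constructor
  · rintro ⟨i, j, hij, hne, hlt, h⟩
    have h' : y = x * reflA d i j := Subtype.ext h
    refine ⟨reflA d i j, mem_reflections_iff.2 ⟨hd, i, j, hij, hne, rfl⟩, h', ?_⟩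
    rw [h']
    exact lt_len_mul_reflA hd hij hne hlt
  · rintro ⟨t, ht, rfl, hlt⟩
    obtain ⟨-, i, j, hij, hne, rfl⟩ := mem_reflections_iff.1 ht
    exact ⟨i, j, hij, hne, (len_lt_mul_reflA_iff hd hij hne).1 hlt, rfl⟩

theorem bruhatLE_iff {d : ℕ} (hd : 0 < d) {x y : affSym d} :
    BruhatLE (simples d) x y ↔ ReflTransGen (Up d) (x : Equiv.Perm ℤ) y := by
  constructor
  · intro h
    exact ReflTransGen.lift (fun z : affSym d => (z : Equiv.Perm ℤ))
      (fun a b hab => (up_coe_iff hd).2 hab) x y h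
  · intro h
    -- The intermediate permutations of a chain are not known in advance to lie in `affSym d`, so
    -- membership is carried through the induction.
    suffices H : ∀ z : Equiv.Perm ℤ, ReflTransGen (Up d) (x : Equiv.Perm ℤ) z →
        ∃ hz : z ∈ affSym d, BruhatLE (simples d) x ⟨z, hz⟩ from (H _ h).2
    intro z hz
    induction hz with
    | refl => exact ⟨x.2, ReflTransGen.refl⟩
    | tail _ hstep ih =>
      obtain ⟨hz, ih⟩ := ih
      obtain ⟨i, j, hij, hne, hlt, rfl⟩ := hstep
      exact ⟨mul_mem hz (refl_mem_affSym d i j),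
        ih.tail ((up_coe_iff hd).1 ⟨i, j, hij, hne, hlt, rfl⟩)⟩

theorem Up.mul_left {d : ℕ} {x y : Equiv.Perm ℤ} (k : ℤ) (h : Up d x y) :
    Up d (shift k * x) (shift k * y) := by
  obtain ⟨i, j, hij, hne, hlt, rfl⟩ := h
  refine ⟨i, j, hij, hne, ?_, by rw [mul_assoc]⟩
  simp only [Equiv.Perm.mul_apply, shift_apply]
  omega

theorem reflTransGen_up_shift_mul_iff {d : ℕ} {x y : Equiv.Perm ℤ} (k : ℤ) :
    ReflTransGen (Up d) (shift k * x) (shift k * y) ↔ ReflTransGen (Up d) x y := by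
  have key : ∀ (k : ℤ) (x y : Equiv.Perm ℤ), ReflTransGen (Up d) x y →
      ReflTransGen (Up d) (shift k * x) (shift k * y) := fun k x y h =>
    ReflTransGen.lift (shift k * ·) (fun _ _ hab => Up.mul_left k hab) x y h
  have hinv : ∀ z : Equiv.Perm ℤ, shift (-k) * (shift k * z) = z := fun z => by
    ext i
    simp [shift_apply]
  refine ⟨fun h => ?_, key k x y⟩
  have := key (-k) _ _ h
  rwa [hinv, hinv] at this

/-- A reflection has total displacement zero over a period, and the displacement of `z` is periodic;
so right multiplication by a reflection does not change the sum of values over a period. -/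
theorem offset_eq_of_reflTransGen_up {d : ℕ} {x y : extAffSym d}
    (h : ReflTransGen (Up d) (x : Equiv.Perm ℤ) y) : offset x = offset y := by
  suffices H : ∀ z : Equiv.Perm ℤ, ReflTransGen (Up d) (x : Equiv.Perm ℤ) z →
      ∃ hz : z ∈ extAffSym d, offset x = offset ⟨z, hz⟩ from (H _ h).2
  intro z hz
  induction hz with
  | refl => exact ⟨x.2, rfl⟩
  | tail _ hstep ih =>
    obtain ⟨hz, ih⟩ := ih
    obtain ⟨i, j, hij, hne, hlt, rfl⟩ := hstep
    refine ⟨mul_mem hz (refl_mem_extAffSym d i j), ih.trans ?_⟩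
    have h1 := sum_comp_of_periodic (refl_mem_extAffSym d i j) _ (displacement_periodic hz)
    have h2 := (refl_mem_affSym d i j).2
    rw [Finset.sum_sub_distrib, Finset.sum_sub_distrib] at h1
    unfold offset
    simp only [Equiv.Perm.mul_apply]
    congr 1
    linarith

theorem coe_affPart {d : ℕ} (w : extAffSym d) :
    (affPart w : Equiv.Perm ℤ) = shift (-offset w) * w := rfl

/-- Chains preserve the offset and are compatible with translation on the left, so normalising to
offset zero becomes invisible and the order can be studied on bare permutations. -/
theorem extBruhatLE_iff {d : ℕ} (hd : 0 < d) {x y : extAffSym d} :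
    ExtBruhatLE x y ↔ ReflTransGen (Up d) (x : Equiv.Perm ℤ) y := by
  constructor
  · rintro ⟨h1, h2⟩
    rw [bruhatLE_iff hd, coe_affPart, coe_affPart, h1, reflTransGen_up_shift_mul_iff] at h2
    exact h2
  · intro h
    have h1 := offset_eq_of_reflTransGen_up h
    refine ⟨h1, ?_⟩
    rwa [bruhatLE_iff hd, coe_affPart, coe_affPart, h1, reflTransGen_up_shift_mul_iff]

end AffineKL

namespace AffineKL

open Relation Polynomial

/-! ### The `R`-polynomials -/

/-- The operator by which `R_{·,w}` is obtained from `R_{·,ws}`, where `s = s_p`, `ws < w`. -/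
noncomputable def demazureOp {d : ℕ} (p : ℤ) (f : affSym d → ℤ[X]) (x : affSym d) : ℤ[X] :=
  if (x : Equiv.Perm ℤ) (p + 1) < (x : Equiv.Perm ℤ) p then f (x * reflA d p (p + 1))
  else X * f (x * reflA d p (p + 1)) + (X - 1) * f x

theorem mul_reflA_left {d : ℕ} (hd : 2 ≤ d) (x : affSym d) (p : ℤ) :
    ((x * reflA d p (p + 1) : affSym d) : Equiv.Perm ℤ) p = (x : Equiv.Perm ℤ) (p + 1) := by
  rw [coe_mul_reflA, Equiv.Perm.mul_apply, refl_left (by omega) (not_modEq_succ hd p)]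

theorem mul_reflA_right {d : ℕ} (hd : 2 ≤ d) (x : affSym d) (p : ℤ) :
    ((x * reflA d p (p + 1) : affSym d) : Equiv.Perm ℤ) (p + 1) = (x : Equiv.Perm ℤ) p := by
  rw [coe_mul_reflA, Equiv.Perm.mul_apply, refl_right (by omega) (not_modEq_succ hd p)]

theorem mul_reflA_of_ne {d : ℕ} (x : affSym d) {p q : ℤ} (h1 : ¬ q ≡ p [ZMOD d])
    (h2 : ¬ q ≡ p + 1 [ZMOD d]) :
    ((x * reflA d p (p + 1) : affSym d) : Equiv.Perm ℤ) q = (x : Equiv.Perm ℤ) q := by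
  rw [coe_mul_reflA, Equiv.Perm.mul_apply, refl_of_ne h1 h2]

theorem apply_ne_apply_succ {d : ℕ} (x : affSym d) (p : ℤ) :
    (x : Equiv.Perm ℤ) p ≠ (x : Equiv.Perm ℤ) (p + 1) := fun h => by
  have := (x : Equiv.Perm ℤ).injective h
  omega

theorem not_modEq_add_two {d : ℕ} (hd : 3 ≤ d) (p : ℤ) : ¬ p ≡ p + 1 + 1 [ZMOD d] := fun h => by
  rw [Int.modEq_iff_dvd] at h
  have := Int.le_of_dvd (by omega) h
  omega

theorem mul_reflA_comm {d : ℕ} {p q : ℤ} (h1 : ¬ p ≡ q [ZMOD d]) (h2 : ¬ p ≡ q + 1 [ZMOD d])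
    (h3 : ¬ p + 1 ≡ q [ZMOD d]) (x : affSym d) :
    x * reflA d p (p + 1) * reflA d q (q + 1) = x * reflA d q (q + 1) * reflA d p (p + 1) := by
  have h4 : ¬ p + 1 ≡ q + 1 [ZMOD d] := fun h => h1 (Int.ModEq.add_right_cancel' _ h)
  rw [mul_assoc, mul_assoc]
  congr 1
  apply Subtype.ext
  change refl d p (p + 1) * refl d q (q + 1) = refl d q (q + 1) * refl d p (p + 1)
  rw [mul_refl (refl_mem_extAffSym _ _ _), refl_of_ne (fun h => h1 h.symm) (fun h => h3 h.symm),
    refl_of_ne (fun h => h2 h.symm) (fun h => h4 h.symm)]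

/-- Both triple products are the reflection exchanging `p` and `p + 2`; for `d ≥ 3` these are
incongruent. -/
theorem mul_reflA_braid {d : ℕ} (hd : 3 ≤ d) (p : ℤ) (x : affSym d) :
    x * reflA d (p + 1) (p + 1 + 1) * reflA d p (p + 1) * reflA d (p + 1) (p + 1 + 1)
      = x * reflA d p (p + 1) * reflA d (p + 1) (p + 1 + 1) * reflA d p (p + 1) := by
  have hd0 : 0 < d := by omega
  have h1 := not_modEq_succ (show 2 ≤ d by omega) p
  have h2 := not_modEq_succ (show 2 ≤ d by omega) (p + 1)
  have h3 := not_modEq_add_two hd p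
  simp only [mul_assoc]
  congr 1
  apply Subtype.ext
  change refl d (p + 1) (p + 1 + 1) * (refl d p (p + 1) * refl d (p + 1) (p + 1 + 1))
    = refl d p (p + 1) * (refl d (p + 1) (p + 1 + 1) * refl d p (p + 1))
  have e1 := mul_refl (refl_mem_extAffSym d (p + 1) (p + 1 + 1)) p (p + 1)
  rw [refl_of_ne h1 h3, refl_left hd0 h2] at e1
  have e2 := mul_refl (refl_mem_extAffSym d p (p + 1)) (p + 1) (p + 1 + 1)
  rw [refl_right hd0 h1, refl_of_ne (fun h => h3 h.symm) (fun h => h2 h.symm)] at e2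
  rw [← mul_assoc, ← mul_assoc, e1, e2, mul_assoc, refl_mul_self, mul_assoc, refl_mul_self]

theorem demazureOp_comm {d : ℕ} {p q : ℤ} (h1 : ¬ p ≡ q [ZMOD d])
    (h2 : ¬ p ≡ q + 1 [ZMOD d]) (h3 : ¬ p + 1 ≡ q [ZMOD d]) (f : affSym d → ℤ[X])
    (x : affSym d) : demazureOp p (demazureOp q f) x = demazureOp q (demazureOp p f) x := by
  have h4 : ¬ p + 1 ≡ q + 1 [ZMOD d] := fun h => h1 (Int.ModEq.add_right_cancel' _ h)
  simp only [demazureOp, mul_reflA_of_ne _ h1 h2, mul_reflA_of_ne _ h3 h4,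
    mul_reflA_of_ne _ (fun h => h1 (Int.ModEq.symm h)) (fun h => h3 (Int.ModEq.symm h)),
    mul_reflA_of_ne _ (fun h => h2 (Int.ModEq.symm h)) (fun h => h4 (Int.ModEq.symm h)),
    mul_reflA_comm h1 h2 h3]
  split_ifs <;> ring

/-- For each relative order of the values of `x` at `p`, `p + 1`, `p + 2` this is a polynomial
identity in the values of `f` on the coset of `x` under the two simple reflections. -/
theorem demazureOp_braid {d : ℕ} (hd : 3 ≤ d) (p : ℤ) (f : affSym d → ℤ[X])
    (x : affSym d) :
    demazureOp p (demazureOp (p + 1) (demazureOp p f)) x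
      = demazureOp (p + 1) (demazureOp p (demazureOp (p + 1) f)) x := by
  have hd2 : 2 ≤ d := by omega
  have hd0 : 0 < d := by omega
  have h1 := not_modEq_succ hd2 p
  have h2 := not_modEq_succ hd2 (p + 1)
  have h3 := not_modEq_add_two hd p
  have v1 := fun x : affSym d => mul_reflA_left hd2 x p
  have v2 := fun x : affSym d => mul_reflA_right hd2 x p
  have v3 := fun x : affSym d => mul_reflA_of_ne x (p := p) (q := p + 1 + 1)
    (fun h => h3 h.symm) (fun h => h2 h.symm)
  have v4 := fun x : affSym d => mul_reflA_left hd2 x (p + 1)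
  have v5 := fun x : affSym d => mul_reflA_right hd2 x (p + 1)
  have v6 := fun x : affSym d => mul_reflA_of_ne x (p := p + 1) (q := p) h1 h3
  have n1 := apply_ne_apply_succ x p
  have n2 := apply_ne_apply_succ x (p + 1)
  have n3 : (x : Equiv.Perm ℤ) p ≠ (x : Equiv.Perm ℤ) (p + 1 + 1) := fun h => by
    have := (x : Equiv.Perm ℤ).injective h
    omega
  simp only [demazureOp, v1, v2, v3, v4, v5, v6, mul_reflA_mul_reflA,
    mul_reflA_braid hd]
  split_ifs <;> first | omega | ring

open Classical in
theorem rPoly_one {d : ℕ} (x : affSym d) :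
    rPoly (simples d) x 1 = if x = 1 then 1 else 0 := by
  have h : ¬ ∃ s ∈ simples d, wordLength (simples d) (1 * s) < wordLength (simples d) 1 := by
    rintro ⟨s, -, hs⟩
    exact absurd hs (by rw [show wordLength (simples d) 1 = 0 from len_one d]; omega)
  rw [rPoly, dif_neg h]
  congr

theorem exists_rPoly_eq {d : ℕ} {w : affSym d} (hw : w ≠ 1) :
    ∃ p : ℤ, (w : Equiv.Perm ℤ) (p + 1) < (w : Equiv.Perm ℤ) p ∧ ∀ x,
      rPoly (simples d) x w
        = demazureOp p (fun z => rPoly (simples d) z (w * reflA d p (p + 1))) x := by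
  obtain ⟨hd, p, hp⟩ := exists_descent hw
  have h : ∃ s ∈ simples d, wordLength (simples d) (w * s) < wordLength (simples d) w :=
    ⟨_, reflA_succ_mem_simples hd p, (len_mul_simple_lt_iff hd).2 hp⟩
  obtain ⟨-, q, hq⟩ := mem_simples_iff.1 h.choose_spec.1
  have hlt := h.choose_spec.2
  rw [hq] at hlt
  refine ⟨q, (len_mul_simple_lt_iff hd).1 hlt, fun x => ?_⟩
  conv_lhs => rw [rPoly, dif_pos h]
  rw [hq, demazureOp]
  simp only [show wordLength (simples d) (x * reflA d q (q + 1)) < wordLength (simples d) x ↔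
    (x : Equiv.Perm ℤ) (q + 1) < (x : Equiv.Perm ℤ) q from len_mul_simple_lt_iff hd]

theorem reflA_succ_congr {d : ℕ} (hd : 2 ≤ d) {p q : ℤ} (h : p ≡ q [ZMOD d]) :
    reflA d p (p + 1) = reflA d q (q + 1) := by
  obtain ⟨k, rfl⟩ := modEq_iff_exists.1 h
  apply Subtype.ext
  change refl d _ _ = refl d _ _
  rw [show q + k * d + 1 = q + 1 + k * d by ring, refl_add_mul (by omega) (not_modEq_succ hd q)]

theorem demazureOp_congr {d : ℕ} (hd : 2 ≤ d) {p q : ℤ} (h : p ≡ q [ZMOD d])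
    (f : affSym d → ℤ[X]) : demazureOp p f = demazureOp q f := by
  funext x
  unfold demazureOp
  rw [reflA_succ_congr hd h]
  obtain ⟨k, rfl⟩ := modEq_iff_exists.1 h
  simp only [show q + k * d + 1 = q + 1 + k * d by ring, map_add_mul x.2.1,
    add_lt_add_iff_right]

theorem descent_congr {d : ℕ} (w : affSym d) {p q : ℤ} (h : p ≡ q [ZMOD d]) :
    (w : Equiv.Perm ℤ) (p + 1) < (w : Equiv.Perm ℤ) p ↔
      (w : Equiv.Perm ℤ) (q + 1) < (w : Equiv.Perm ℤ) q := by
  obtain ⟨k, rfl⟩ := modEq_iff_exists.1 h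
  rw [show q + k * d + 1 = q + 1 + k * d by ring, map_add_mul w.2.1, map_add_mul w.2.1]
  simp only [add_lt_add_iff_right]

/-- The recursion for `R`-polynomials holds for every descent of `w`. -/
theorem rPoly_eq_demazureOp {d : ℕ} {w : affSym d} {p : ℤ}
    (hp : (w : Equiv.Perm ℤ) (p + 1) < (w : Equiv.Perm ℤ) p) (x : affSym d) :
    rPoly (simples d) x w
      = demazureOp p (fun z => rPoly (simples d) z (w * reflA d p (p + 1))) x := by
  induction hn : len w using Nat.strong_induction_on generalizing w p x with
  | _ n ih =>
    have hw : w ≠ 1 := by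
      rintro rfl
      simp at hp
    have hd2 := (exists_descent hw).1
    have hd0 : 0 < d := by omega
    -- two descents `p`, `p + 1`
    have braid : ∀ p : ℤ, (w : Equiv.Perm ℤ) (p + 1) < (w : Equiv.Perm ℤ) p →
        (w : Equiv.Perm ℤ) (p + 1 + 1) < (w : Equiv.Perm ℤ) (p + 1) →
        demazureOp p (fun z => rPoly (simples d) z (w * reflA d p (p + 1)))
          = demazureOp (p + 1)
            (fun z => rPoly (simples d) z (w * reflA d (p + 1) (p + 1 + 1))) := by
      intro p h1 h2
      -- For `d = 2` two consecutive descents would give `w (p + 2) < w p`, against `w (p + 2) = w p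
      -- + 2`.
      have hd3 : 3 ≤ d := by
        by_contra! h
        have h5 : (d : ℤ) = 2 := by omega
        have := w.2.1.1 p
        rw [h5, show p + 2 = p + 1 + 1 by ring] at this
        omega
      have hne := not_modEq_succ hd2 p
      have hne2 := not_modEq_succ hd2 (p + 1)
      have hne3 := not_modEq_add_two hd3 p
      have v3 := fun x : affSym d => mul_reflA_of_ne x (p := p) (q := p + 1 + 1)
        (fun h => hne3 h.symm) (fun h => hne2 h.symm)
      have v6 := fun x : affSym d => mul_reflA_of_ne x (p := p + 1) (q := p) hne hne3
      have l1 := len_mul_simple_add_one hd2 h1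
      have l2 := len_mul_simple_add_one hd2 h2
      have a1 : ((w * reflA d p (p + 1) : affSym d) : Equiv.Perm ℤ) (p + 1 + 1)
          < ((w * reflA d p (p + 1) : affSym d) : Equiv.Perm ℤ) (p + 1) := by
        rw [v3, mul_reflA_right hd2]
        omega
      have l3 := len_mul_simple_add_one hd2 a1
      have a2 : ((w * reflA d p (p + 1) * reflA d (p + 1) (p + 1 + 1) : affSym d) :
            Equiv.Perm ℤ) (p + 1)
          < ((w * reflA d p (p + 1) * reflA d (p + 1) (p + 1 + 1) : affSym d) :
            Equiv.Perm ℤ) p := by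
        rw [v6, mul_reflA_left hd2, v3, mul_reflA_left hd2]
        omega
      have b1 : ((w * reflA d (p + 1) (p + 1 + 1) : affSym d) : Equiv.Perm ℤ) (p + 1)
          < ((w * reflA d (p + 1) (p + 1 + 1) : affSym d) : Equiv.Perm ℤ) p := by
        rw [v6, mul_reflA_left hd2]
        omega
      have l4 := len_mul_simple_add_one hd2 b1
      have b2 : ((w * reflA d (p + 1) (p + 1 + 1) * reflA d p (p + 1) : affSym d) :
            Equiv.Perm ℤ) (p + 1 + 1)
          < ((w * reflA d (p + 1) (p + 1 + 1) * reflA d p (p + 1) : affSym d) :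
            Equiv.Perm ℤ) (p + 1) := by
        rw [v3, mul_reflA_right hd2 _ (p + 1), mul_reflA_right hd2 _ p, v6]
        omega
      funext z
      -- From either descent two further ones can be removed, by the induction hypothesis; the two
      -- paths end at the same element by the braid relation.
      have r1 : (fun z => rPoly (simples d) z (w * reflA d p (p + 1)))
          = demazureOp (p + 1) (demazureOp p (fun z => rPoly (simples d) z
            (w * reflA d p (p + 1) * reflA d (p + 1) (p + 1 + 1) * reflA d p (p + 1)))) := by
        funext z
        rw [ih _ (by omega) a1 z rfl]
        congr 1
        funext z
        exact ih _ (by omega) a2 z rfl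
      have r2 : (fun z => rPoly (simples d) z (w * reflA d (p + 1) (p + 1 + 1)))
          = demazureOp p (demazureOp (p + 1) (fun z => rPoly (simples d) z
            (w * reflA d (p + 1) (p + 1 + 1) * reflA d p (p + 1)
              * reflA d (p + 1) (p + 1 + 1)))) := by
        funext z
        rw [ih _ (by omega) b1 z rfl]
        congr 1
        funext z
        exact ih _ (by omega) b2 z rfl
      rw [r1, r2, demazureOp_braid hd3, mul_reflA_braid hd3]
    -- The definition uses some descent `q`. Modulo `d`, the given `p` equals `q`, is adjacent to it
    -- on one side or the other, or gives a commuting reflection.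
    obtain ⟨q, hq, hR⟩ := exists_rPoly_eq hw
    rw [hR x]
    by_cases h1 : p ≡ q [ZMOD d]
    · rw [demazureOp_congr hd2 h1, reflA_succ_congr hd2 h1]
    by_cases h2 : p ≡ q + 1 [ZMOD d]
    · rw [demazureOp_congr hd2 h2, reflA_succ_congr hd2 h2,
        braid q hq ((descent_congr w h2).1 hp)]
    by_cases h3 : p + 1 ≡ q [ZMOD d]
    · rw [braid p hp ((descent_congr w h3).2 hq), demazureOp_congr hd2 h3,
        reflA_succ_congr hd2 h3]
    have h4 : ¬ p + 1 ≡ q + 1 [ZMOD d] := fun h => h1 (Int.ModEq.add_right_cancel' _ h)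
    have a1 : ((w * reflA d p (p + 1) : affSym d) : Equiv.Perm ℤ) (q + 1)
        < ((w * reflA d p (p + 1) : affSym d) : Equiv.Perm ℤ) q := by
      rwa [mul_reflA_of_ne _ (fun h => h1 h.symm) (fun h => h3 h.symm),
        mul_reflA_of_ne _ (fun h => h2 h.symm) (fun h => h4 h.symm)]
    have b1 : ((w * reflA d q (q + 1) : affSym d) : Equiv.Perm ℤ) (p + 1)
        < ((w * reflA d q (q + 1) : affSym d) : Equiv.Perm ℤ) p := by
      rwa [mul_reflA_of_ne _ h1 h2, mul_reflA_of_ne _ h3 h4]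
    have l1 := len_mul_simple_add_one hd2 hp
    have l2 := len_mul_simple_add_one hd2 hq
    have r1 : (fun z => rPoly (simples d) z (w * reflA d p (p + 1)))
        = demazureOp q (fun z => rPoly (simples d) z
          (w * reflA d p (p + 1) * reflA d q (q + 1))) :=
      funext fun z => ih _ (by omega) a1 z rfl
    have r2 : (fun z => rPoly (simples d) z (w * reflA d q (q + 1)))
        = demazureOp p (fun z => rPoly (simples d) z
          (w * reflA d q (q + 1) * reflA d p (p + 1))) :=
      funext fun z => ih _ (by omega) b1 z rfl
    rw [r1, r2, demazureOp_comm h1 h2 h3, mul_reflA_comm h1 h2 h3]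

/-- A simple reflection only exchanges the order of adjacent integers. -/
theorem of_not_refl_succ_lt {d : ℕ} (hd : 2 ≤ d) {p i j : ℤ} (hij : i < j)
    (h : ¬ refl d p (p + 1) i < refl d p (p + 1) j) : j = i + 1 ∧ i ≡ p [ZMOD d] := by
  have hd0 : 0 < d := by omega
  have hpne := not_modEq_succ hd p
  rw [refl_apply hd0 hpne, refl_apply hd0 hpne] at h
  split_ifs at h with h1 h2 h3 h4 h5 h6 <;> try omega
  · rcases (show j = i + 1 ∨ j = i + 2 by omega) with h | h
    · exact ⟨h, h1⟩
    · subst h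
      have h7 := (h1.add_right 2).symm.trans h3
      exact absurd (show p + 1 ≡ p + 1 + 1 [ZMOD d] by
        rw [add_assoc]; exact h7.symm) (not_modEq_succ hd _)
  · exact ⟨by omega, h1⟩
  · have h7 : i = j - 1 := by omega
    refine absurd ?_ h1
    rw [h7]
    rename_i h8
    simpa using h8.sub_right 1

/-- If `u ≤ v` then `us ≤ v` or `us ≤ vs`. -/
theorem reflTransGen_up_mul_simple {d : ℕ} (hd : 2 ≤ d) {u v : Equiv.Perm ℤ} (p : ℤ)
    (h : ReflTransGen (Up d) u v) :
    ReflTransGen (Up d) (u * refl d p (p + 1)) v ∨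
      ReflTransGen (Up d) (u * refl d p (p + 1)) (v * refl d p (p + 1)) := by
  have hd0 : 0 < d := by omega
  have hpne := not_modEq_succ hd p
  induction h using ReflTransGen.head_induction_on with
  | refl => exact Or.inr ReflTransGen.refl
  | head hstep hrest ih =>
    rename_i u u'
    obtain ⟨i, j, hij, hne, hlt, rfl⟩ := hstep
    set s := refl d p (p + 1) with hs
    have hsm : s ∈ extAffSym d := refl_mem_extAffSym _ _ _
    -- If `s` keeps the order of `i` and `j`, the first step of the chain can be conjugated by `s`.
    -- If not, `s` is the reflection of that step, and the rest of the chain already starts at `u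
    -- s`.
    by_cases hsij : s i < s j
    · have hup : Up d (u * s) (u * refl d i j * s) := by
        refine ⟨s i, s j, hsij, fun h => hne ((map_modEq_iff hsm).1 h), ?_, ?_⟩
        · simpa [hs, refl_refl_apply] using hlt
        · have := mul_refl hsm (s i) (s j)
          rw [hs, refl_refl_apply, refl_refl_apply, ← hs] at this
          rw [mul_assoc, mul_assoc, this]
      rcases ih with ih | ih
      · exact Or.inl (ReflTransGen.head hup ih)
      · exact Or.inr (ReflTransGen.head hup ih)
    · left
      obtain ⟨rfl, h1⟩ := of_not_refl_succ_lt hd hij hsij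
      obtain ⟨k, rfl⟩ := modEq_iff_exists.1 h1
      have key : refl d (p + k * d) (p + k * d + 1) = s := by
        rw [hs, show p + k * d + 1 = p + 1 + k * d by ring, refl_add_mul hd0 hpne]
      rwa [key] at hrest

/-- If `R_{x,w}` is nonzero, then so is a term of its recursion along a descent of `w`; the lifting
property `reflTransGen_up_mul_simple` turns `xs ≤ ws` into `x ≤ w`. -/
theorem reflTransGen_up_of_rPoly_ne_zero {d : ℕ} {x w : affSym d}
    (h : rPoly (simples d) x w ≠ 0) : ReflTransGen (Up d) (x : Equiv.Perm ℤ) w := by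
  induction hn : len w using Nat.strong_induction_on generalizing w x with
  | _ n ih =>
    by_cases hw : w = 1
    · subst hw
      rw [rPoly_one] at h
      have : x = 1 := by
        by_contra h1
        exact h (if_neg h1)
      rw [this]
    · obtain ⟨hd, p, hp⟩ := exists_descent hw
      have hd0 : 0 < d := by omega
      have hne := not_modEq_succ hd p
      have hl := len_mul_simple_add_one hd hp
      rw [rPoly_eq_demazureOp hp, demazureOp] at h
      have hup : ∀ y : affSym d, ¬ (y : Equiv.Perm ℤ) (p + 1) < (y : Equiv.Perm ℤ) p →
          Up d (y : Equiv.Perm ℤ) ((y * reflA d p (p + 1) : affSym d) : Equiv.Perm ℤ) := by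
        intro y hy
        refine ⟨p, p + 1, lt_add_one p, hne, ?_, rfl⟩
        have := apply_ne_apply_succ y p
        omega
      have hwup : Up d ((w * reflA d p (p + 1) : affSym d) : Equiv.Perm ℤ) w := by
        have := hup (w * reflA d p (p + 1)) (by
          rw [mul_reflA_left hd, mul_reflA_right hd]
          omega)
        rwa [mul_reflA_mul_reflA] at this
      split_ifs at h with hx
      · have h1 := ih _ (by omega) h rfl
        rcases reflTransGen_up_mul_simple hd p h1 with h2 | h2
        · rw [coe_mul_reflA, mul_assoc, refl_mul_self, mul_one] at h2
          exact h2.tail hwup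
        · rw [coe_mul_reflA, coe_mul_reflA, mul_assoc, refl_mul_self, mul_one, mul_assoc,
            refl_mul_self, mul_one] at h2
          exact h2
      · by_cases h1 : rPoly (simples d) x (w * reflA d p (p + 1)) = 0
        · rw [h1, mul_zero, add_zero] at h
          have h2 := ih _ (by omega) (right_ne_zero_of_mul h) rfl
          exact (ReflTransGen.head (hup x hx) h2).tail hwup
        · exact (ih _ (by omega) h1 rfl).tail hwup

/-! ### Rank functions -/

/-- The number of `r ≤ p` with `w r > q`. -/
noncomputable def rk (w : Equiv.Perm ℤ) (p q : ℤ) : ℕ := {r : ℤ | r ≤ p ∧ q < w r}.ncard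

theorem exists_displacement_bound {d : ℕ} (hd : 0 < d) {w : Equiv.Perm ℤ}
    (hw : w ∈ extAffSym d) : ∃ D : ℤ, ∀ i, |w i - i| ≤ D := by
  refine ⟨∑ k ∈ Finset.Ico (0 : ℤ) d, |w k - k|, fun i => ?_⟩
  have h1 : i % (d : ℤ) ∈ Finset.Ico (0 : ℤ) d := by
    rw [Finset.mem_Ico]
    exact ⟨Int.emod_nonneg _ (by omega), Int.emod_lt_of_pos _ (by omega)⟩
  have h2 := Finset.single_le_sum (f := fun k : ℤ => |w k - k|) (fun _ _ => abs_nonneg _) h1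
  have h3 := map_add_mul hw (i % d) (i / d)
  have h4 : i % (d : ℤ) + i / d * d = i := by rw [mul_comm]; exact Int.emod_add_mul_ediv i d
  rw [h4] at h3
  rw [show w i - i = w (i % d) - i % d by linarith]
  exact h2

/-- Periodicity bounds the displacement. Without finiteness `Set.ncard` would return the default
value `0` and ranks would carry no information. -/
theorem rk_finite {d : ℕ} (hd : 0 < d) {w : Equiv.Perm ℤ} (hw : w ∈ extAffSym d) (p q : ℤ) :
    {r : ℤ | r ≤ p ∧ q < w r}.Finite := by
  obtain ⟨D, hD⟩ := exists_displacement_bound hd hw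
  refine (Set.finite_Icc (q - D) p).subset fun r hr => ?_
  have h := abs_le.1 (hD r)
  have h1 := hr.1
  have h2 := hr.2
  rw [Set.mem_Icc]
  omega

theorem rk_eq_add {d : ℕ} (hd : 0 < d) {w : Equiv.Perm ℤ} (hw : w ∈ extAffSym d) (p q : ℤ) :
    rk w p q = rk w (p - 1) q + if q < w p then 1 else 0 := by
  unfold rk
  split_ifs with h
  · have e : {r : ℤ | r ≤ p ∧ q < w r} = insert p {r : ℤ | r ≤ p - 1 ∧ q < w r} := by
      ext r
      simp only [Set.mem_ofPred_eq, Set.mem_insert_iff]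
      constructor
      · rintro ⟨h1, h2⟩
        by_cases hr : r = p
        · exact Or.inl hr
        · exact Or.inr ⟨by omega, h2⟩
      · rintro (rfl | ⟨h1, h2⟩)
        · exact ⟨le_rfl, h⟩
        · exact ⟨by omega, h2⟩
    rw [e, Set.ncard_insert_of_notMem (by simp) (rk_finite hd hw _ _)]
  · congr 1
    ext r
    simp only [Set.mem_ofPred_eq]
    constructor
    · rintro ⟨h1, h2⟩
      refine ⟨?_, h2⟩
      have : r ≠ p := by
        rintro rfl
        exact h h2
      omega
    · rintro ⟨h1, h2⟩
      exact ⟨by omega, h2⟩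

theorem rk_sub_one {w : Equiv.Perm ℤ} {a b : ℤ} (h : w a = b) :
    rk w (a - 1) (b - 1) = rk w (a - 1) b := by
  unfold rk
  congr 1
  ext r
  simp only [Set.mem_ofPred_eq]
  refine and_congr_right fun hr => ?_
  have : w r ≠ b := fun h2 => by
    have := w.injective (h2.trans h.symm)
    omega
  omega

/-- A counted position `r` of `x` can drop out for `y = x t` only if it is the larger member of a
pair exchanged by `t`. Its partner `t r` is then smaller and carries the value `x r`, so it replaces
`r` in the count for `y`. -/
theorem rk_le_of_up {d : ℕ} (hd : 0 < d) {x y : Equiv.Perm ℤ} (hx : x ∈ extAffSym d)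
    (h : Up d x y) (p q : ℤ) : rk x p q ≤ rk y p q := by
  have hy := h.mem hx
  obtain ⟨i, j, hij, hne, hlt, rfl⟩ := h
  set t := refl d i j with ht
  have htm : t ∈ extAffSym d := refl_mem_extAffSym d i j
  have key : ∀ r, ¬ q < x (t r) → q < x r → t r < r := by
    intro r h1 h2
    by_cases hi : r ≡ i [ZMOD d]
    · obtain ⟨k, rfl⟩ := modEq_iff_exists.1 hi
      rw [map_add_mul htm, map_add_mul hx, refl_left hd hne] at h1
      rw [map_add_mul hx] at h2
      omega
    · by_cases hj : r ≡ j [ZMOD d]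
      · obtain ⟨k, rfl⟩ := modEq_iff_exists.1 hj
        rw [map_add_mul htm, refl_right hd hne]
        omega
      · rw [ht, refl_of_ne hi hj] at h1
        exact absurd h2 h1
  refine Set.ncard_le_ncard_of_injOn (fun r => if q < x (t r) then r else t r) ?_ ?_
    (rk_finite hd hy p q)
  · rintro r ⟨h1, h2⟩
    simp only [Set.mem_ofPred_eq, Equiv.Perm.mul_apply]
    split_ifs with h3
    · exact ⟨h1, h3⟩
    · rw [ht, refl_refl_apply, ← ht]
      exact ⟨by have := key r h3 h2; omega, h2⟩
  · rintro r ⟨h1, h2⟩ r' ⟨h1', h2'⟩ he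
    simp only at he
    split_ifs at he with h3 h4 h4
    · exact he
    · rw [he, ht, refl_refl_apply] at h3
      have := key r' h4 h2'
      have e : t r = r' := by rw [he, ht, refl_refl_apply]
      have h5 : q < x (t r) := by rw [e]; exact h2'
      exfalso
      by_cases hi : r' ≡ i [ZMOD d]
      · obtain ⟨k, rfl⟩ := modEq_iff_exists.1 hi
        rw [map_add_mul htm, refl_left hd hne] at this
        omega
      · rw [he] at h2
        exact h4 h2
    · have e : t r' = r := by rw [← he, ht, refl_refl_apply]
      exfalso
      rw [← he] at h2'
      exact h3 h2'
    · exact t.injective he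

theorem rk_le {d : ℕ} (hd : 0 < d) {x y : Equiv.Perm ℤ} (hx : x ∈ extAffSym d)
    (h : ReflTransGen (Up d) x y) (p q : ℤ) : rk x p q ≤ rk y p q := by
  induction h with
  | refl => exact le_rfl
  | tail h1 h2 ih => exact ih.trans (rk_le_of_up hd (mem_of_reflTransGen_up h1 hx) h2 p q)

/-- If `x ≤ u ≤ w`, `x a = w a = b` and `x`, `w` have the same rank at this point, then the same is
true of `u`. -/
theorem apply_eq_of_between {d : ℕ} (hd : 0 < d) {x u w : Equiv.Perm ℤ} (hx : x ∈ extAffSym d)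
    (h1 : ReflTransGen (Up d) x u) (h2 : ReflTransGen (Up d) u w) {a b : ℤ} (hxa : x a = b)
    (hwa : w a = b) (hr : rk x (a - 1) b = rk w (a - 1) b) :
    u a = b ∧ rk u (a - 1) b = rk x (a - 1) b := by
  have hu := mem_of_reflTransGen_up h1 hx
  have hw := mem_of_reflTransGen_up h2 hu
  have hle := fun p q => rk_le hd hx h1 p q
  have hle2 := fun p q => rk_le hd hu h2 p q
  -- The ranks of `u` at the four points around `(a, b)` are squeezed between those of `x` and `w`.
  -- The comparison at `b - 1` excludes `u a < b`, and the one at `b` excludes `u a > b`.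
  have a1 := hle (a - 1) b
  have a2 := hle2 (a - 1) b
  have b1 := hle (a - 1) (b - 1)
  have b2 := hle2 (a - 1) (b - 1)
  have c1 := hle a b
  have c2 := hle2 a b
  have d1 := hle a (b - 1)
  have d2 := hle2 a (b - 1)
  rw [rk_sub_one hxa] at b1
  rw [rk_sub_one hwa] at b2
  rw [rk_eq_add hd hx a, rk_eq_add hd hu a, hxa] at c1 d1
  rw [rk_eq_add hd hw a, rk_eq_add hd hu a, hwa] at c2 d2
  rw [rk_sub_one hxa] at d1
  rw [rk_sub_one hwa] at d2
  simp only [lt_irrefl, if_false, sub_one_lt, if_true] at c1 c2 d1 d2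
  constructor
  · have e1 : b - 1 < u a := by
      by_contra h
      rw [if_neg h] at d1
      omega
    have e2 : ¬ b < u a := fun h => by
      rw [if_pos h] at c2
      omega
    omega
  · omega

/-- The reflection permutes the half-line of positions up to `q`, since a boundary at `q` is crossed
only if `q ≡ p`. -/
theorem rk_mul_refl_succ {d : ℕ} (hd : 2 ≤ d) (w : Equiv.Perm ℤ) {p q : ℤ}
    (h : ¬ q ≡ p [ZMOD d]) (v : ℤ) : rk (w * refl d p (p + 1)) q v = rk w q v := by
  have hd0 : 0 < d := by omega
  have hpne := not_modEq_succ hd p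
  set s := refl d p (p + 1) with hs
  have key : ∀ r, r ≤ q → s r ≤ q := by
    intro r hr
    rw [hs, refl_apply hd0 hpne]
    split_ifs with h1 h2
    · have : r ≠ q := fun h2 => h (h2 ▸ h1)
      omega
    · omega
    · exact hr
  have e : {r : ℤ | r ≤ q ∧ v < w r} = s '' {r : ℤ | r ≤ q ∧ v < (w * s) r} := by
    ext r
    simp only [Set.mem_image, Set.mem_ofPred_eq, Equiv.Perm.mul_apply]
    constructor
    · rintro ⟨h1, h2⟩
      exact ⟨s r, ⟨key r h1, by rwa [hs, refl_refl_apply]⟩, by rw [hs, refl_refl_apply]⟩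
    · rintro ⟨r', ⟨h1, h2⟩, rfl⟩
      exact ⟨key r' h1, h2⟩
  unfold rk
  rw [e, Set.ncard_image_of_injective _ s.injective]

/-! ### Deleting and inserting a point -/

/-- `α` is a strictly increasing periodic map whose image is the complement of a residue class. -/
structure Skip (e : ℕ) (a : ℤ) (α : ℤ → ℤ) : Prop where
  strictMono : StrictMono α
  map_add : ∀ p, α (p + e) = α p + (e + 1 : ℕ)
  range : ∀ x, (∃ p, α p = x) ↔ ¬ x ≡ a [ZMOD (e + 1 : ℕ)]

namespace Skip

variable {e : ℕ} {a : ℤ} {α : ℤ → ℤ}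

theorem map_add_mul (h : Skip e a α) (p k : ℤ) : α (p + k * e) = α p + k * (e + 1 : ℕ) := by
  have hp : Function.Periodic (fun p => (e : ℤ) * α p - (e + 1 : ℕ) * p) (e : ℤ) := fun x => by
    simp only
    rw [h.map_add]
    ring
  -- For `e = 0` there is no such map, because `map_add` would read `α p = α p + 1`.
  rcases Nat.eq_zero_or_pos e with rfl | he
  · have := h.map_add 0
    simp at this
  · have := hp.int_mul k p
    simp only [Int.cast_id] at this
    have he' : (e : ℤ) ≠ 0 := by omega
    apply mul_left_cancel₀ he'
    linarith

theorem not_modEq (h : Skip e a α) (p : ℤ) : ¬ α p ≡ a [ZMOD (e + 1 : ℕ)] :=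
  (h.range _).1 ⟨p, rfl⟩

theorem modEq_iff (h : Skip e a α) {i j : ℤ} :
    α i ≡ α j [ZMOD (e + 1 : ℕ)] ↔ i ≡ j [ZMOD e] := by
  rw [modEq_iff_exists, modEq_iff_exists]
  refine exists_congr fun k => ?_
  rw [← h.map_add_mul, h.strictMono.injective.eq_iff]

theorem exists_succ (h : Skip e a α) {p : ℤ} (h1 : ¬ p ≡ a [ZMOD (e + 1 : ℕ)])
    (h2 : ¬ p + 1 ≡ a [ZMOD (e + 1 : ℕ)]) : ∃ q, α q = p ∧ α (q + 1) = p + 1 := by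
  obtain ⟨q, hq⟩ := (h.range p).2 h1
  obtain ⟨q', hq'⟩ := (h.range (p + 1)).2 h2
  refine ⟨q, hq, ?_⟩
  have h3 : q < q' := h.strictMono.lt_iff_lt.1 (by omega)
  have h4 : α q < α (q + 1) := h.strictMono (lt_add_one q)
  have h5 : α (q + 1) ≤ α q' := h.strictMono.monotone (by omega)
  omega

theorem refl_apply (he : 0 < e) (h : Skip e a α) {i j : ℤ} (hij : ¬ i ≡ j [ZMOD e]) (p : ℤ) :
    refl (e + 1) (α i) (α j) (α p) = α (refl e i j p) := by
  have hij' : ¬ α i ≡ α j [ZMOD (e + 1 : ℕ)] := fun h2 => hij (h.modEq_iff.1 h2)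
  by_cases h1 : p ≡ i [ZMOD e]
  · obtain ⟨k, rfl⟩ := modEq_iff_exists.1 h1
    rw [h.map_add_mul, AffineKL.map_add_mul (refl_mem_extAffSym _ _ _), refl_left (by omega) hij',
      AffineKL.map_add_mul (refl_mem_extAffSym _ _ _), refl_left he hij, h.map_add_mul]
  · by_cases h2 : p ≡ j [ZMOD e]
    · obtain ⟨k, rfl⟩ := modEq_iff_exists.1 h2
      rw [h.map_add_mul, AffineKL.map_add_mul (refl_mem_extAffSym _ _ _),
        refl_right (by omega) hij', AffineKL.map_add_mul (refl_mem_extAffSym _ _ _),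
        refl_right he hij, h.map_add_mul]
    · rw [refl_of_ne h1 h2, refl_of_ne (fun h3 => h1 (h.modEq_iff.1 h3))
        (fun h3 => h2 (h.modEq_iff.1 h3))]

/-- The only pairs whose order the reflection reverses are adjacent ones containing a member of the
class of `a`. The image of `α` avoids this class, so the composite is still increasing. -/
theorem refl_comp (he : 0 < e) (h : Skip e a α) {p : ℤ}
    (hp : p ≡ a [ZMOD (e + 1 : ℕ)] ∨ p + 1 ≡ a [ZMOD (e + 1 : ℕ)]) :
    Skip e (refl (e + 1) p (p + 1) a) (fun q => refl (e + 1) p (p + 1) (α q)) := by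
  have hs := refl_mem_extAffSym (e + 1) p (p + 1)
  refine ⟨fun i j hij => ?_, fun q => ?_, fun x => ?_⟩
  · by_contra hlt
    obtain ⟨h1, h2⟩ := of_not_refl_succ_lt (by omega) (h.strictMono hij) hlt
    rcases hp with hp | hp
    · exact h.not_modEq i (h2.trans hp)
    · have h3 : α j ≡ p + 1 [ZMOD (e + 1 : ℕ)] := h1 ▸ h2.add_right 1
      exact h.not_modEq j (h3.trans hp)
  · rw [h.map_add, hs.1]
  · have h1 : x ≡ refl (e + 1) p (p + 1) a [ZMOD (e + 1 : ℕ)] ↔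
        refl (e + 1) p (p + 1) x ≡ a [ZMOD (e + 1 : ℕ)] := by
      rw [← map_modEq_iff hs, refl_refl_apply]
    rw [h1, ← h.range]
    refine exists_congr fun q => ⟨fun h2 => ?_, fun h2 => ?_⟩
    · rw [← h2, refl_refl_apply]
    · rw [h2, refl_refl_apply]

end Skip

/-- `w` is obtained from `y` by inserting the point `(a, b)` and its translates, where `α` and `β`
are the relabellings of positions and values. -/
structure Infl (a b : ℤ) (α β : ℤ → ℤ) (y w : Equiv.Perm ℤ) : Prop where
  comp : ∀ p, w (α p) = β (y p)
  point : w a = b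

/-! ### Insertions and Bruhat chains -/

section Infl

variable {e : ℕ} {a b : ℤ} {α β : ℤ → ℤ}

theorem Infl.mul_refl (he : 0 < e) (hα : Skip e a α) {y w : Equiv.Perm ℤ}
    (h : Infl a b α β y w) {i j : ℤ} (hij : ¬ i ≡ j [ZMOD e]) :
    Infl a b α β (y * refl e i j) (w * refl (e + 1) (α i) (α j)) := by
  refine ⟨fun p => ?_, ?_⟩
  · rw [Equiv.Perm.mul_apply, Equiv.Perm.mul_apply, hα.refl_apply he hij, h.comp]
  · rw [Equiv.Perm.mul_apply, refl_of_ne (fun h => hα.not_modEq i h.symm)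
      (fun h => hα.not_modEq j h.symm), h.point]

theorem Infl.left_unique (hβ : Skip e b β) {y y' w : Equiv.Perm ℤ}
    (h : Infl a b α β y w) (h' : Infl a b α β y' w) : y = y' := by
  ext p
  apply hβ.strictMono.injective
  rw [← h.comp, h'.comp]

theorem Infl.right_unique (hα : Skip e a α) {y w w' : Equiv.Perm ℤ}
    (hw : w ∈ extAffSym (e + 1)) (hw' : w' ∈ extAffSym (e + 1))
    (h : Infl a b α β y w) (h' : Infl a b α β y w') : w = w' := by
  ext x
  by_cases hx : x ≡ a [ZMOD (e + 1 : ℕ)]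
  · obtain ⟨k, rfl⟩ := modEq_iff_exists.1 hx
    rw [map_add_mul hw, map_add_mul hw', h.point, h'.point]
  · obtain ⟨p, rfl⟩ := (hα.range x).2 hx
    rw [h.comp, h'.comp]

/-- Existence of insertions. -/
theorem exists_infl (he : 0 < e) (hα : Skip e a α) (hβ : Skip e b β) {y : Equiv.Perm ℤ}
    (hy : y ∈ extAffSym e) : ∃ w ∈ extAffSym (e + 1), Infl a b α β y w := by
  classical
  -- The points missed by `α` are the translates of `a`; the second branch sends them to the
  -- corresponding translates of `b`.
  let f : ℤ → ℤ := fun x => if h : ∃ p, α p = x then β (y h.choose) else x - a + b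
  have f1 : ∀ p, f (α p) = β (y p) := by
    intro p
    have h : ∃ q, α q = α p := ⟨p, rfl⟩
    simp only [f]
    rw [dif_pos h, hα.strictMono.injective h.choose_spec]
  have f2 : ∀ k : ℤ, f (a + k * (e + 1 : ℕ)) = b + k * (e + 1 : ℕ) := by
    intro k
    have h : ¬ ∃ q, α q = a + k * (e + 1 : ℕ) := by
      rw [hα.range, not_not]
      exact modEq_iff_exists.2 ⟨k, rfl⟩
    simp only [f]
    rw [dif_neg h]
    ring
  have hb : Function.Bijective f := by
    constructor
    · intro x x' hx
      by_cases h1 : x ≡ a [ZMOD (e + 1 : ℕ)] <;> by_cases h2 : x' ≡ a [ZMOD (e + 1 : ℕ)]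
      · obtain ⟨k, rfl⟩ := modEq_iff_exists.1 h1
        obtain ⟨k', rfl⟩ := modEq_iff_exists.1 h2
        rw [f2, f2] at hx
        linarith
      · obtain ⟨k, rfl⟩ := modEq_iff_exists.1 h1
        obtain ⟨p, rfl⟩ := (hα.range _).2 h2
        rw [f2, f1] at hx
        exact absurd (modEq_iff_exists.2 ⟨k, hx.symm⟩) (hβ.not_modEq _)
      · obtain ⟨k, rfl⟩ := modEq_iff_exists.1 h2
        obtain ⟨p, rfl⟩ := (hα.range _).2 h1
        rw [f2, f1] at hx
        exact absurd (modEq_iff_exists.2 ⟨k, hx⟩) (hβ.not_modEq _)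
      · obtain ⟨p, rfl⟩ := (hα.range _).2 h1
        obtain ⟨p', rfl⟩ := (hα.range _).2 h2
        rw [f1, f1] at hx
        rw [y.injective (hβ.strictMono.injective hx)]
    · intro v
      by_cases h1 : v ≡ b [ZMOD (e + 1 : ℕ)]
      · obtain ⟨k, rfl⟩ := modEq_iff_exists.1 h1
        exact ⟨_, f2 k⟩
      · obtain ⟨q, rfl⟩ := (hβ.range _).2 h1
        exact ⟨α (y⁻¹ q), by rw [f1, perm_apply_inv]⟩
  refine ⟨Equiv.ofBijective f hb, ?_, f1, ?_⟩
  · rw [mem_extAffSym_iff (by omega)]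
    intro x
    simp only [Equiv.ofBijective_apply]
    by_cases h1 : x ≡ a [ZMOD (e + 1 : ℕ)]
    · obtain ⟨k, rfl⟩ := modEq_iff_exists.1 h1
      have := f2 (k + 1)
      rw [show a + (k + 1) * ((e + 1 : ℕ) : ℤ) = a + k * (e + 1 : ℕ) + (e + 1 : ℕ) by ring] at this
      rw [this, f2]
      ring
    · obtain ⟨p, rfl⟩ := (hα.range _).2 h1
      rw [← hα.map_add, f1, f1, hy.1, hβ.map_add]
  · have := f2 0
    rw [zero_mul, add_zero, add_zero] at this
    exact this

/-- Existence of deletions. -/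
theorem exists_infl_of_apply_eq (he : 0 < e) (hα : Skip e a α) (hβ : Skip e b β)
    {w : Equiv.Perm ℤ} (hw : w ∈ extAffSym (e + 1)) (hab : w a = b) :
    ∃ y ∈ extAffSym e, Infl a b α β y w := by
  have h1 : ∀ p, ∃ q, β q = w (α p) := fun p => by
    rw [hβ.range, ← hab, map_modEq_iff hw]
    exact hα.not_modEq p
  choose f hf using h1
  have hb : Function.Bijective f := by
    constructor
    · intro p p' h
      have := (hf p).symm.trans ((congrArg β h).trans (hf p'))
      exact hα.strictMono.injective (w.injective this)
    · intro q
      have h2 : ∃ p, α p = w⁻¹ (β q) := by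
        rw [hα.range, ← map_modEq_iff hw, perm_apply_inv, hab]
        exact hβ.not_modEq q
      obtain ⟨p, hp⟩ := h2
      refine ⟨p, hβ.strictMono.injective ?_⟩
      rw [hf, hp, perm_apply_inv]
  refine ⟨Equiv.ofBijective f hb, ?_, fun p => (hf p).symm, hab⟩
  rw [mem_extAffSym_iff he]
  intro p
  apply hβ.strictMono.injective
  simp only [Equiv.ofBijective_apply]
  rw [hf, hα.map_add, hw.1, hβ.map_add, hf]

/-- Chains downstairs lift without any condition on ranks: relabelling a step by `α` gives an upward
step that fixes the class of `a`. -/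
theorem exists_infl_up (he : 0 < e) (hα : Skip e a α) (hβ : Skip e b β) {z z' x : Equiv.Perm ℤ}
    (h : Infl a b α β z x) (hz : ReflTransGen (Up e) z z') :
    ∃ u, ReflTransGen (Up (e + 1)) x u ∧ Infl a b α β z' u := by
  induction hz with
  | refl => exact ⟨x, ReflTransGen.refl, h⟩
  | tail _ hstep ih =>
    obtain ⟨u, hu, hi⟩ := ih
    obtain ⟨i, j, hij, hne, hlt, rfl⟩ := hstep
    refine ⟨_, hu.tail ⟨α i, α j, hα.strictMono hij, fun h => hne (hα.modEq_iff.1 h), ?_, rfl⟩,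
      hi.mul_refl he hα hne⟩
    rw [hi.comp, hi.comp]
    exact hβ.strictMono hlt

/-- A chain upstairs projects only if its reflections avoid the class of `a`. Equality of ranks at
the two ends forces this, as `apply_eq_of_between` applies to every intermediate permutation. -/
theorem exists_infl_of_up (he : 0 < e) (hα : Skip e a α) (hβ : Skip e b β)
    {z x u : Equiv.Perm ℤ} (hx : x ∈ extAffSym (e + 1)) (h : Infl a b α β z x)
    (hxu : ReflTransGen (Up (e + 1)) x u) (hu : u a = b)
    (hr : rk x (a - 1) b = rk u (a - 1) b) :
    ∃ z', ReflTransGen (Up e) z z' ∧ Infl a b α β z' u := by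
  induction hxu with
  | refl => exact ⟨z, ReflTransGen.refl, h⟩
  | tail h1 hstep ih =>
    rename_i u' u
    obtain ⟨h2, h3⟩ := apply_eq_of_between (by omega) hx h1 (ReflTransGen.single hstep) h.point hu hr
    obtain ⟨z', hz', hi⟩ := ih h2 h3.symm
    obtain ⟨i, j, hij, hne, hlt, rfl⟩ := hstep
    -- Both ends of the last step send `a` to `b`, so its reflection fixes `a`; its two indices are
    -- therefore in the image of `α`.
    have hta : refl (e + 1) i j a = a := u'.injective (hu.trans h2.symm)
    have hai : ¬ i ≡ a [ZMOD (e + 1 : ℕ)] := by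
      intro h4
      obtain ⟨k, rfl⟩ := modEq_iff_exists.1 h4.symm
      rw [map_add_mul (refl_mem_extAffSym _ _ _), refl_left (by omega) hne] at hta
      omega
    have haj : ¬ j ≡ a [ZMOD (e + 1 : ℕ)] := by
      intro h4
      obtain ⟨k, rfl⟩ := modEq_iff_exists.1 h4.symm
      rw [map_add_mul (refl_mem_extAffSym _ _ _), refl_right (by omega) hne] at hta
      omega
    obtain ⟨i, rfl⟩ := (hα.range _).2 hai
    obtain ⟨j, rfl⟩ := (hα.range _).2 haj
    have hne' : ¬ i ≡ j [ZMOD e] := fun h => hne (hα.modEq_iff.2 h)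
    refine ⟨_, hz'.tail ⟨i, j, hα.strictMono.lt_iff_lt.1 hij, hne', ?_, rfl⟩,
      hi.mul_refl he hα hne'⟩
    rw [hi.comp, hi.comp] at hlt
    exact hβ.strictMono.lt_iff_lt.1 hlt

theorem reflTransGen_up_of_infl (he : 0 < e) (hα : Skip e a α) (hβ : Skip e b β)
    {z y x w : Equiv.Perm ℤ} (hx : x ∈ extAffSym (e + 1)) (hw : w ∈ extAffSym (e + 1))
    (hzx : Infl a b α β z x) (hyw : Infl a b α β y w) (h : ReflTransGen (Up e) z y) :
    ReflTransGen (Up (e + 1)) x w := by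
  obtain ⟨u, hu, hi⟩ := exists_infl_up he hα hβ hzx h
  rwa [← hi.right_unique hα (mem_of_reflTransGen_up hu hx) hw hyw]

theorem reflTransGen_up_infl_iff (he : 0 < e) (hα : Skip e a α) (hβ : Skip e b β)
    {z y x w : Equiv.Perm ℤ} (hx : x ∈ extAffSym (e + 1)) (hw : w ∈ extAffSym (e + 1))
    (hzx : Infl a b α β z x) (hyw : Infl a b α β y w) (hr : rk x (a - 1) b = rk w (a - 1) b) :
    ReflTransGen (Up (e + 1)) x w ↔ ReflTransGen (Up e) z y := by
  refine ⟨fun h => ?_, reflTransGen_up_of_infl he hα hβ hx hw hzx hyw⟩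
  obtain ⟨z', h1, h2⟩ := exists_infl_of_up he hα hβ hx hzx h hyw.point hr
  rwa [hyw.left_unique hβ h2]

end Infl

section Infl

variable {e : ℕ} {a b : ℤ} {α β : ℤ → ℤ}

/-! ### Lengths and polynomials under insertion -/

/-- Right multiplication by a simple reflection is absorbed by the relabelling of positions, with
the deletion `y` unchanged. This handles the descents next to the inserted point. -/
theorem Infl.mul_simple {y w : Equiv.Perm ℤ} (h : Infl a b α β y w) (p : ℤ) :
    Infl (refl (e + 1) p (p + 1) a) b (fun q => refl (e + 1) p (p + 1) (α q)) β y
      (w * refl (e + 1) p (p + 1)) := by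
  refine ⟨fun q => ?_, ?_⟩
  · rw [Equiv.Perm.mul_apply, refl_refl_apply, h.comp]
  · rw [Equiv.Perm.mul_apply, refl_refl_apply, h.point]

/-- As the point moves from `a` to `a + 1`, the value `w (a + 1)` passes to its left. -/
theorem rk_mul_simple_right {d : ℕ} (hd : 2 ≤ d) {w : Equiv.Perm ℤ} (hw : w ∈ extAffSym d)
    (a b : ℤ) : rk (w * refl d a (a + 1)) (refl d a (a + 1) a - 1) b
      = rk w (a - 1) b + if b < w (a + 1) then 1 else 0 := by
  have hne := not_modEq_succ hd a
  have hne' : ¬ a - 1 ≡ a [ZMOD d] := by simpa using not_modEq_succ hd (a - 1)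
  rw [refl_left (by omega) hne, add_sub_cancel_right,
    rk_eq_add (by omega) (mul_mem hw (refl_mem_extAffSym _ _ _)),
    rk_mul_refl_succ hd w hne', Equiv.Perm.mul_apply, refl_left (by omega) hne]

/-- As the point moves from `a` to `a - 1`, the value `w (a - 1)` ceases to be on its left. -/
theorem rk_mul_simple_left {d : ℕ} (hd : 2 ≤ d) {w : Equiv.Perm ℤ} (hw : w ∈ extAffSym d)
    (a b : ℤ) : rk (w * refl d (a - 1) (a - 1 + 1)) (refl d (a - 1) (a - 1 + 1) a - 1) b
        + (if b < w (a - 1) then 1 else 0)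
      = rk w (a - 1) b := by
  have hne := not_modEq_succ hd (a - 1)
  have hne' : ¬ a - 1 - 1 ≡ a - 1 [ZMOD d] := by simpa using not_modEq_succ hd (a - 1 - 1)
  have h1 : refl d (a - 1) (a - 1 + 1) a = a - 1 := by
    have := refl_right (by omega) hne
    rw [sub_add_cancel] at this ⊢
    exact this
  rw [h1, rk_mul_refl_succ hd w hne', ← rk_eq_add (by omega) hw]

/-- A descent of `w` may be taken to be one of the three kinds: at `a`, at `a - 1`, or
away from `a`. -/
theorem descent_cases {d : ℕ} {w : affSym d}
    {p : ℤ} (hp : (w : Equiv.Perm ℤ) (p + 1) < (w : Equiv.Perm ℤ) p) (a : ℤ) :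
    (w : Equiv.Perm ℤ) (a + 1) < (w : Equiv.Perm ℤ) a ∨
    (w : Equiv.Perm ℤ) (a - 1 + 1) < (w : Equiv.Perm ℤ) (a - 1) ∨
    (¬ p ≡ a [ZMOD d] ∧ ¬ p + 1 ≡ a [ZMOD d]) := by
  by_cases h1 : p ≡ a [ZMOD d]
  · exact Or.inl ((descent_congr w h1).1 hp)
  by_cases h2 : p + 1 ≡ a [ZMOD d]
  · refine Or.inr (Or.inl ((descent_congr w (p := p) ?_).1 hp))
    simpa using h2.sub_right 1
  · exact Or.inr (Or.inr ⟨h1, h2⟩)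

theorem eq_one_of_infl_one (hα : Skip e a α) (hβ : Skip e b β) {y : affSym e}
    (h : Infl a b α β (y : Equiv.Perm ℤ) ((1 : affSym (e + 1)) : Equiv.Perm ℤ)) : y = 1 := by
  refine eq_one_of_strictMono y fun i j hij => hβ.strictMono.lt_iff_lt.1 ?_
  rw [← h.comp, ← h.comp]
  exact hα.strictMono hij

/-- Induction along descents of `w`. A descent at `a` moves the point one place to the right and
keeps its rank. One at `a - 1` moves it to the left and lowers the rank by one. Both lower `2 * rk +
(b - a)` by one and keep `y`; any other descent is one of `y` and keeps the rank. The identity has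
`a = b` and rank zero. -/
theorem len_infl (he : 0 < e) (hα : Skip e a α) (hβ : Skip e b β) {w : affSym (e + 1)}
    {y : affSym e} (h : Infl a b α β (y : Equiv.Perm ℤ) w) :
    (len w : ℤ) = len y + 2 * rk w (a - 1) b + (b - a) ∧ len y ≤ len w := by
  induction hn : len w using Nat.strong_induction_on generalizing w y a α with
  | _ n ih =>
    have hd : 2 ≤ e + 1 := by omega
    by_cases hw : w = 1
    · subst hw
      have hy := eq_one_of_infl_one hα hβ h
      have hab : a = b := h.point
      subst hy hab hn
      have : rk ((1 : affSym (e + 1)) : Equiv.Perm ℤ) (a - 1) a = 0 := by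
        unfold rk
        rw [Set.ncard_eq_zero (rk_finite (Nat.succ_pos e) (1 : affSym (e + 1)).2.1 _ _)]
        ext r
        simp only [Set.mem_ofPred_eq, Set.mem_empty_iff_false, iff_false, not_and, OneMemClass.coe_one,
          Equiv.Perm.one_apply]
        omega
      rw [this, len_one, len_one]
      simp
    · obtain ⟨-, p, hp⟩ := exists_descent hw
      have hpt := h.point
      rcases descent_cases hp a with h1 | h1 | ⟨h1, h2⟩
      · have hl := len_mul_simple_add_one hd h1
        have := ih (len (w * reflA (e + 1) a (a + 1))) (by omega)
          (hα.refl_comp he (Or.inl (Int.ModEq.refl a))) (h.mul_simple a) rfl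
        have hr := rk_mul_simple_right hd w.2.1 a b
        rw [if_neg (by omega), add_zero] at hr
        rw [← coe_mul_reflA, refl_left (by omega) (not_modEq_succ hd a)] at hr
        rw [refl_left (by omega) (not_modEq_succ hd a), hr] at this
        omega
      · have hl := len_mul_simple_add_one hd h1
        have := ih (len (w * reflA (e + 1) (a - 1) (a - 1 + 1))) (by omega)
          (hα.refl_comp he (p := a - 1) (Or.inr (by simp))) (h.mul_simple (a - 1)) rfl
        have hr := rk_mul_simple_left hd w.2.1 a b
        have h3 : refl (e + 1) (a - 1) (a - 1 + 1) a = a - 1 := by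
          have := refl_right (by omega) (not_modEq_succ hd (a - 1))
          rw [sub_add_cancel] at this ⊢
          exact this
        rw [sub_add_cancel] at h1
        rw [if_pos (by omega), ← coe_mul_reflA] at hr
        rw [h3] at this hr
        omega
      · obtain ⟨q, rfl, hq2⟩ := hα.exists_succ h1 h2
        have he2 : 2 ≤ e := by
          by_contra! h3
          have : e = 1 := by omega
          subst this
          have h4 := hα.map_add q
          push_cast at h4
          omega
        have hqne := not_modEq_succ he2 q
        have hyd : (y : Equiv.Perm ℤ) (q + 1) < (y : Equiv.Perm ℤ) q := by
          rw [← hq2, h.comp, h.comp] at hp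
          exact hβ.strictMono.lt_iff_lt.1 hp
        have hl := len_mul_simple_add_one hd hp
        have hl' := len_mul_simple_add_one he2 hyd
        have hI := h.mul_refl he hα hqne
        rw [hq2] at hI
        have := ih _ (by omega) hα (w := w * reflA (e + 1) (α q) (α q + 1))
          (y := y * reflA e q (q + 1)) hI rfl
        have hr := rk_mul_refl_succ hd w (p := α q) (q := a - 1) (fun h3 => h2 (by
          simpa using (h3.add_right 1).symm)) b
        rw [← coe_mul_reflA] at hr
        rw [hr] at this
        omega

theorem rPoly_eq_zero_of_rk_lt {d : ℕ} (hd : 0 < d) {x w : affSym d} {p q : ℤ}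
    (h : rk (w : Equiv.Perm ℤ) p q < rk (x : Equiv.Perm ℤ) p q) :
    ¬ ReflTransGen (Up d) (x : Equiv.Perm ℤ) w := fun h2 => by
  have := rk_le hd x.2.1 h2 p q
  omega

theorem rPoly_infl_of_not_le (he : 0 < e) (hα : Skip e a α) (hβ : Skip e b β)
    {x w : affSym (e + 1)} {z y : affSym e} (hzx : Infl a b α β (z : Equiv.Perm ℤ) x)
    (hyw : Infl a b α β (y : Equiv.Perm ℤ) w)
    (h : ¬ ReflTransGen (Up (e + 1)) (x : Equiv.Perm ℤ) w) :
    rPoly (simples (e + 1)) x w = rPoly (simples e) z y := by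
  have h1 : rPoly (simples (e + 1)) x w = 0 := by
    by_contra h1
    exact h (reflTransGen_up_of_rPoly_ne_zero h1)
  have h2 : rPoly (simples e) z y = 0 := by
    by_contra h2
    exact h (reflTransGen_up_of_infl he hα hβ x.2.1 w.2.1 hzx hyw
      (reflTransGen_up_of_rPoly_ne_zero h2))
  rw [h1, h2]

/-- Induction along a descent of `w`. Next to the point, a common descent of `x` and `w` moves the
point in both and keeps the deletions; if `x` has no descent there, the ranks exclude `x ≤ w` and
both sides vanish. Elsewhere, descents upstairs and downstairs correspond and the two recursions
coincide. -/
theorem rPoly_infl (he : 0 < e) (hα : Skip e a α) (hβ : Skip e b β) {x w : affSym (e + 1)}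
    {z y : affSym e} (hzx : Infl a b α β (z : Equiv.Perm ℤ) x)
    (hyw : Infl a b α β (y : Equiv.Perm ℤ) w)
    (hr : rk (x : Equiv.Perm ℤ) (a - 1) b = rk (w : Equiv.Perm ℤ) (a - 1) b) :
    rPoly (simples (e + 1)) x w = rPoly (simples e) z y := by
  induction hn : len w using Nat.strong_induction_on generalizing x w z y a α with
  | _ n ih =>
    have hd : 2 ≤ e + 1 := by omega
    by_cases hw : w = 1
    · subst hw
      obtain rfl := eq_one_of_infl_one hα hβ hyw
      rw [rPoly_one, rPoly_one]
      congr 1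
      refine propext ⟨?_, ?_⟩
      · rintro rfl
        exact Subtype.ext (hzx.left_unique hβ hyw)
      · rintro rfl
        exact Subtype.ext (hzx.right_unique hα x.2.1 (one_mem _) hyw)
    · obtain ⟨-, p, hp⟩ := exists_descent hw
      have hxpt := hzx.point
      have hwpt := hyw.point
      rcases descent_cases hp a with h1 | h1 | ⟨h1, h2⟩
      · have hl := len_mul_simple_add_one hd h1
        have hrw := rk_mul_simple_right hd w.2.1 a b
        have hrx := rk_mul_simple_right hd x.2.1 a b
        rw [if_neg (by omega), add_zero] at hrw
        by_cases hxa : (x : Equiv.Perm ℤ) (a + 1) < (x : Equiv.Perm ℤ) a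
        · rw [if_neg (by omega), add_zero] at hrx
          rw [rPoly_eq_demazureOp h1, demazureOp, if_pos hxa]
          exact ih _ (by omega) (hα.refl_comp he (Or.inl (Int.ModEq.refl a)))
            (hzx.mul_simple a) (hyw.mul_simple a) (by
              rw [coe_mul_reflA, coe_mul_reflA, hrx, hrw, hr]) rfl
        -- Here `w (a + 1) < b < x (a + 1)`, so at `a + 1` the rank of `x` exceeds that of `w` by
        -- one.
        · refine rPoly_infl_of_not_le he hα hβ hzx hyw
            (rPoly_eq_zero_of_rk_lt (by omega) (p := a + 1) (q := b) ?_)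
          have := apply_ne_apply_succ x a
          rw [rk_eq_add (by omega) w.2.1, rk_eq_add (by omega) x.2.1, add_sub_cancel_right,
            rk_eq_add (by omega) w.2.1 a, rk_eq_add (by omega) x.2.1 a, if_neg (by omega),
            if_neg (by omega), if_neg (by omega), if_pos (by omega)]
          omega
      · have hl := len_mul_simple_add_one hd h1
        have hrw := rk_mul_simple_left hd w.2.1 a b
        have hrx := rk_mul_simple_left hd x.2.1 a b
        have h1' := h1
        rw [sub_add_cancel] at h1'
        rw [if_pos (by omega)] at hrw
        by_cases hxa : (x : Equiv.Perm ℤ) (a - 1 + 1) < (x : Equiv.Perm ℤ) (a - 1)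
        · have hxa' := hxa
          rw [sub_add_cancel] at hxa'
          rw [if_pos (by omega)] at hrx
          rw [rPoly_eq_demazureOp h1, demazureOp, if_pos hxa]
          exact ih _ (by omega) (hα.refl_comp he (p := a - 1) (Or.inr (by simp)))
            (hzx.mul_simple (a - 1)) (hyw.mul_simple (a - 1)) (by
              rw [coe_mul_reflA, coe_mul_reflA]
              omega) rfl
        -- Here `x (a - 1) < b < w (a - 1)`; the ranks agree at `a - 1`, so at `a - 2` the rank of
        -- `x` exceeds that of `w` by one.
        · refine rPoly_infl_of_not_le he hα hβ hzx hyw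
            (rPoly_eq_zero_of_rk_lt (by omega) (p := a - 1 - 1) (q := b) ?_)
          have := apply_ne_apply_succ x (a - 1)
          rw [sub_add_cancel] at this hxa
          rw [rk_eq_add (by omega) w.2.1 (a - 1), rk_eq_add (by omega) x.2.1 (a - 1),
            if_neg (by omega), if_pos (by omega)] at hr
          omega
      · obtain ⟨q, rfl, hq2⟩ := hα.exists_succ h1 h2
        have he2 : 2 ≤ e := by
          by_contra! h3
          have : e = 1 := by omega
          subst this
          have h4 := hα.map_add q
          push_cast at h4
          omega
        have hqne := not_modEq_succ he2 q
        have hiff : ∀ {u : affSym (e + 1)} {v : affSym e},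
            Infl a b α β (v : Equiv.Perm ℤ) u →
            ((v : Equiv.Perm ℤ) (q + 1) < (v : Equiv.Perm ℤ) q ↔
              (u : Equiv.Perm ℤ) (α q + 1) < (u : Equiv.Perm ℤ) (α q)) := by
          intro u v h
          rw [← hq2, h.comp, h.comp, hβ.strictMono.lt_iff_lt]
        have hI : ∀ {u : affSym (e + 1)} {v : affSym e},
            Infl a b α β (v : Equiv.Perm ℤ) u →
            Infl a b α β ((v * reflA e q (q + 1) : affSym e) : Equiv.Perm ℤ)
              ((u * reflA (e + 1) (α q) (α q + 1) : affSym (e + 1)) : Equiv.Perm ℤ) := by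
          intro u v h
          have := h.mul_refl he hα hqne
          rw [hq2] at this
          exact this
        have hrk : ∀ u : affSym (e + 1),
            rk ((u * reflA (e + 1) (α q) (α q + 1) : affSym (e + 1)) : Equiv.Perm ℤ) (a - 1) b
              = rk (u : Equiv.Perm ℤ) (a - 1) b := fun u =>
          rk_mul_refl_succ hd u (p := α q) (q := a - 1) (fun h3 => h2 (by
            simpa using (h3.add_right 1).symm)) b
        have hl := len_mul_simple_add_one hd hp
        rw [rPoly_eq_demazureOp hp, rPoly_eq_demazureOp ((hiff hyw).2 hp), demazureOp, demazureOp]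
        simp only [hiff hzx]
        rw [ih _ (by omega) hα (hI hzx) (hI hyw) (by rw [hrk, hrk, hr]) rfl,
          ih _ (by omega) hα hzx (hI hyw) (by rw [hrk, hr]) rfl]

theorem klPoly_self {d : ℕ} (x : affSym d) : klPoly (simples d) x x = 1 := by
  rw [klPoly, if_pos rfl]

/-- By `len_infl` and the equality of ranks, the length difference, and so the truncation degree, is
the same on both sides. Insertion matches the elements `z < v ≤ y` with the elements `x < u ≤ w`,
and the sums agree by `rPoly_infl` and induction on the length difference. -/
theorem klPoly_infl (he : 0 < e) (hα : Skip e a α) (hβ : Skip e b β) {x w : affSym (e + 1)}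
    {z y : affSym e} (hzx : Infl a b α β (z : Equiv.Perm ℤ) x)
    (hyw : Infl a b α β (y : Equiv.Perm ℤ) w)
    (hr : rk (x : Equiv.Perm ℤ) (a - 1) b = rk (w : Equiv.Perm ℤ) (a - 1) b) :
    klPoly (simples (e + 1)) x w = klPoly (simples e) z y := by
  induction hn : len w - len x using Nat.strong_induction_on generalizing x z with
  | _ n ih =>
    have hd : 0 < e + 1 := by omega
    have hl1 := len_infl he hα hβ hzx
    have hl2 := len_infl he hα hβ hyw
    rw [hr] at hl1
    have hlen : wordLength (simples (e + 1)) w - wordLength (simples (e + 1)) x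
        = wordLength (simples e) y - wordLength (simples e) z := by
      change len w - len x = len y - len z
      omega
    have heq : ∀ {u u' : affSym (e + 1)} {v v' : affSym e}, Infl a b α β (v : Equiv.Perm ℤ) u →
        Infl a b α β (v' : Equiv.Perm ℤ) u' → (u = u' ↔ v = v') := by
      intro u u' v v' h h'
      constructor
      · rintro rfl
        exact Subtype.ext (h.left_unique hβ h')
      · rintro rfl
        exact Subtype.ext (h.right_unique hα u.2.1 u'.2.1 h')
    rw [klPoly, klPoly]
    by_cases hzy : z = y
    · rw [if_pos hzy, if_pos ((heq hzx hyw).2 hzy)]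
    rw [if_neg hzy, if_neg (mt (heq hzx hyw).1 hzy), hlen]
    have hsum : (∑ᶠ (u : affSym (e + 1)) (_ : BruhatLT (simples (e + 1)) x u ∧
          BruhatLE (simples (e + 1)) u w), rPoly (simples (e + 1)) x u * klPoly (simples (e + 1)) u w)
        = ∑ᶠ (v : affSym e) (_ : BruhatLT (simples e) z v ∧ BruhatLE (simples e) v y),
          rPoly (simples e) z v * klPoly (simples e) v y := by
      symm
      classical
      -- An insertion into an element of `affSym e` need not have offset zero, hence the default
      -- `1`. For `v` in the interval the lifted chain starts at `x` and stays in `affSym (e + 1)`,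
      -- so the default is not used.
      let g : affSym e → affSym (e + 1) := fun v =>
        if h : ∃ u : affSym (e + 1), Infl a b α β (v : Equiv.Perm ℤ) u then h.choose else 1
      have hg : ∀ {v : affSym e} {u : affSym (e + 1)}, Infl a b α β (v : Equiv.Perm ℤ) u →
          g v = u := by
        intro v u h
        have h' : ∃ u : affSym (e + 1), Infl a b α β (v : Equiv.Perm ℤ) u := ⟨u, h⟩
        simp only [g]
        rw [dif_pos h']
        exact (heq h'.choose_spec h).2 rfl
      have hfwd : ∀ {v : affSym e}, BruhatLT (simples e) z v → BruhatLE (simples e) v y →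
          ∃ u : affSym (e + 1), Infl a b α β (v : Equiv.Perm ℤ) u ∧
            BruhatLT (simples (e + 1)) x u ∧ BruhatLE (simples (e + 1)) u w := by
        intro v h1 h2
        obtain ⟨u, hu, hi⟩ := exists_infl_up he hα hβ hzx ((bruhatLE_iff he).1 h1.1)
        have hu' : BruhatLE (simples (e + 1)) x
            ⟨u, by
              suffices H : ∀ u, ReflTransGen (Up (e + 1)) (x : Equiv.Perm ℤ) u →
                  u ∈ affSym (e + 1) from H u hu
              intro u hu
              induction hu with
              | refl => exact x.2
              | tail _ hstep ih =>
                obtain ⟨i, j, -, -, -, rfl⟩ := hstep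
                exact mul_mem ih (refl_mem_affSym _ _ _)⟩ := (bruhatLE_iff hd).2 hu
        refine ⟨_, hi, ⟨hu', fun hxu => h1.2 ((heq hzx hi).1 hxu)⟩, ?_⟩
        exact (bruhatLE_iff hd).2 (reflTransGen_up_of_infl he hα hβ
          (mem_of_reflTransGen_up hu x.2.1) w.2.1 hi hyw ((bruhatLE_iff he).1 h2))
      have hrk : ∀ {v : affSym e} {u : affSym (e + 1)}, Infl a b α β (v : Equiv.Perm ℤ) u →
          BruhatLE (simples (e + 1)) x u → BruhatLE (simples (e + 1)) u w →
          rk (u : Equiv.Perm ℤ) (a - 1) b = rk (x : Equiv.Perm ℤ) (a - 1) b := by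
        intro v u _ h1 h2
        exact (apply_eq_of_between hd x.2.1 ((bruhatLE_iff hd).1 h1) ((bruhatLE_iff hd).1 h2)
          hzx.point hyw.point hr).2
      refine finsum_mem_eq_of_bijOn g
        (s := {v | BruhatLT (simples e) z v ∧ BruhatLE (simples e) v y})
        (t := {u | BruhatLT (simples (e + 1)) x u ∧ BruhatLE (simples (e + 1)) u w}) ⟨?_, ?_, ?_⟩ ?_
      · rintro v ⟨h1, h2⟩
        obtain ⟨u, hi, h3, h4⟩ := hfwd h1 h2
        rw [hg hi]
        exact ⟨h3, h4⟩
      · rintro v ⟨h1, h2⟩ v' ⟨h1', h2'⟩ hvv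
        obtain ⟨u, hi, -, -⟩ := hfwd h1 h2
        obtain ⟨u', hi', -, -⟩ := hfwd h1' h2'
        rw [hg hi, hg hi'] at hvv
        exact (heq hi hi').1 hvv
      · rintro u ⟨h1, h2⟩
        have hub := apply_eq_of_between hd x.2.1 ((bruhatLE_iff hd).1 h1.1)
          ((bruhatLE_iff hd).1 h2) hzx.point hyw.point hr
        obtain ⟨v, hv, hi⟩ := exists_infl_of_up he hα hβ x.2.1 hzx ((bruhatLE_iff hd).1 h1.1)
          hub.1 hub.2.symm
        have hvm : v ∈ affSym e := by
          clear hi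
          induction hv with
          | refl => exact z.2
          | tail _ hstep ih =>
            obtain ⟨i, j, -, -, -, rfl⟩ := hstep
            exact mul_mem ih (refl_mem_affSym _ _ _)
        refine ⟨⟨v, hvm⟩, ⟨⟨(bruhatLE_iff he).2 hv, fun hzv => h1.2 ((heq hzx hi).2 hzv)⟩, ?_⟩,
          hg hi⟩
        exact (bruhatLE_iff he).2 ((reflTransGen_up_infl_iff he hα hβ u.2.1 w.2.1 hi hyw
          (hub.2.trans hr)).1 ((bruhatLE_iff hd).1 h2))
      · rintro v ⟨h1, h2⟩
        obtain ⟨u, hi, h3, h4⟩ := hfwd h1 h2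
        have hrku := hrk hi h3.1 h4
        rw [hg hi, rPoly_infl he hα hβ hzx hi hrku.symm]
        congr 1
        have hl3 : len x < len u := h3.length_lt
        have hl4 : len u ≤ len w := h4.length_le
        exact (ih _ (by omega) hi (hrku.trans hr) rfl).symm
    rw [hsum]

end Infl

/-! ### The extended group -/

/-- The length, as a function on all permutations of `ℤ`. -/
noncomputable def permLength (d : ℕ) (w : Equiv.Perm ℤ) : ℕ :=
  open Classical in if h : w ∈ extAffSym d then extLength (⟨w, h⟩ : extAffSym d) else 0

/-- The Kazhdan-Lusztig polynomials, as functions on all pairs of permutations of `ℤ`. -/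
noncomputable def permKL (d : ℕ) (x w : Equiv.Perm ℤ) : ℤ[X] :=
  open Classical in if h : x ∈ extAffSym d ∧ w ∈ extAffSym d then
    extKLPoly (⟨x, h.1⟩ : extAffSym d) ⟨w, h.2⟩ else 0

theorem permLength_coe {d : ℕ} (w : extAffSym d) : permLength d w = extLength w := by
  rw [permLength, dif_pos w.2]

theorem permKL_coe {d : ℕ} (x w : extAffSym d) : permKL d x w = extKLPoly x w := by
  rw [permKL, dif_pos ⟨x.2, w.2⟩]

theorem extKLPoly_self {d : ℕ} (x : extAffSym d) : extKLPoly x x = 1 := by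
  rw [extKLPoly, if_pos rfl, klPoly_self]

theorem extLength_lt {d : ℕ} (hd : 0 < d) {w : extAffSym d} {i j : ℤ} (hij : i < j)
    (hne : ¬ i ≡ j [ZMOD d]) (h : (w : Equiv.Perm ℤ) i < (w : Equiv.Perm ℤ) j) :
    extLength w < extLength (w * ⟨refl d i j, refl_mem_extAffSym d i j⟩) := by
  have h1 : offset w = offset (w * ⟨refl d i j, refl_mem_extAffSym d i j⟩) :=
    offset_eq_of_reflTransGen_up (ReflTransGen.single ⟨i, j, hij, hne, h, rfl⟩)
  have h2 : affPart (w * ⟨refl d i j, refl_mem_extAffSym d i j⟩) = affPart w * reflA d i j := by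
    apply Subtype.ext
    rw [coe_mul_reflA, coe_affPart, coe_affPart, ← h1, Subgroup.coe_mul, mul_assoc]
  rw [extLength, extLength, h2]
  refine lt_len_mul_reflA hd hij hne ?_
  rw [coe_affPart, Equiv.Perm.mul_apply, Equiv.Perm.mul_apply, shift_apply, shift_apply]
  omega

theorem rk_shift_mul (k : ℤ) (w : Equiv.Perm ℤ) (p q : ℤ) :
    rk (shift k * w) p (q + k) = rk w p q := by
  unfold rk
  simp only [Equiv.Perm.mul_apply, shift_apply, add_lt_add_iff_right]

section Ext

variable {e : ℕ} {a b : ℤ} {α β : ℤ → ℤ}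

/-- Normalising `w` and its deletion `y` to offset zero translates their values by different
amounts. This is the resulting change of the relabelling of values. -/
theorem Skip.shift (h : Skip e b β) (k l : ℤ) : Skip e (b - k) (fun p => β (p + l) - k) := by
  refine ⟨fun p q hpq => ?_, fun p => ?_, fun x => ?_⟩
  · exact sub_lt_sub_right (h.strictMono (by omega)) k
  · rw [show p + e + l = p + l + e by ring, h.map_add]
    ring
  · have h1 : (x ≡ b - k [ZMOD (e + 1 : ℕ)]) ↔ (x + k ≡ b [ZMOD (e + 1 : ℕ)]) :=
      ⟨fun h => by simpa using h.add_right k, fun h => by simpa using h.sub_right k⟩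
    rw [h1, ← h.range]
    constructor
    · rintro ⟨p, rfl⟩
      exact ⟨p + l, by ring⟩
    · rintro ⟨p, hp⟩
      exact ⟨p - l, by rw [sub_add_cancel, hp]; ring⟩

theorem Infl.affPart {y : extAffSym e} {w : extAffSym (e + 1)}
    (h : Infl a b α β (y : Equiv.Perm ℤ) w) :
    Infl a (b - offset w) α (fun p => β (p + offset y) - offset w)
      (AffineKL.affPart y : Equiv.Perm ℤ) (AffineKL.affPart w : Equiv.Perm ℤ) := by
  refine ⟨fun p => ?_, ?_⟩
  · rw [coe_affPart, coe_affPart, Equiv.Perm.mul_apply, Equiv.Perm.mul_apply, shift_apply,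
      shift_apply, neg_add_cancel_right, h.comp, sub_eq_add_neg]
  · rw [coe_affPart, Equiv.Perm.mul_apply, shift_apply, h.point, sub_eq_add_neg]

theorem permLength_infl (he : 0 < e) (hα : Skip e a α) (hβ : Skip e b β) {y : extAffSym e}
    {w : extAffSym (e + 1)} (h : Infl a b α β (y : Equiv.Perm ℤ) w) :
    (extLength w : ℤ) = extLength y + (2 * rk (w : Equiv.Perm ℤ) (a - 1) b + (b - offset w - a)) ∧
      extLength y ≤ extLength w := by
  have := len_infl he hα (hβ.shift (offset w) (offset y)) h.affPart
  rw [coe_affPart w, sub_eq_add_neg b (offset w), rk_shift_mul] at this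
  rw [extLength, extLength, sub_eq_add_neg b (offset w)]
  constructor
  · linarith [this.1]
  · exact this.2

theorem extKLPoly_infl (he : 0 < e) (hα : Skip e a α) (hβ : Skip e b β) {z y : extAffSym e}
    {x w : extAffSym (e + 1)} (hzx : Infl a b α β (z : Equiv.Perm ℤ) x)
    (hyw : Infl a b α β (y : Equiv.Perm ℤ) w)
    (hr : rk (x : Equiv.Perm ℤ) (a - 1) b = rk (w : Equiv.Perm ℤ) (a - 1) b)
    (h1 : offset x = offset w) (h2 : offset z = offset y) :
    extKLPoly x w = extKLPoly z y := by
  have hx := hzx.affPart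
  have hw := hyw.affPart
  rw [h1, h2] at hx
  rw [extKLPoly, extKLPoly, if_pos h1, if_pos h2]
  refine klPoly_infl he hα (hβ.shift (offset w) (offset y)) hx hw ?_
  rw [coe_affPart, coe_affPart, h1, sub_eq_add_neg b, rk_shift_mul, rk_shift_mul, hr]

end Ext

/-! ### Blocks -/

theorem blockEnd_eq_add (b : ℤ → ℕ) (r : ℤ) : blockEnd b r = blockEnd b (r - 1) + b r := by
  unfold blockEnd
  rcases le_or_gt 1 r with hr | hr
  · have e1 : Finset.Ioc r 0 = ∅ := Finset.Ioc_eq_empty (by omega)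
    have e2 : Finset.Ioc (r - 1) 0 = ∅ := Finset.Ioc_eq_empty (by omega)
    have e3 : Finset.Ioc 0 r = insert r (Finset.Ioc 0 (r - 1)) := by
      ext x
      simp only [Finset.mem_Ioc, Finset.mem_insert]
      omega
    rw [e1, e2, e3, Finset.sum_insert (by simp)]
    simp only [Finset.sum_empty]
    ring
  · have e1 : Finset.Ioc 0 r = ∅ := Finset.Ioc_eq_empty (by omega)
    have e2 : Finset.Ioc 0 (r - 1) = ∅ := Finset.Ioc_eq_empty (by omega)
    have e3 : Finset.Ioc (r - 1) 0 = insert r (Finset.Ioc r 0) := by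
      ext x
      simp only [Finset.mem_Ioc, Finset.mem_insert]
      omega
    rw [e1, e2, e3, Finset.sum_insert (by simp)]
    simp only [Finset.sum_empty]
    ring

theorem blockEnd_mono (b : ℤ → ℕ) : Monotone (blockEnd b) :=
  monotone_int_of_le_succ fun r => by
    have := blockEnd_eq_add b (r + 1)
    rw [add_sub_cancel_right] at this
    omega

theorem blockEnd_zero (b : ℤ → ℕ) : blockEnd b 0 = 0 := by simp [blockEnd]

theorem mem_block {b : ℤ → ℕ} {r p : ℤ} :
    p ∈ block b r ↔ blockEnd b (r - 1) < p ∧ p ≤ blockEnd b r := by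
  rw [block, Finset.mem_Ioc]

theorem block_index_le {b : ℤ → ℕ} {r s p q : ℤ} (hp : p ∈ block b r) (hq : q ∈ block b s)
    (h : p ≤ q) : r ≤ s := by
  rw [mem_block] at hp hq
  by_contra! h2
  have := blockEnd_mono b (show s ≤ r - 1 by omega)
  omega

theorem block_index_unique {b : ℤ → ℕ} {r s p : ℤ} (hp : p ∈ block b r) (hq : p ∈ block b s) :
    r = s :=
  le_antisymm (block_index_le hp hq le_rfl) (block_index_le hq hp le_rfl)

/-- `b` is an `n`-periodic tuple with sum `d` over a period. -/
structure IsBlocks (n d : ℕ) (b : ℤ → ℕ) : Prop where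
  one_le : 1 ≤ n
  periodic : ∀ i, b (i + n) = b i
  total_eq : total n b = d

namespace IsBlocks

variable {n d : ℕ} {b : ℤ → ℕ}

theorem blockEnd_add (h : IsBlocks n d b) (r : ℤ) : blockEnd b (r + n) = blockEnd b r + d := by
  induction r using Int.induction_on with
  | zero =>
    have h1 : ∑ k ∈ Finset.Ioc (0 : ℤ) n, (b k : ℤ) = d := by
      rw [← h.total_eq, total, Nat.cast_sum]
      refine Finset.sum_congr ?_ fun _ _ => rfl
      ext x
      simp only [Finset.mem_Ioc, Finset.mem_Icc]
      omega
    rw [blockEnd_zero, zero_add, zero_add, blockEnd, h1, Finset.Ioc_eq_empty (by omega)]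
    simp
  | succ i ih =>
    have h1 := blockEnd_eq_add b (i + 1)
    have h2 := blockEnd_eq_add b (i + 1 + n)
    rw [add_sub_cancel_right] at h1
    rw [show (i : ℤ) + 1 + n - 1 = i + n by ring, h.periodic] at h2
    omega
  | pred i ih =>
    have h1 := blockEnd_eq_add b (-i)
    have h2 := blockEnd_eq_add b (-i + n)
    rw [show -(i : ℤ) + n - 1 = -i - 1 + n by ring, h.periodic] at h2
    omega

theorem blockEnd_add_mul (h : IsBlocks n d b) (r k : ℤ) :
    blockEnd b (r + k * n) = blockEnd b r + k * d := by
  induction k using Int.induction_on with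
  | zero => simp
  | succ i ih =>
    rw [show r + ((i : ℤ) + 1) * n = r + i * n + n by ring, h.blockEnd_add, ih]
    ring
  | pred i ih =>
    have := h.blockEnd_add (r + (-(i : ℤ) - 1) * n)
    rw [show r + (-(i : ℤ) - 1) * n + n = r + -(i : ℤ) * n by ring, ih] at this
    linarith

theorem add_mem_block (h : IsBlocks n d b) {r p : ℤ} (k : ℤ) :
    p + k * d ∈ block b (r + k * n) ↔ p ∈ block b r := by
  rw [mem_block, mem_block, show r + k * n - 1 = r - 1 + k * n by ring, h.blockEnd_add_mul,
    h.blockEnd_add_mul]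
  omega

theorem block_subset (h : IsBlocks n d b) (r : ℤ) : blockEnd b r ≤ blockEnd b (r - 1) + d := by
  rw [← h.blockEnd_add]
  have := h.one_le
  exact blockEnd_mono b (by omega)

theorem eq_of_mem_block (h : IsBlocks n d b) {r p q : ℤ} (hp : p ∈ block b r)
    (hq : q ∈ block b r) (hpq : p ≡ q [ZMOD d]) : p = q := by
  rw [mem_block] at hp hq
  have := h.block_subset r
  have h1 := Int.eq_zero_of_abs_lt_dvd (Int.modEq_iff_dvd.1 hpq) (by rw [abs_lt]; omega)
  omega

theorem exists_mem_block (h : IsBlocks n d b) (hd : 0 < d) (p : ℤ) : ∃ r, p ∈ block b r := by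
  have h0 : ∀ k : ℤ, blockEnd b (k * n) = k * d := fun k => by
    have := h.blockEnd_add_mul 0 k
    rwa [zero_add, blockEnd_zero, zero_add] at this
  have hd1 : (1 : ℤ) ≤ d := by omega
  -- The block of `p` is the first one whose end is at least `p`; the bounds come from `blockEnd b
  -- (k * n) = k * d`.
  obtain ⟨r, hr, hmin⟩ := Int.exists_least_of_bdd (P := fun r => p ≤ blockEnd b r)
    ⟨(-|p| - 1) * n, fun z hz => by
      by_contra! h1
      have h2 := blockEnd_mono b h1.le
      rw [h0] at h2
      have h3 := neg_abs_le p
      nlinarith [abs_nonneg p]⟩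
    ⟨|p| * n, by
      rw [h0]
      have h3 := le_abs_self p
      nlinarith [abs_nonneg p]⟩
  refine ⟨r, mem_block.2 ⟨?_, hr⟩⟩
  by_contra! h1
  have := hmin _ h1
  omega

theorem le_sum (h : IsBlocks n d b) (r : ℤ) : b r ≤ d := by
  have h1 := h.block_subset r
  have h2 := blockEnd_eq_add b r
  omega

/-- A reflection exchanging two elements of a block preserves all blocks. -/
theorem refl_mem_block (h : IsBlocks n d b) (hd : 0 < d) {t u v : ℤ} (hu : u ∈ block b t)
    (hv : v ∈ block b t) (hne : ¬ u ≡ v [ZMOD d]) {r x : ℤ} :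
    refl d u v x ∈ block b r ↔ x ∈ block b r := by
  have key : ∀ x, x ∈ block b r → refl d u v x ∈ block b r := by
    intro x hx
    by_cases h1 : x ≡ u [ZMOD d]
    · obtain ⟨k, rfl⟩ := modEq_iff_exists.1 h1
      rw [map_add_mul (refl_mem_extAffSym _ _ _), refl_left hd hne]
      rw [block_index_unique hx ((h.add_mem_block k).2 hu)]
      exact (h.add_mem_block k).2 hv
    · by_cases h2 : x ≡ v [ZMOD d]
      · obtain ⟨k, rfl⟩ := modEq_iff_exists.1 h2
        rw [map_add_mul (refl_mem_extAffSym _ _ _), refl_right hd hne]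
        rw [block_index_unique hx ((h.add_mem_block k).2 hv)]
        exact (h.add_mem_block k).2 hu
      · rwa [refl_of_ne h1 h2]
  exact ⟨fun hx => by simpa [refl_refl_apply] using key _ hx, key x⟩

end IsBlocks

theorem psi_eq_card (b c : ℤ → ℕ) (w : Equiv.Perm ℤ) (r s : ℤ) :
    psi b c w r s = ((block b r).filter (fun p => w p ∈ block c s)).card := by
  rw [psi, ← Finset.card_image_of_injective ((block b r).filter _) w.injective]
  congr 1
  ext x
  simp only [Finset.mem_inter, Finset.mem_image, Finset.mem_filter]
  constructor
  · rintro ⟨⟨p, hp, rfl⟩, hx⟩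
    exact ⟨p, ⟨hp, hx⟩, rfl⟩
  · rintro ⟨p, ⟨hp, hx⟩, rfl⟩
    exact ⟨⟨p, hp, rfl⟩, hx⟩

/-- Send a counted position `p` to the pair formed by the block of `p` and the block of `w p`. The
fibre over a cell of the corner has as many elements as the entry there. Columns `≥ j` consist of
the values beyond the end of `C_{j-1}`, whence `j - 1`. -/
theorem corner_eq_rk {n n' d : ℕ} {b c : ℤ → ℕ} (hb : IsBlocks n d b) (hc : IsBlocks n' d c)
    (hd : 0 < d) {m : AffMat n b n' c} {w : Equiv.Perm ℤ} (hw : w ∈ extAffSym d)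
    (hm : psi b c w = m.entry) (i j : ℤ) :
    m.corner i j = rk w (blockEnd b i) (blockEnd c (j - 1)) := by
  classical
  choose row hrow using hb.exists_mem_block hd
  choose col hcol using hc.exists_mem_block hd
  have hfin := rk_finite hd hw (blockEnd b i) (blockEnd c (j - 1))
  set F := hfin.toFinset with hF
  have hFmem : ∀ p, p ∈ F ↔ p ≤ blockEnd b i ∧ blockEnd c (j - 1) < w p := fun p => by
    rw [hF, Set.Finite.mem_toFinset]
    rfl
  have hblk : ∀ {r s p}, p ∈ block b r → w p ∈ block c s → (p ∈ F ↔ r ≤ i ∧ j ≤ s) := by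
    intro r s p hp hs
    rw [hFmem]
    rw [mem_block] at hp hs
    constructor
    · rintro ⟨h1, h2⟩
      constructor
      · by_contra! h3
        have := blockEnd_mono b (show i ≤ r - 1 by omega)
        omega
      · by_contra! h3
        have := blockEnd_mono c (show s ≤ j - 1 by omega)
        omega
    · rintro ⟨h1, h2⟩
      have h3 := blockEnd_mono b h1
      have h4 := blockEnd_mono c (show j - 1 ≤ s - 1 by omega)
      omega
  let g : ℤ → ℤ × ℤ := fun p => (row p, col (w p))
  have hg : ∀ {r s p}, g p = (r, s) ↔ p ∈ block b r ∧ w p ∈ block c s := by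
    intro r s p
    simp only [g, Prod.mk.injEq]
    constructor
    · rintro ⟨rfl, rfl⟩
      exact ⟨hrow p, hcol _⟩
    · rintro ⟨h1, h2⟩
      exact ⟨block_index_unique (hrow p) h1, block_index_unique (hcol _) h2⟩
  have hfib : ∀ r s, r ≤ i ∧ j ≤ s → (F.filter (fun p => g p = (r, s))).card = m.entry r s := by
    intro r s hrs
    rw [← hm, psi_eq_card]
    congr 1
    ext p
    rw [Finset.mem_filter, Finset.mem_filter, hg]
    exact ⟨fun h => h.2, fun h => ⟨(hblk h.1 h.2).2 hrs, h⟩⟩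
  have hin : ∀ x ∈ F.image g, x.1 ≤ i ∧ j ≤ x.2 := by
    intro x hx
    obtain ⟨p, hp, rfl⟩ := Finset.mem_image.1 hx
    exact (hblk (hrow p) (hcol _)).1 hp
  have e1 : rk w (blockEnd b i) (blockEnd c (j - 1)) = F.card := by
    rw [rk, Set.ncard_eq_toFinset_card _ hfin]
  rw [e1, Finset.card_eq_sum_card_image g F, AffMat.corner,
    finsum_eq_sum_of_support_subset (s := F.image g)]
  · refine Finset.sum_congr rfl fun x hx => ?_
    rw [if_pos (hin x hx), ← hfib _ _ (hin x hx)]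
  · intro x hx
    rw [Function.mem_support] at hx
    have h1 : x.1 ≤ i ∧ j ≤ x.2 := by
      by_contra h
      exact hx (if_neg h)
    rw [if_pos h1, ← hfib _ _ h1] at hx
    obtain ⟨p, hp⟩ := Finset.card_pos.1 (Nat.pos_of_ne_zero hx)
    rw [Finset.mem_filter] at hp
    rw [Finset.mem_coe]
    exact Finset.mem_image.2 ⟨p, hp⟩

/-! ### Permutations decreasing on blocks -/

/-- `w` is decreasing on the blocks of `b`, and `w⁻¹` is decreasing on the blocks of `c`. -/
structure Decr (b c : ℤ → ℕ) (w : Equiv.Perm ℤ) : Prop where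
  row : ∀ {r p q}, p ∈ block b r → q ∈ block b r → p < q → w q < w p
  col : ∀ {s p q}, w p ∈ block c s → w q ∈ block c s → p < q → w q < w p

theorem rk_eq_add_card {d : ℕ} (hd : 0 < d) {w : Equiv.Perm ℤ} (hw : w ∈ extAffSym d) {p p' : ℤ}
    (hp : p ≤ p') (v : ℤ) :
    rk w p' v = rk w p v + ((Finset.Ioc p p').filter (fun q => v < w q)).card := by
  have e : {r : ℤ | r ≤ p' ∧ v < w r} = {r : ℤ | r ≤ p ∧ v < w r} ∪
      ↑((Finset.Ioc p p').filter (fun q => v < w q)) := by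
    ext r
    simp only [Set.mem_union, Set.mem_ofPred_eq, Finset.mem_coe, Finset.mem_filter, Finset.mem_Ioc]
    constructor
    · rintro ⟨h1, h2⟩
      by_cases h3 : r ≤ p
      · exact Or.inl ⟨h3, h2⟩
      · exact Or.inr ⟨⟨by omega, h1⟩, h2⟩
    · rintro (⟨h1, h2⟩ | ⟨h1, h2⟩)
      · exact ⟨by omega, h2⟩
      · exact ⟨h1.2, h2⟩
  rw [rk, e, Set.ncard_union_eq ?_ (rk_finite hd hw _ _) (Finset.finite_toSet _),
    Set.ncard_coe_finset, rk]
  rw [Set.disjoint_left]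
  rintro r ⟨h1, -⟩ h2
  rw [Finset.mem_coe, Finset.mem_filter, Finset.mem_Ioc] at h2
  omega

/-- The rank at a point of a decreasing permutation, in terms of the ranks at the block ends. -/
theorem rk_subset_row {b : ℤ → ℕ} {w : Equiv.Perm ℤ} {p i v : ℤ} (hv : v ≤ w p) :
    {q : ℤ | q ≤ p - 1 ∧ w p < w q} ⊆ {q : ℤ | q ≤ blockEnd b (i - 1) ∧ v < w q} ∪
      ↑(Finset.Ioc (blockEnd b (i - 1)) (p - 1)) := by
  rintro q ⟨h1, h2⟩
  simp only [Set.mem_union, Set.mem_ofPred_eq, Finset.mem_coe, Finset.mem_Ioc]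
  omega

theorem rk_subset_col {w : Equiv.Perm ℤ} {p v y : ℤ} (hy : p ≤ y) :
    {q : ℤ | q ≤ p - 1 ∧ w p < w q} ⊆ {q : ℤ | q ≤ y ∧ v < w q} ∪
      ↑((Finset.Ioc (w p) v).image w.symm) := by
  rintro q ⟨h1, h2⟩
  by_cases h3 : v < w q
  · exact Or.inl ⟨by omega, h3⟩
  · refine Or.inr ?_
    rw [Finset.mem_coe, Finset.mem_image]
    exact ⟨w q, Finset.mem_Ioc.2 ⟨h2, by omega⟩, w.symm_apply_apply q⟩

theorem ncard_row_union {d : ℕ} (hd : 0 < d) {w : Equiv.Perm ℤ} (hw : w ∈ extAffSym d)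
    (x p v : ℤ) :
    ({q : ℤ | q ≤ x ∧ v < w q} ∪ ↑(Finset.Ioc x (p - 1))).ncard
      = rk w x v + (p - 1 - x).toNat := by
  rw [Set.ncard_union_eq ?_ (rk_finite hd hw _ _) (Finset.finite_toSet _), Set.ncard_coe_finset,
    Int.card_Ioc, rk]
  rw [Set.disjoint_left]
  rintro q ⟨h1, -⟩ h2
  rw [Finset.mem_coe, Finset.mem_Ioc] at h2
  omega

theorem ncard_col_union {d : ℕ} (hd : 0 < d) {w : Equiv.Perm ℤ} (hw : w ∈ extAffSym d)
    (y p v : ℤ) :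
    ({q : ℤ | q ≤ y ∧ v < w q} ∪ ↑((Finset.Ioc (w p) v).image w.symm)).ncard
      = rk w y v + (v - w p).toNat := by
  rw [Set.ncard_union_eq ?_ (rk_finite hd hw _ _) (Finset.finite_toSet _), Set.ncard_coe_finset,
    Finset.card_image_of_injective _ w.symm.injective, Int.card_Ioc, rk]
  rw [Set.disjoint_left]
  rintro q ⟨-, h1⟩ h2
  rw [Finset.mem_coe, Finset.mem_image] at h2
  obtain ⟨u, hu, rfl⟩ := h2
  rw [Equiv.apply_symm_apply] at h1
  rw [Finset.mem_Ioc] at hu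
  omega

namespace Decr

variable {d : ℕ} {b c : ℤ → ℕ} {w : Equiv.Perm ℤ}

/-- For a decreasing permutation the inclusion `rk_subset_row` is an equality: earlier positions of
the same row block have larger values, and so do earlier positions with values in the same column
block. -/
theorem rk_eq_row (h : Decr b c w) (hd : 0 < d) (hw : w ∈ extAffSym d) {p i j : ℤ}
    (hp : p ∈ block b i) (hwp : w p ∈ block c j) :
    rk w (p - 1) (w p) = rk w (blockEnd b (i - 1)) (blockEnd c (j - 1))
      + (p - 1 - blockEnd b (i - 1)).toNat := by
  have hp' := mem_block.1 hp
  have hwp' := mem_block.1 hwp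
  rw [← ncard_row_union hd hw, rk]
  congr 1
  refine subset_antisymm (rk_subset_row hwp'.1.le) ?_
  rintro q (⟨h1, h2⟩ | h1)
  · refine ⟨by omega, ?_⟩
    by_cases h3 : w q ≤ blockEnd c j
    · exact h.col (mem_block.2 ⟨h2, h3⟩) hwp (by omega)
    · omega
  · rw [Finset.mem_coe, Finset.mem_Ioc] at h1
    exact ⟨h1.2, h.row (mem_block.2 ⟨h1.1, by omega⟩) hp (by omega)⟩

/-- The counterpart of `rk_eq_row` at the opposite corner of the cell: positions with larger values
in the same column block come earlier, and so do positions of the row block with values beyond the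
column block. -/
theorem rk_eq_col (h : Decr b c w) (hd : 0 < d) (hw : w ∈ extAffSym d) {p i j : ℤ}
    (hp : p ∈ block b i) (hwp : w p ∈ block c j) :
    rk w (p - 1) (w p) = rk w (blockEnd b i) (blockEnd c j)
      + (blockEnd c j - w p).toNat := by
  have hp' := mem_block.1 hp
  have hwp' := mem_block.1 hwp
  rw [← ncard_col_union hd hw, rk]
  congr 1
  refine subset_antisymm (rk_subset_col hp'.2) ?_
  rintro q (⟨h1, h2⟩ | h1)
  · refine ⟨?_, by omega⟩
    by_contra! h3
    have h4 : p ≠ q := by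
      rintro rfl
      omega
    have := h.row hp (mem_block.2 ⟨by omega, h1⟩) (by omega)
    omega
  · rw [Finset.mem_coe, Finset.mem_image] at h1
    obtain ⟨u, hu, rfl⟩ := h1
    rw [Finset.mem_Ioc] at hu
    refine ⟨?_, by rw [Equiv.apply_symm_apply]; omega⟩
    by_contra! h3
    have h4 : p ≠ w.symm u := by
      rintro rfl
      rw [Equiv.apply_symm_apply] at hu
      omega
    have := h.col (q := w.symm u) hwp
      (by rw [Equiv.apply_symm_apply]; exact mem_block.2 ⟨by omega, hu.2⟩) (by omega)
    rw [Equiv.apply_symm_apply] at this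
    omega

/-- As `w` decreases on the block, the positions in it with value greater than `v` form an initial
segment, whose length is the difference of two ranks at block ends. -/
theorem lt_apply_iff (h : Decr b c w) (hd : 0 < d) (hw : w ∈ extAffSym d) {p i : ℤ}
    (hp : p ∈ block b i) (v : ℤ) :
    v < w p ↔ p - blockEnd b (i - 1) ≤ rk w (blockEnd b i) v - rk w (blockEnd b (i - 1)) v := by
  have hp' := mem_block.1 hp
  rw [rk_eq_add_card hd hw (blockEnd_mono b (show i - 1 ≤ i by omega)) v]
  set T := (Finset.Ioc (blockEnd b (i - 1)) (blockEnd b i)).filter (fun q => v < w q) with hT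
  have hTm : ∀ q, q ∈ T ↔ q ∈ block b i ∧ v < w q := fun q => by
    rw [hT, Finset.mem_filter, block]
  constructor
  · intro hv
    have h1 : Finset.Ioc (blockEnd b (i - 1)) p ⊆ T := by
      intro q hq
      rw [Finset.mem_Ioc] at hq
      have hqb : q ∈ block b i := mem_block.2 ⟨hq.1, by omega⟩
      rw [hTm]
      refine ⟨hqb, ?_⟩
      rcases hq.2.lt_or_eq with h2 | rfl
      · have := h.row hqb hp h2
        omega
      · exact hv
    have h2 := Finset.card_le_card h1
    rw [Int.card_Ioc] at h2
    omega
  · intro hle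
    by_contra hv
    have h1 : T ⊆ Finset.Ioc (blockEnd b (i - 1)) (p - 1) := by
      intro q hq
      rw [hTm] at hq
      have hqb := mem_block.1 hq.1
      rw [Finset.mem_Ioc]
      refine ⟨hqb.1, ?_⟩
      by_contra! h2
      rcases (show p ≤ q by omega).lt_or_eq with h3 | rfl
      · have := h.row hp hq.1 h3
        have := hq.2
        omega
      · exact hv hq.2
    have h2 := Finset.card_le_card h1
    rw [Int.card_Ioc] at h2
    omega

/-- Two decreasing permutations agree at a position if they send it to the same block and have the
same ranks at two opposite corners of the cell. -/
theorem apply_eq (h : Decr b c w) {w' : Equiv.Perm ℤ} (h' : Decr b c w') (hd : 0 < d)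
    (hw : w ∈ extAffSym d) (hw' : w' ∈ extAffSym d) {p i j : ℤ} (hp : p ∈ block b i)
    (hwp : w p ∈ block c j) (hwp' : w' p ∈ block c j)
    (h1 : rk w (blockEnd b (i - 1)) (blockEnd c (j - 1))
      = rk w' (blockEnd b (i - 1)) (blockEnd c (j - 1)))
    (h2 : rk w (blockEnd b i) (blockEnd c j) = rk w' (blockEnd b i) (blockEnd c j)) :
    w p = w' p ∧ rk w (p - 1) (w p) = rk w' (p - 1) (w' p) := by
  have e1 := h.rk_eq_row hd hw hp hwp
  have e2 := h.rk_eq_col hd hw hp hwp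
  have e1' := h'.rk_eq_row hd hw' hp hwp'
  have e2' := h'.rk_eq_col hd hw' hp hwp'
  have := mem_block.1 hwp
  have := mem_block.1 hwp'
  omega

/-- The ranks at block ends determine the column block of `w p` by `lt_apply_iff`, and then the
value itself by `apply_eq`. -/
theorem eq_of_rk_eq {n n' : ℕ} (hb : IsBlocks n d b) (hc : IsBlocks n' d c) (h : Decr b c w)
    {w' : Equiv.Perm ℤ} (h' : Decr b c w') (hd : 0 < d) (hw : w ∈ extAffSym d)
    (hw' : w' ∈ extAffSym d)
    (hr : ∀ i j, rk w (blockEnd b i) (blockEnd c j) = rk w' (blockEnd b i) (blockEnd c j)) :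
    w = w' := by
  ext p
  obtain ⟨i, hi⟩ := hb.exists_mem_block hd p
  obtain ⟨j, hj⟩ := hc.exists_mem_block hd (w p)
  have hj' : w' p ∈ block c j := by
    have hj1 := mem_block.1 hj
    rw [mem_block, h'.lt_apply_iff hd hw' hi, ← hr, ← hr, ← h.lt_apply_iff hd hw hi,
      ← not_lt, h'.lt_apply_iff hd hw' hi, ← hr, ← hr, ← h.lt_apply_iff hd hw hi, not_lt]
    exact hj1
  exact (h.apply_eq h' hd hw hw' hi hj hj' (hr _ _) (hr _ _)).1

end Decr

/-! ### Removing and adding the matrix `e` -/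

theorem unitMat_swap (n n' : ℕ) (i j r s : ℤ) : unitMat n n' i j r s = unitMat n' n j i s r := by
  unfold unitMat
  congr 1
  exact propext (exists_congr fun _ => and_comm)

theorem unitMat_add_mul {n : ℕ} (hn : 1 ≤ n) (n' : ℕ) (i j k s : ℤ) :
    unitMat n n' i j (i + k * n) s = if s = j + k * n' then 1 else 0 := by
  unfold unitMat
  congr 1
  refine propext ⟨?_, fun h => ⟨k, rfl, h⟩⟩
  rintro ⟨l, h1, h2⟩
  have h3 : (n : ℤ) ≠ 0 := by omega
  have h4 : k = l := mul_right_cancel₀ h3 (by linarith)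
  rw [h2, h4]

theorem unitMat_of_not_modEq {n n' : ℕ} {i j r s : ℤ} (h : ¬ r ≡ i [ZMOD n]) :
    unitMat n n' i j r s = 0 := by
  unfold unitMat
  refine if_neg ?_
  rintro ⟨k, h1, -⟩
  exact h (modEq_iff_exists.2 ⟨k, h1⟩)

theorem unitMat_support_finite {n : ℕ} (hn : 1 ≤ n) (n' : ℕ) (i j r : ℤ) :
    {s | unitMat n n' i j r s ≠ 0}.Finite := by
  by_cases h : r ≡ i [ZMOD n]
  · obtain ⟨k, rfl⟩ := modEq_iff_exists.1 h
    refine (Set.finite_singleton (j + k * n')).subset fun s hs => ?_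
    by_contra h2
    exact hs (by rw [unitMat_add_mul hn]; exact if_neg h2)
  · refine Set.finite_empty.subset fun s hs => ?_
    exact absurd (unitMat_of_not_modEq h) hs

theorem finsum_unitMat {n : ℕ} (hn : 1 ≤ n) (n' : ℕ) (i j r : ℤ) :
    ∑ᶠ s, unitMat n n' i j r s = if r ≡ i [ZMOD n] then 1 else 0 := by
  split_ifs with h
  · obtain ⟨k, rfl⟩ := modEq_iff_exists.1 h
    rw [finsum_eq_single _ (j + k * n') fun s hs => by rw [unitMat_add_mul hn, if_neg hs],
      unitMat_add_mul hn, if_pos rfl]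
  · simp only [unitMat_of_not_modEq h, finsum_zero]

theorem unitMat_add (n n' : ℕ) (i j r s : ℤ) :
    unitMat n n' i j (r + n) (s + n') = unitMat n n' i j r s := by
  unfold unitMat
  congr 1
  refine propext ⟨?_, ?_⟩
  · rintro ⟨k, h1, h2⟩
    exact ⟨k - 1, by linarith, by linarith⟩
  · rintro ⟨k, h1, h2⟩
    exact ⟨k + 1, by linarith, by linarith⟩

namespace AffMat

variable {n : ℕ} {b : ℤ → ℕ} {n' : ℕ} {c : ℤ → ℕ}

theorem entry_add_mul (m : AffMat n b n' c) (i j k : ℤ) :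
    m.entry (i + k * n) (j + k * n') = m.entry i j := by
  induction k using Int.induction_on with
  | zero => simp
  | succ k ih =>
    rw [show i + ((k : ℤ) + 1) * n = i + k * n + n by ring,
      show j + ((k : ℤ) + 1) * n' = j + k * n' + n' by ring, m.periodic, ih]
  | pred k ih =>
    rw [← ih, ← m.periodic (i + (-(k : ℤ) - 1) * n)]
    congr 1 <;> ring

theorem entry_le_row (m : AffMat n b n' c) (i j : ℤ) : m.entry i j ≤ b i := by
  rw [← m.row_sum i]
  exact single_le_finsum j (m.row_finite i) fun _ => Nat.zero_le _

theorem entry_le_col (m : AffMat n b n' c) (i j : ℤ) : m.entry i j ≤ c j := by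
  rw [← m.col_sum j]
  exact single_le_finsum (f := fun i => m.entry i j) i (m.col_finite j) fun _ => Nat.zero_le _

theorem unitMat_le (m : AffMat n b n' c) {i j : ℤ} (h : 1 ≤ m.entry i j) (r s : ℤ) :
    unitMat n n' i j r s ≤ m.entry r s := by
  unfold unitMat
  split_ifs with h1
  · obtain ⟨k, rfl, rfl⟩ := h1
    rwa [m.entry_add_mul]
  · exact Nat.zero_le _

/-- The matrix `m - e`. -/
noncomputable def sub (m : AffMat n b n' c) (hn : 1 ≤ n) (hn' : 1 ≤ n') {i j : ℤ}
    (h : 1 ≤ m.entry i j) : AffMat n (lower n b i) n' (lower n' c j) where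
  entry r s := m.entry r s - unitMat n n' i j r s
  periodic r s := by rw [m.periodic, unitMat_add]
  row_finite r := (m.row_finite r).subset fun s hs => by
    have := m.unitMat_le h r s
    simp only [Set.mem_ofPred_eq] at hs ⊢
    omega
  row_sum r := by
    have h1 : ∑ᶠ s, m.entry r s = ∑ᶠ s, ((m.entry r s - unitMat n n' i j r s)
        + unitMat n n' i j r s) := finsum_congr fun s => by
      have := m.unitMat_le h r s
      omega
    rw [finsum_add_distrib ((m.row_finite r).subset fun s hs => by
        simp only [Function.mem_support, Set.mem_ofPred_eq] at hs ⊢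
        omega) (unitMat_support_finite hn n' i j r), finsum_unitMat hn, m.row_sum] at h1
    rw [lower]
    omega
  col_finite s := (m.col_finite s).subset fun r hr => by
    simp only [Set.mem_ofPred_eq] at hr ⊢
    omega
  col_sum s := by
    have h1 : ∑ᶠ r, m.entry r s = ∑ᶠ r, ((m.entry r s - unitMat n n' i j r s)
        + unitMat n' n j i s r) := finsum_congr fun r => by
      have := m.unitMat_le h r s
      rw [unitMat_swap n' n]
      omega
    rw [finsum_add_distrib ((m.col_finite s).subset fun r hr => by
        simp only [Function.mem_support, Set.mem_ofPred_eq] at hr ⊢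
        omega) (unitMat_support_finite hn' n j i s), finsum_unitMat hn', m.col_sum] at h1
    rw [lower]
    omega

/-- The matrix `q + e`. -/
noncomputable def add {i j : ℤ} (q : AffMat n (lower n b i) n' (lower n' c j)) (hn : 1 ≤ n)
    (hn' : 1 ≤ n') (hb : ∀ r, r ≡ i [ZMOD n] → 1 ≤ b r) (hc : ∀ s, s ≡ j [ZMOD n'] → 1 ≤ c s) :
    AffMat n b n' c where
  entry r s := q.entry r s + unitMat n n' i j r s
  periodic r s := by rw [q.periodic, unitMat_add]
  row_finite r := ((q.row_finite r).union (unitMat_support_finite hn n' i j r)).subset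
    fun s hs => by
      simp only [Set.mem_ofPred_eq, Set.mem_union] at hs ⊢
      omega
  row_sum r := by
    rw [finsum_add_distrib (q.row_finite r) (unitMat_support_finite hn n' i j r),
      finsum_unitMat hn, q.row_sum, lower]
    have := hb r
    split_ifs with h
    · have := hb r h
      omega
    · omega
  col_finite s := ((q.col_finite s).union (unitMat_support_finite hn' n j i s)).subset
    fun r hr => by
      rw [Set.mem_union, Set.mem_ofPred_eq, Set.mem_ofPred_eq, ← unitMat_swap]
      rw [Set.mem_ofPred_eq] at hr
      omega
  col_sum s := by
    simp only [unitMat_swap n n']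
    rw [finsum_add_distrib (q.col_finite s) (unitMat_support_finite hn' n j i s),
      finsum_unitMat hn', q.col_sum, lower]
    split_ifs with h
    · have := hc s h
      omega
    · omega

end AffMat

/-! ### Deleting a point from blocks -/

theorem ediv_eq_of_le_of_lt {x d k : ℤ} (hd : 0 < d) (h1 : k * d ≤ x) (h2 : x < (k + 1) * d) :
    x / d = k :=
  le_antisymm (Int.lt_add_one_iff.1 (Int.ediv_lt_of_lt_mul hd h2)) (Int.le_ediv_of_mul_le hd h1)

theorem exists_ediv {d : ℤ} (hd : 0 < d) (x : ℤ) :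
    ∃ t, 0 ≤ t ∧ t < d ∧ x = x / d * d + t :=
  ⟨x % d, Int.emod_nonneg _ hd.ne', Int.emod_lt_of_pos _ hd, by
    rw [mul_comm]; exact (Int.mul_ediv_add_emod x d).symm⟩

theorem ediv_sub_ediv {n : ℤ} (hn : 0 < n) (x : ℤ) :
    x / n - (x - 1) / n = if n ∣ x then 1 else 0 := by
  obtain ⟨t, h0, h1, h2⟩ := exists_ediv hn x
  split_ifs with h
  · obtain ⟨k, rfl⟩ := h
    rw [Int.mul_ediv_cancel_left _ hn.ne', ediv_eq_of_le_of_lt (k := k - 1) hn (by linarith)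
      (by linarith)]
    ring
  · have h3 : t ≠ 0 := by
      rintro rfl
      exact h ⟨x / n, by linarith⟩
    have : 1 ≤ t := by omega
    rw [ediv_eq_of_le_of_lt (x := x - 1) (k := x / n) hn (by linarith) (by linarith)]
    ring

namespace IsBlocks

variable {n d : ℕ} {b : ℤ → ℕ}

theorem apply_of_modEq (h : IsBlocks n d b) {r i : ℤ} (hr : r ≡ i [ZMOD n]) : b r = b i := by
  obtain ⟨k, rfl⟩ := modEq_iff_exists.1 hr
  have hp : Function.Periodic b (n : ℤ) := h.periodic
  have := hp.int_mul k i
  simpa using this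

/-- The difference of quotients is the signed number of members of the class of `i` between `0` and
`r`, the blocks that lose an element. -/
theorem blockEnd_lower (h : IsBlocks n d b) {i : ℤ} (hi : 1 ≤ b i) (r : ℤ) :
    blockEnd (lower n b i) r = blockEnd b r - ((r - i) / n - (-i) / n) := by
  have hn : (0 : ℤ) < n := by have := h.one_le; omega
  have step : ∀ r : ℤ, ((lower n b i r : ℕ) : ℤ) = b r - ((r - i) / n - (r - 1 - i) / n) := by
    intro r
    rw [show r - 1 - i = r - i - 1 by ring, ediv_sub_ediv hn, lower]
    have e : (r ≡ i [ZMOD n]) ↔ (n : ℤ) ∣ r - i := by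
      rw [Int.modEq_comm, Int.modEq_iff_dvd]
    by_cases h1 : r ≡ i [ZMOD n]
    · rw [if_pos h1, if_pos (e.1 h1), Nat.cast_sub (by rw [h.apply_of_modEq h1]; exact hi)]
      simp
    · rw [if_neg h1, if_neg (fun h2 => h1 (e.2 h2))]
      simp
  induction r using Int.induction_on with
  | zero => simp [blockEnd_zero]
  | succ r ih =>
    have h1 := blockEnd_eq_add b (r + 1)
    have h2 := blockEnd_eq_add (lower n b i) (r + 1)
    have h3 := step (r + 1)
    rw [add_sub_cancel_right] at h1 h2 h3
    linarith
  | pred r ih =>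
    have h1 := blockEnd_eq_add b (-r)
    have h2 := blockEnd_eq_add (lower n b i) (-r)
    have h3 := step (-r)
    linarith

theorem one_le_of_mem (_ : IsBlocks n d b) {i a : ℤ} (ha : a ∈ block b i) : 1 ≤ b i := by
  have h1 := mem_block.1 ha
  have h2 := blockEnd_eq_add b i
  omega

theorem lower {e : ℕ} (h : IsBlocks n (e + 1) b) {i : ℤ} (hi : 1 ≤ b i) :
    IsBlocks n e (AffineKL.lower n b i) := by
  have hn : (0 : ℤ) < n := by have := h.one_le; omega
  refine ⟨h.one_le, fun r => ?_, ?_⟩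
  · have e : (r + n ≡ i [ZMOD n]) ↔ (r ≡ i [ZMOD n]) := by simp [Int.ModEq]
    unfold AffineKL.lower
    simp only [h.periodic, e]
  · have h1 := h.blockEnd_lower hi n
    have h2 := h.blockEnd_add 0
    have h3 : ∀ b : ℤ → ℕ, blockEnd b n = total n b := fun b => by
      rw [blockEnd, total, Nat.cast_sum, Finset.Ioc_eq_empty (a := (n : ℤ)) (by omega), Finset.sum_empty,
        sub_zero]
      refine Finset.sum_congr ?_ fun _ _ => rfl
      ext x
      simp only [Finset.mem_Ioc, Finset.mem_Icc]
      omega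
    rw [zero_add, blockEnd_zero] at h2
    have h4 := Int.add_mul_ediv_right (-i) 1 hn.ne'
    rw [one_mul, show -i + (n : ℤ) = n - i by ring] at h4
    rw [h3, h2, h4] at h1
    push_cast at h1
    omega

/-- The relabelling of positions when `a` and its translates are deleted. -/
theorem exists_skip {e : ℕ} (h : IsBlocks n (e + 1) b) (he : 0 < e) {i a : ℤ}
    (ha : a ∈ block b i) :
    ∃ α, Skip e a α ∧ ∀ p r, α p ∈ block b r ↔ p ∈ block (AffineKL.lower n b i) r := by
  have hn : (0 : ℤ) < n := by have := h.one_le; omega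
  have he' : (0 : ℤ) < e := by omega
  -- Both block systems are normalised at `0`, and `c` accounts for the blocks lowered between `0`
  -- and `i`. The quotient in `α` adds one jump for each translate of `a` that is passed.
  set c : ℤ := (-i) / n with hc
  let α : ℤ → ℤ := fun p => p - c + (p - a - c - 1) / e
  have hα : ∀ p, ∃ k t : ℤ, 0 ≤ t ∧ t < e ∧ p = a + c + 1 + k * e + t ∧
      α p = a + 1 + t + k * (e + 1) := by
    intro p
    obtain ⟨t, h0, h1, h2⟩ := exists_ediv he' (p - a - c - 1)
    refine ⟨(p - a - c - 1) / e, t, h0, h1, by linarith, ?_⟩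
    simp only [α]
    linarith
  -- Between the `k`-th translate of `a` and the next one, the bound is corrected by `k - c`,
  -- exactly as the block ends are in `blockEnd_lower`.
  have key : ∀ p x k, a + k * (e + 1) ≤ x → x < a + (k + 1) * (e + 1) →
      (α p ≤ x ↔ p ≤ x - k + c) := by
    intro p x k h1 h2
    obtain ⟨l, t, h3, h4, h5, h6⟩ := hα p
    rw [h6]
    rcases lt_trichotomy l k with hlk | rfl | hlk
    · have h7 : (l + 1) * (e : ℤ) ≤ k * e := by
        apply mul_le_mul_of_nonneg_right _ he'.le
        omega
      constructor <;> intro _ <;> linarith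
    · constructor <;> intro _ <;> linarith
    · have h7 : (k + 1) * (e : ℤ) ≤ l * e := by
        apply mul_le_mul_of_nonneg_right _ he'.le
        omega
      constructor <;> intro _ <;> linarith
  refine ⟨α, ⟨fun p q hpq => ?_, fun p => ?_, fun x => ?_⟩, ?_⟩
  · have := Int.ediv_le_ediv he' (show p - a - c - 1 ≤ q - a - c - 1 by omega)
    simp only [α]
    omega
  · simp only [α]
    rw [show p + e - a - c - 1 = p - a - c - 1 + 1 * e by ring,
      Int.add_mul_ediv_right _ _ he'.ne']
    push_cast
    ring
  · constructor
    · rintro ⟨p, rfl⟩ hmod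
      obtain ⟨k, t, h1, h2, -, h3⟩ := hα p
      obtain ⟨l, hl⟩ := modEq_iff_exists.1 hmod
      rw [h3] at hl
      push_cast at hl
      have h4 : (e : ℤ) + 1 ∣ t + 1 := ⟨l - k, by linarith⟩
      have := Int.le_of_dvd (by omega) h4
      omega
    · intro hmod
      obtain ⟨t, h1, h2, h3⟩ := exists_ediv (show (0 : ℤ) < e + 1 by omega) (x - a)
      have h4 : t ≠ 0 := by
        rintro rfl
        exact hmod (modEq_iff_exists.2 ⟨(x - a) / (e + 1), by push_cast; linarith⟩)
      refine ⟨a + c + 1 + (x - a) / (e + 1) * e + (t - 1), ?_⟩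
      simp only [α]
      rw [ediv_eq_of_le_of_lt (k := (x - a) / (e + 1)) he' (by linarith [show 1 ≤ t by omega])
        (by linarith)]
      linarith
  · have hend : ∀ p r, α p ≤ blockEnd b r ↔ p ≤ blockEnd (AffineKL.lower n b i) r := by
      intro p r
      obtain ⟨t, h1, h2, h3⟩ := exists_ediv hn (r - i)
      set k := (r - i) / (n : ℤ) with hk
      -- Since `i + k n ≤ r < i + (k + 1) n`, the end of the `r`-th block lies in the window
      -- starting at the `k`-th translate of `a`.
      have ha1 := mem_block.1 ((h.add_mem_block k).2 ha)
      have ha2 := mem_block.1 ((h.add_mem_block (k + 1)).2 ha)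
      have m1 := blockEnd_mono b (show i + k * n ≤ r by linarith)
      have m2 := blockEnd_mono b (show r ≤ i + (k + 1) * n - 1 by
        have : r < i + (k + 1) * n := by linarith
        omega)
      push_cast at ha1 ha2
      rw [h.blockEnd_lower (h.one_le_of_mem ha), ← hk, ← hc,
        key p (blockEnd b r) k (by linarith) (by linarith)]
      constructor <;> intro _ <;> linarith
    intro p r
    rw [mem_block, mem_block, hend, ← not_le, hend, not_le]

end IsBlocks

/-! ### The matrix of an insertion -/

section Psi

variable {n n' d : ℕ} {b c : ℤ → ℕ}

/-- A block contains at most one member of a residue class, so the class of `a` contributes one to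
each translate of the cell `(i, j)` and nothing to other cells. -/
theorem psi_eq_card_add_unitMat (hb : IsBlocks n d b) (hc : IsBlocks n' d c) {w : Equiv.Perm ℤ}
    (hw : w ∈ extAffSym d) {a i j : ℤ} (ha : a ∈ block b i) (hwa : w a ∈ block c j) (r s : ℤ) :
    psi b c w r s = ((block b r).filter (fun p => w p ∈ block c s ∧ ¬ p ≡ a [ZMOD d])).card
      + unitMat n n' i j r s := by
  rw [psi_eq_card, ← Finset.card_filter_add_card_filter_not (fun p => p ≡ a [ZMOD d]),
    Finset.filter_filter, Finset.filter_filter, add_comm]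
  congr 1
  by_cases h : ∃ k : ℤ, r = i + k * n ∧ s = j + k * n'
  · have hu : unitMat n n' i j r s = 1 := if_pos h
    obtain ⟨k, rfl, rfl⟩ := h
    rw [hu, Finset.card_eq_one]
    refine ⟨a + k * d, ?_⟩
    ext p
    rw [Finset.mem_filter, Finset.mem_singleton]
    constructor
    · rintro ⟨h1, -, h2⟩
      exact hb.eq_of_mem_block h1 ((hb.add_mem_block k).2 ha)
        (h2.trans (modEq_iff_exists.2 ⟨k, rfl⟩).symm)
    · rintro rfl
      refine ⟨(hb.add_mem_block k).2 ha, ?_, modEq_iff_exists.2 ⟨k, rfl⟩⟩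
      rw [map_add_mul hw]
      exact (hc.add_mem_block k).2 hwa
  · have hu : unitMat n n' i j r s = 0 := if_neg h
    rw [hu, Finset.card_eq_zero, Finset.filter_eq_empty_iff]
    rintro p hp ⟨h1, h2⟩
    obtain ⟨k, rfl⟩ := modEq_iff_exists.1 h2
    rw [map_add_mul hw] at h1
    exact h ⟨k, block_index_unique hp ((hb.add_mem_block k).2 ha),
      block_index_unique h1 ((hc.add_mem_block k).2 hwa)⟩

variable {e : ℕ} {b' c' : ℤ → ℕ} {a i j v : ℤ} {α β : ℤ → ℤ} {y w : Equiv.Perm ℤ}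

theorem psi_infl (hb : IsBlocks n (e + 1) b) (hc : IsBlocks n' (e + 1) c)
    (hα : Skip e a α) (hαb : ∀ p r, α p ∈ block b r ↔ p ∈ block b' r)
    (hβc : ∀ p s, β p ∈ block c s ↔ p ∈ block c' s) (hw : w ∈ extAffSym (e + 1))
    (h : Infl a v α β y w) (ha : a ∈ block b i) (hv : v ∈ block c j) (r s : ℤ) :
    psi b c w r s = psi b' c' y r s + unitMat n n' i j r s := by
  rw [psi_eq_card_add_unitMat hb hc hw ha (h.point.symm ▸ hv), psi_eq_card]
  congr 1
  rw [← Finset.card_image_of_injective ((block b' r).filter (fun p => y p ∈ block c' s))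
    hα.strictMono.injective]
  congr 1
  ext x
  simp only [Finset.mem_filter, Finset.mem_image]
  constructor
  · rintro ⟨h1, h2, h3⟩
    obtain ⟨p, rfl⟩ := (hα.range x).2 h3
    rw [h.comp, hβc] at h2
    exact ⟨p, ⟨(hαb _ _).1 h1, h2⟩, rfl⟩
  · rintro ⟨p, ⟨h1, h2⟩, rfl⟩
    exact ⟨(hαb _ _).2 h1, by rwa [h.comp, hβc], hα.not_modEq p⟩

theorem Decr.of_infl (hα : Skip e a α) (hβ : Skip e v β)
    (hαb : ∀ p r, α p ∈ block b r ↔ p ∈ block b' r)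
    (hβc : ∀ p s, β p ∈ block c s ↔ p ∈ block c' s) (h : Infl a v α β y w) (hw : Decr b c w) :
    Decr b' c' y := by
  constructor
  · intro r p q hp hq hpq
    have := hw.row ((hαb p r).2 hp) ((hαb q r).2 hq) (hα.strictMono hpq)
    rw [h.comp, h.comp] at this
    exact hβ.strictMono.lt_iff_lt.1 this
  · intro s p q hp hq hpq
    have := hw.col (w := w) (p := α p) (q := α q) (s := s) (by rwa [h.comp, hβc])
      (by rwa [h.comp, hβc]) (hα.strictMono hpq)
    rw [h.comp, h.comp] at this
    exact hβ.strictMono.lt_iff_lt.1 this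

/-- An insertion into a decreasing permutation is decreasing, if the ranks at the new point and
at the corners of its cell are related as they should be. -/
theorem Decr.infl (hb : IsBlocks n (e + 1) b) (hc : IsBlocks n' (e + 1) c)
    (hα : Skip e a α) (hβ : Skip e v β) (hαb : ∀ p r, α p ∈ block b r ↔ p ∈ block b' r)
    (hβc : ∀ p s, β p ∈ block c s ↔ p ∈ block c' s) (hw : w ∈ extAffSym (e + 1))
    (h : Infl a v α β y w) (ha : a ∈ block b i) (hv : v ∈ block c j) (hy : Decr b' c' y)
    (h1 : rk w (a - 1) v = rk w (blockEnd b (i - 1)) (blockEnd c (j - 1))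
      + (a - 1 - blockEnd b (i - 1)).toNat)
    (h2 : rk w (a - 1) v = rk w (blockEnd b i) (blockEnd c j) + (blockEnd c j - v).toNat) :
    Decr b c w := by
  have hd : 0 < e + 1 := Nat.succ_pos e
  have hav := h.point
  have ha' := mem_block.1 ha
  have hv' := mem_block.1 hv
  -- By the two rank equalities, the inclusions `rk_subset_row` and `rk_subset_col` are between
  -- finite sets of the same size, hence equalities. They place the inserted point in decreasing
  -- order relative to all points of its row block and of its column block.
  have e1 := Set.eq_of_subset_of_ncard_le (rk_subset_row (b := b) (w := w) (p := a) (i := i)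
    (v := blockEnd c (j - 1)) (by omega)) (by
      rw [ncard_row_union hd hw, hav]
      exact h1.ge) ((rk_finite hd hw _ _).union (Finset.finite_toSet _))
  have e2 := Set.eq_of_subset_of_ncard_le (rk_subset_col (w := w) (p := a)
    (v := blockEnd c j) ha'.2) (by
      rw [ncard_col_union hd hw, hav]
      exact h2.ge) ((rk_finite hd hw _ _).union (Finset.finite_toSet _))
  rw [hav] at e1 e2
  have f1 : ∀ q, q ≤ blockEnd b (i - 1) → blockEnd c (j - 1) < w q → v < w q := fun q h3 h4 =>
    (e1.ge (Or.inl ⟨h3, h4⟩)).2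
  have f2 : ∀ q, blockEnd b (i - 1) < q → q ≤ a - 1 → v < w q := fun q h3 h4 =>
    (e1.ge (Or.inr (Finset.mem_coe.2 (Finset.mem_Ioc.2 ⟨h3, h4⟩)))).2
  have f3 : ∀ q, q ≤ blockEnd b i → blockEnd c j < w q → q ≤ a - 1 := fun q h3 h4 =>
    (e2.ge (Or.inl ⟨h3, h4⟩)).1
  have f4 : ∀ q, v < w q → w q ≤ blockEnd c j → q ≤ a - 1 := fun q h3 h4 =>
    (e2.ge (Or.inr (Finset.mem_coe.2 (Finset.mem_image.2
      ⟨w q, Finset.mem_Ioc.2 ⟨h3, h4⟩, w.symm_apply_apply q⟩)))).1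
  have hne : ∀ q, q ≠ a → w q ≠ v := fun q hq h3 => hq (w.injective (h3.trans hav.symm))
  constructor
  · intro r p q hp hq hpq
    by_cases h3 : p ≡ a [ZMOD (e + 1 : ℕ)]
    · obtain ⟨k, rfl⟩ := modEq_iff_exists.1 h3
      obtain rfl := block_index_unique hp ((hb.add_mem_block k).2 ha)
      obtain ⟨q, rfl⟩ : ∃ q', q = q' + k * (e + 1 : ℕ) := ⟨q - k * (e + 1 : ℕ), by ring⟩
      rw [hb.add_mem_block, mem_block] at hq
      rw [map_add_mul hw, map_add_mul hw, hav]
      have h4 : a < q := by omega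
      have := hne q (by omega)
      have := f3 q hq.2
      have := f4 q
      omega
    · by_cases h4 : q ≡ a [ZMOD (e + 1 : ℕ)]
      · obtain ⟨k, rfl⟩ := modEq_iff_exists.1 h4
        obtain rfl := block_index_unique hq ((hb.add_mem_block k).2 ha)
        obtain ⟨p, rfl⟩ : ∃ p', p = p' + k * (e + 1 : ℕ) := ⟨p - k * (e + 1 : ℕ), by ring⟩
        rw [hb.add_mem_block, mem_block] at hp
        rw [map_add_mul hw, map_add_mul hw, hav]
        have := f2 p
        omega
      · obtain ⟨p, rfl⟩ := (hα.range p).2 h3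
        obtain ⟨q, rfl⟩ := (hα.range q).2 h4
        rw [h.comp, h.comp]
        exact hβ.strictMono (hy.row ((hαb _ _).1 hp) ((hαb _ _).1 hq)
          (hα.strictMono.lt_iff_lt.1 hpq))
  · intro s p q hp hq hpq
    by_cases h3 : p ≡ a [ZMOD (e + 1 : ℕ)]
    · obtain ⟨k, rfl⟩ := modEq_iff_exists.1 h3
      rw [map_add_mul hw, hav] at hp
      obtain rfl := block_index_unique hp ((hc.add_mem_block k).2 hv)
      obtain ⟨q, rfl⟩ : ∃ q', q = q' + k * (e + 1 : ℕ) := ⟨q - k * (e + 1 : ℕ), by ring⟩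
      rw [map_add_mul hw, hc.add_mem_block, mem_block] at hq
      rw [map_add_mul hw, map_add_mul hw, hav]
      have := hne q (by omega)
      have := f4 q
      omega
    · by_cases h4 : q ≡ a [ZMOD (e + 1 : ℕ)]
      · obtain ⟨k, rfl⟩ := modEq_iff_exists.1 h4
        rw [map_add_mul hw, hav] at hq
        obtain rfl := block_index_unique hq ((hc.add_mem_block k).2 hv)
        obtain ⟨p, rfl⟩ : ∃ p', p = p' + k * (e + 1 : ℕ) := ⟨p - k * (e + 1 : ℕ), by ring⟩
        rw [map_add_mul hw, hc.add_mem_block, mem_block] at hp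
        rw [map_add_mul hw, map_add_mul hw, hav]
        have := f1 p
        have := f2 p
        omega
      · obtain ⟨p, rfl⟩ := (hα.range p).2 h3
        obtain ⟨q, rfl⟩ := (hα.range q).2 h4
        rw [h.comp, hβc] at hp hq
        rw [h.comp, h.comp]
        exact hβ.strictMono (hy.col hp hq (hα.strictMono.lt_iff_lt.1 hpq))

end Psi

/-! ### The longest element of a double coset -/

section Longest

variable {n n' : ℕ} {b c : ℤ → ℕ}

theorem block_eq_empty {n : ℕ} {b : ℤ → ℕ} (hb : IsBlocks n 0 b) (r : ℤ) : block b r = ∅ := by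
  have h1 := hb.le_sum r
  have h2 := blockEnd_eq_add b r
  rw [block, Finset.Ioc_eq_empty (by omega)]

theorem AffMat.exists_one_le {d : ℕ} (hb : IsBlocks n d b) (hd : 0 < d) (m : AffMat n b n' c) :
    ∃ i j, 1 ≤ m.entry i j := by
  obtain ⟨r, hr⟩ := hb.exists_mem_block hd 0
  have h1 := hb.one_le_of_mem hr
  by_contra! h
  have h2 := m.row_sum r
  simp only [fun j => Nat.lt_one_iff.1 (h r j), finsum_zero] at h2
  omega

/-- The double coset of a matrix is not empty. -/
theorem exists_psi_eq {d : ℕ} (hb : IsBlocks n d b) (hc : IsBlocks n' d c) (m : AffMat n b n' c) :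
    ∃ w ∈ extAffSym d, psi b c w = m.entry := by
  induction d generalizing b c with
  | zero =>
    refine ⟨1, one_mem _, ?_⟩
    funext r s
    have h1 := m.entry_le_row r s
    have h2 := hb.le_sum r
    rw [psi_eq_card, block_eq_empty hb]
    simp only [Finset.filter_empty, Finset.card_empty]
    omega
  | succ e ih =>
    obtain ⟨i, j, hij⟩ := m.exists_one_le hb (Nat.succ_pos e)
    have hbi := hij.trans (m.entry_le_row i j)
    have hcj := hij.trans (m.entry_le_col i j)
    have ha : blockEnd b i ∈ block b i := by
      have := blockEnd_eq_add b i
      exact mem_block.2 ⟨by omega, le_rfl⟩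
    have hv : blockEnd c j ∈ block c j := by
      have := blockEnd_eq_add c j
      exact mem_block.2 ⟨by omega, le_rfl⟩
    -- Insertion requires `e > 0`; for `d = 1` a translation realises the matrix, which is just
    -- `unitMat`.
    rcases Nat.eq_zero_or_pos e with rfl | he
    · have hw := shift_mem_extAffSym Nat.one_pos (blockEnd c j - blockEnd b i)
      refine ⟨_, hw, ?_⟩
      funext r s
      have h0 : (m.sub hb.one_le hc.one_le hij).entry r s = 0 := by
        have h1 := (m.sub hb.one_le hc.one_le hij).entry_le_row r s
        have h2 := (hb.lower hbi).le_sum r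
        omega
      have h3 := m.unitMat_le hij r s
      change m.entry r s - unitMat n n' i j r s = 0 at h0
      rw [psi_eq_card_add_unitMat hb hc hw ha (by rwa [shift_apply, add_sub_cancel]),
        Finset.filter_false_of_mem, Finset.card_empty]
      · omega
      · rintro p - ⟨-, h4⟩
        exact h4 (by simp [Int.ModEq])
    · obtain ⟨y, hy, hym⟩ := ih (hb.lower hbi) (hc.lower hcj) (m.sub hb.one_le hc.one_le hij)
      obtain ⟨α, hα, hαb⟩ := hb.exists_skip he ha
      obtain ⟨β, hβ, hβc⟩ := hc.exists_skip he hv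
      obtain ⟨w, hw, hi⟩ := exists_infl he hα hβ hy
      refine ⟨w, hw, ?_⟩
      funext r s
      rw [psi_infl hb hc hα hαb hβc hw hi ha hv, hym]
      exact Nat.sub_add_cancel (m.unitMat_le hij r s)

/-- The matrix restricts the values on one period to finitely many blocks, and these values
determine `w`. This gives an element of maximal length in the fibre. -/
theorem psi_fibre_finite {d : ℕ} (hb : IsBlocks n d b) (hc : IsBlocks n' d c) (hd : 0 < d)
    (m : AffMat n b n' c) : {w : extAffSym d | psi b c w = m.entry}.Finite := by
  choose row hrow using hb.exists_mem_block hd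
  choose col hcol using hc.exists_mem_block hd
  have hfin : ∀ p : ℤ, (⋃ s ∈ {s | m.entry (row p) s ≠ 0}, (block c s : Set ℤ)).Finite := fun p =>
    (m.row_finite (row p)).biUnion fun s _ => Finset.finite_toSet _
  have hpi := Set.Finite.pi' (ι := Finset.Ico (0 : ℤ) d) fun p => hfin p
  refine Set.Finite.of_finite_image (f := fun (w : extAffSym d) (p : Finset.Ico (0 : ℤ) d) =>
    (w : Equiv.Perm ℤ) p) (hpi.subset ?_) ?_
  · rintro f ⟨w, hw, rfl⟩ p
    simp only [Set.mem_iUnion]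
    refine ⟨col ((w : Equiv.Perm ℤ) p), ?_, hcol _⟩
    change m.entry _ _ ≠ 0
    have hw' : psi b c w = m.entry := hw
    rw [← hw', psi_eq_card]
    exact Finset.card_ne_zero_of_mem (Finset.mem_filter.2 ⟨hrow p, hcol _⟩)
  · intro w _ w' _ h
    apply Subtype.ext
    ext p
    have h1 : p % (d : ℤ) ∈ Finset.Ico (0 : ℤ) d := by
      rw [Finset.mem_Ico]
      exact ⟨Int.emod_nonneg _ (by omega), Int.emod_lt_of_pos _ (by omega)⟩
    have h2 : (w : Equiv.Perm ℤ) (p % d) = (w' : Equiv.Perm ℤ) (p % d) := congrFun h ⟨_, h1⟩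
    have h3 := map_add_mul w.2 (p % d) (p / d)
    have h4 := map_add_mul w'.2 (p % d) (p / d)
    rw [show p % (d : ℤ) + p / d * d = p by rw [mul_comm]; exact Int.emod_add_mul_ediv p d] at h3 h4
    rw [h3, h4, h2]

theorem psi_mul_refl {d : ℕ} (hb : IsBlocks n d b) (hd : 0 < d) (w : Equiv.Perm ℤ) {r p q : ℤ}
    (hp : p ∈ block b r) (hq : q ∈ block b r) (hne : ¬ p ≡ q [ZMOD d]) :
    psi b c (w * refl d p q) = psi b c w := by
  funext r s
  rw [psi_eq_card, psi_eq_card]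
  refine Finset.card_nbij' (refl d p q) (refl d p q) ?_ ?_ (fun x _ => refl_refl_apply _ _ _ x)
    (fun x _ => refl_refl_apply _ _ _ x)
  · intro x hx
    rw [Finset.mem_coe, Finset.mem_filter] at hx ⊢
    exact ⟨(hb.refl_mem_block hd hp hq hne).2 hx.1, hx.2⟩
  · intro x hx
    rw [Finset.mem_coe, Finset.mem_filter] at hx ⊢
    refine ⟨(hb.refl_mem_block hd hp hq hne).2 hx.1, ?_⟩
    rw [Equiv.Perm.mul_apply, refl_refl_apply]
    exact hx.2

theorem psi_refl_mul {d : ℕ} (hc : IsBlocks n' d c) (hd : 0 < d) (w : Equiv.Perm ℤ) {s p q : ℤ}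
    (hp : p ∈ block c s) (hq : q ∈ block c s) (hne : ¬ p ≡ q [ZMOD d]) :
    psi b c (refl d p q * w) = psi b c w := by
  funext r s
  rw [psi_eq_card, psi_eq_card]
  simp only [Equiv.Perm.mul_apply, hc.refl_mem_block hd hp hq hne]

theorem exists_isLongest (hb : IsBlocks n (total n b) b) (hc : IsBlocks n' (total n b) c)
    (hd : 0 < total n b) (m : AffMat n b n' c) : ∃ w, m.IsLongest w := by
  obtain ⟨w, hw, hm⟩ := exists_psi_eq hb hc m
  obtain ⟨u, hu, hmax⟩ := Set.exists_max_image _ extLength (psi_fibre_finite hb hc hd m)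
    ⟨⟨w, hw⟩, hm⟩
  exact ⟨u, hu, fun v hv => hmax v hv⟩

/-- If two elements of a block were in increasing order, the reflection exchanging them would
preserve the fibre of `psi` and increase the length. -/
theorem AffMat.IsLongest.decr (hb : IsBlocks n (total n b) b) (hc : IsBlocks n' (total n b) c)
    (hd : 0 < total n b) {m : AffMat n b n' c} {w : extAffSym (total n b)} (h : m.IsLongest w) :
    Decr b c w := by
  have key : ∀ p q : ℤ, p < q → ¬ p ≡ q [ZMOD (total n b : ℕ)] →
      psi b c ((w : Equiv.Perm ℤ) * refl (total n b) p q) = psi b c w →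
      (w : Equiv.Perm ℤ) q < (w : Equiv.Perm ℤ) p := by
    intro p q hpq hne hpsi
    by_contra! h1
    rcases h1.lt_or_eq with h2 | h2
    · have h3 := extLength_lt hd hpq hne h2
      have h4 := h.2 (w * ⟨refl (total n b) p q, refl_mem_extAffSym _ p q⟩) (by
        rw [Subgroup.coe_mul]
        exact hpsi.trans h.1)
      omega
    · exact hpq.ne ((w : Equiv.Perm ℤ).injective h2)
  constructor
  · intro r p q hp hq hpq
    have hne : ¬ p ≡ q [ZMOD (total n b : ℕ)] := fun h => hpq.ne (hb.eq_of_mem_block hp hq h)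
    exact key p q hpq hne (psi_mul_refl hb hd _ hp hq hne)
  · intro s p q hp hq hpq
    have hne : ¬ (w : Equiv.Perm ℤ) p ≡ (w : Equiv.Perm ℤ) q [ZMOD (total n b : ℕ)] := fun h =>
      hpq.ne ((w : Equiv.Perm ℤ).injective (hc.eq_of_mem_block hp hq h))
    refine key p q hpq (fun h => hne ((map_modEq_iff w.2).2 h)) ?_
    rw [mul_refl w.2]
    exact psi_refl_mul hc hd _ hp hq hne

/-- The longest element, as a permutation of `ℤ`. -/
noncomputable def AffMat.perm (m : AffMat n b n' c) : Equiv.Perm ℤ := m.longest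

theorem AffMat.perm_spec {d : ℕ} (hb : IsBlocks n d b) (hc : IsBlocks n' d c) (hd : 0 < d)
    (m : AffMat n b n' c) : m.perm ∈ extAffSym d ∧ psi b c m.perm = m.entry ∧ Decr b c m.perm := by
  obtain rfl := hb.total_eq
  have h := exists_isLongest hb hc hd m
  have h1 : m.IsLongest m.longest := by
    rw [AffMat.longest, dif_pos h]
    exact h.choose_spec
  exact ⟨m.longest.2, h1.1, h1.decr hb hc hd⟩

theorem AffMat.corner_eq_rk_perm {d : ℕ} (hb : IsBlocks n d b) (hc : IsBlocks n' d c) (hd : 0 < d)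
    (m : AffMat n b n' c) (i j : ℤ) :
    m.corner i j = rk m.perm (blockEnd b i) (blockEnd c (j - 1)) :=
  corner_eq_rk hb hc hd (m.perm_spec hb hc hd).1 (m.perm_spec hb hc hd).2.1 i j

/-- The ranks at block ends are corner sums of the matrix, so they leave only one decreasing
permutation. Thus longest elements are recognised without computing lengths. -/
theorem AffMat.eq_perm {d : ℕ} (hb : IsBlocks n d b) (hc : IsBlocks n' d c) (hd : 0 < d)
    {m : AffMat n b n' c} {w : Equiv.Perm ℤ} (hw : w ∈ extAffSym d) (hm : psi b c w = m.entry)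
    (hdec : Decr b c w) : w = m.perm := by
  obtain ⟨h1, h2, h3⟩ := m.perm_spec hb hc hd
  refine hdec.eq_of_rk_eq hb hc h3 hd hw h1 fun i j => ?_
  have e1 := corner_eq_rk hb hc hd hw hm i (j + 1)
  have e2 := corner_eq_rk hb hc hd h1 h2 i (j + 1)
  rw [add_sub_cancel_right] at e1 e2
  rw [← e1, e2]

theorem AffMat.perm_injective {d : ℕ} (hb : IsBlocks n d b) (hc : IsBlocks n' d c) (hd : 0 < d)
    {m m₁ : AffMat n b n' c} (h : m.perm = m₁.perm) : m = m₁ := by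
  apply AffMat.ext
  rw [← (m.perm_spec hb hc hd).2.1, ← (m₁.perm_spec hb hc hd).2.1, h]

theorem AffMat.le_iff {d : ℕ} (hb : IsBlocks n d b) (hd : 0 < d) {m m₁ : AffMat n b n' c} :
    m ≤ m₁ ↔ ReflTransGen (Up d) m.perm m₁.perm := by
  obtain rfl := hb.total_eq
  exact extBruhatLE_iff hd

theorem AffMat.length_eq {d : ℕ} (hb : IsBlocks n d b) (m : AffMat n b n' c) :
    m.length = permLength d m.perm := by
  obtain rfl := hb.total_eq
  exact (permLength_coe m.longest).symm

theorem AffMat.kl_eq {d : ℕ} (hb : IsBlocks n d b) (m m₁ : AffMat n b n' c) :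
    m.kl m₁ = permKL d m.perm m₁.perm := by
  obtain rfl := hb.total_eq
  exact (permKL_coe m.longest m₁.longest).symm

theorem AffMat.kl_self (m : AffMat n b n' c) : m.kl m = 1 := extKLPoly_self _

theorem AffMat.corner_mono {d : ℕ} (hb : IsBlocks n d b) (hc : IsBlocks n' d c) (hd : 0 < d)
    {m m₁ : AffMat n b n' c} (h : m ≤ m₁) (i j : ℤ) : m.corner i j ≤ m₁.corner i j := by
  rw [m.corner_eq_rk_perm hb hc hd, m₁.corner_eq_rk_perm hb hc hd]
  exact rk_le hd (m.perm_spec hb hc hd).1 ((AffMat.le_iff hb hd).1 h) _ _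

theorem AffMat.corner_add {d : ℕ} (hb : IsBlocks n d b) (hc : IsBlocks n' d c) (hd : 0 < d)
    (m : AffMat n b n' c) (i j : ℤ) :
    m.corner i j + m.corner (i - 1) (j + 1)
      = m.corner (i - 1) j + m.corner i (j + 1) + m.entry i j := by
  obtain ⟨h1, h2, h3⟩ := m.perm_spec hb hc hd
  simp only [m.corner_eq_rk_perm hb hc hd, add_sub_cancel_right]
  rw [rk_eq_add_card hd h1 (blockEnd_mono b (show i - 1 ≤ i by omega)),
    rk_eq_add_card hd h1 (blockEnd_mono b (show i - 1 ≤ i by omega)) (blockEnd c j), ← h2,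
    psi_eq_card]
  have h4 := blockEnd_mono c (show j - 1 ≤ j by omega)
  have e : ((Finset.Ioc (blockEnd b (i - 1)) (blockEnd b i)).filter
        (fun q => blockEnd c (j - 1) < m.perm q)).card
      = ((Finset.Ioc (blockEnd b (i - 1)) (blockEnd b i)).filter
        (fun q => blockEnd c j < m.perm q)).card
        + ((block b i).filter (fun p => m.perm p ∈ block c j)).card := by
    rw [← Finset.card_union_of_disjoint]
    · congr 1
      ext q
      simp only [Finset.mem_union, Finset.mem_filter, Finset.mem_Ioc, mem_block]
      constructor
      · rintro ⟨h5, h6⟩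
        rcases lt_or_ge (blockEnd c j) (m.perm q) with h7 | h7
        · exact Or.inl ⟨h5, h7⟩
        · exact Or.inr ⟨h5, h6, h7⟩
      · rintro (⟨h5, h6⟩ | ⟨h5, h6, -⟩)
        · exact ⟨h5, h4.trans_lt h6⟩
        · exact ⟨h5, h6⟩
    · rw [Finset.disjoint_left]
      intro q hq hq'
      have h5 := (mem_block.1 (Finset.mem_filter.1 hq').2).2
      have h6 := (Finset.mem_filter.1 hq).2
      omega
  omega

theorem AffMat.corner_sub_le {d : ℕ} (hb : IsBlocks n d b) (hc : IsBlocks n' d c) (hd : 0 < d)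
    (m : AffMat n b n' c) (i j : ℤ) :
    m.corner (i - 1) j ≤ m.corner i j ∧ m.corner i j ≤ m.corner (i - 1) j + b i := by
  obtain ⟨h1, -, -⟩ := m.perm_spec hb hc hd
  simp only [m.corner_eq_rk_perm hb hc hd]
  rw [rk_eq_add_card hd h1 (blockEnd_mono b (show i - 1 ≤ i by omega))]
  have h2 := Finset.card_filter_le (Finset.Ioc (blockEnd b (i - 1)) (blockEnd b i))
    (fun q => blockEnd c (j - 1) < m.perm q)
  have h3 := blockEnd_eq_add b i
  rw [Int.card_Ioc] at h2
  omega

/-! ### Cancellation -/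

/-- Corner sums are monotone, so the two that agree at the ends are constant. By `corner_add`, the
entry is then the sum of two other, monotone corner sums minus a constant. -/
theorem AffMat.Cancellable.between {d : ℕ} (hb : IsBlocks n d b) (hc : IsBlocks n' d c)
    (hd : 0 < d) {m m' m₁ : AffMat n b n' c} {i j : ℤ} (h : m.Cancellable m' i j) (h1 : m ≤ m₁)
    (h2 : m₁ ≤ m') : m.entry i j ≤ m₁.entry i j ∧ m₁.corner (i - 1) j = m.corner (i - 1) j ∧
      m₁.corner i (j + 1) = m.corner i (j + 1) := by
  have := h.above
  have := h.right
  have := AffMat.corner_mono hb hc hd h1 (i - 1) j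
  have := AffMat.corner_mono hb hc hd h2 (i - 1) j
  have := AffMat.corner_mono hb hc hd h1 i (j + 1)
  have := AffMat.corner_mono hb hc hd h2 i (j + 1)
  have := AffMat.corner_mono hb hc hd h1 i j
  have := AffMat.corner_mono hb hc hd h1 (i - 1) (j + 1)
  have := m.corner_add hb hc hd i j
  have := m₁.corner_add hb hc hd i j
  omega

/-- All longest elements in the interval send a certain `a` in the `i`-th block to the same element
of the `j`-th block, with the same rank at this point. -/
theorem AffMat.Cancellable.exists_point {d : ℕ} (hb : IsBlocks n d b) (hc : IsBlocks n' d c)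
    (hd : 0 < d) {m m' : AffMat n b n' c} {i j : ℤ} (h : m.Cancellable m' i j) (hmm : m ≤ m') :
    ∃ a v : ℤ, a ∈ block b i ∧ v ∈ block c j ∧ ∀ m₁ : AffMat n b n' c, m ≤ m₁ → m₁ ≤ m' →
      m₁.perm a = v ∧ rk m₁.perm (a - 1) v = rk m.perm (a - 1) v := by
  have h1 := h.one_le
  have hadd := m.corner_add hb hc hd i j
  have hs1 := m.corner_sub_le hb hc hd i j
  have hs2 := m.corner_sub_le hb hc hd i (j + 1)
  have hend := blockEnd_eq_add b i
  -- In the longest element of `m`, the block `B_i` begins with the positions whose values lie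
  -- beyond `C_j`; `a` is the first position after these. For other `m₁` in the interval no more
  -- positions lie beyond `C_j`, and no fewer reach `C_j` or beyond, so `a` still lands in `C_j`.
  set a : ℤ := blockEnd b (i - 1) + m.corner i (j + 1) - m.corner (i - 1) (j + 1) + 1 with ha
  have hab : a ∈ block b i := mem_block.2 ⟨by omega, by omega⟩
  have hcell : ∀ m₁ : AffMat n b n' c, m ≤ m₁ → m₁ ≤ m' → m₁.perm a ∈ block c j := by
    intro m₁ h2 h3
    obtain ⟨hw, -, hdec⟩ := m₁.perm_spec hb hc hd
    obtain ⟨-, h4, h5⟩ := h.between hb hc hd h2 h3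
    have h6 := AffMat.corner_mono hb hc hd h2 i j
    have h7 := AffMat.corner_mono hb hc hd h2 (i - 1) (j + 1)
    rw [mem_block, ← not_lt, hdec.lt_apply_iff hd hw hab, hdec.lt_apply_iff hd hw hab]
    have e : ∀ r, rk m₁.perm (blockEnd b r) (blockEnd c j) = m₁.corner r (j + 1) := fun r => by
      rw [m₁.corner_eq_rk_perm hb hc hd, add_sub_cancel_right]
    rw [← m₁.corner_eq_rk_perm hb hc hd, ← m₁.corner_eq_rk_perm hb hc hd, e, e]
    constructor <;> omega
  refine ⟨a, m.perm a, hab, hcell m (le_refl m) hmm, fun m₁ h2 h3 => ?_⟩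
  obtain ⟨hw, -, hdec⟩ := m₁.perm_spec hb hc hd
  obtain ⟨hw', -, hdec'⟩ := m.perm_spec hb hc hd
  obtain ⟨-, h4, h5⟩ := h.between hb hc hd h2 h3
  -- The two constant corner sums are the ranks at the two opposite corners of the cell that
  -- `Decr.apply_eq` requires.
  have h6 := hdec.apply_eq hdec' hd hw hw' hab (hcell m₁ h2 h3) (hcell m (le_refl m) hmm)
    (by rw [← m₁.corner_eq_rk_perm hb hc hd, ← m.corner_eq_rk_perm hb hc hd, h4])
    (by
      have e1 := m₁.corner_eq_rk_perm hb hc hd i (j + 1)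
      have e2 := m.corner_eq_rk_perm hb hc hd i (j + 1)
      rw [add_sub_cancel_right] at e1 e2
      rw [← e1, ← e2, h5])
  exact ⟨h6.1, h6.1 ▸ h6.2⟩

end Longest

/-! ### Inverse Kazhdan-Lusztig polynomials -/

/-- An isomorphism of intervals that preserves the polynomials `P` also preserves the entries of the
inverse matrix. -/
theorem AffMat.klInv_eq_of_orderIso {n n' k k' : ℕ} {b c f g : ℤ → ℕ} {m m' : AffMat n b n' c}
    {p p' : AffMat k f k' g} (φ : Set.Icc m m' ≃o Set.Icc p p')
    (hkl : ∀ x y : Set.Icc m m', AffMat.kl x.1 y.1 = AffMat.kl (φ x).1 (φ y).1)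
    (x y : Set.Icc m m') : AffMat.klInv x.1 y.1 = AffMat.klInv (φ x).1 (φ y).1 := by
  induction hN : y.1.length using Nat.strong_induction_on generalizing y with
  | _ N ih =>
    classical
    have hlt : ∀ u v : Set.Icc m m', u.1 < v.1 ↔ (φ u).1 < (φ v).1 := fun u v =>
      (φ.lt_iff_lt (x := u) (y := v)).symm
    have hle : ∀ u v : Set.Icc m m', u.1 ≤ v.1 ↔ (φ u).1 ≤ (φ v).1 := fun u v =>
      (φ.le_iff_le (x := u) (y := v)).symm
    have heq : (x.1 = y.1) = ((φ x).1 = (φ y).1) := propext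
      ⟨fun h => congrArg Subtype.val (congrArg φ (Subtype.ext h)),
        fun h => congrArg Subtype.val (φ.injective (Subtype.ext h))⟩
    have hsum : (∑ᶠ (z : AffMat n b n' c) (_ : x.1 ≤ z ∧ z < y.1),
          AffMat.klInv x.1 z * AffMat.kl z y.1)
        = ∑ᶠ (z : AffMat k f k' g) (_ : (φ x).1 ≤ z ∧ z < (φ y).1),
          AffMat.klInv (φ x).1 z * AffMat.kl z (φ y).1 := by
      -- The value `p` outside the interval is a default; every index of the sum lies in the
      -- interval.
      let G : AffMat n b n' c → AffMat k f k' g := fun z =>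
        if h : z ∈ Set.Icc m m' then (φ ⟨z, h⟩).1 else p
      have hG : ∀ z (h : z ∈ Set.Icc m m'), G z = (φ ⟨z, h⟩).1 := fun z h => dif_pos h
      have hmem : ∀ z, x.1 ≤ z ∧ z < y.1 → z ∈ Set.Icc m m' := fun z hz =>
        ⟨x.2.1.trans hz.1, hz.2.le.trans y.2.2⟩
      refine finsum_mem_eq_of_bijOn G (s := {z | x.1 ≤ z ∧ z < y.1})
        (t := {z | (φ x).1 ≤ z ∧ z < (φ y).1}) ⟨?_, ?_, ?_⟩ ?_
      · intro z hz
        rw [hG z (hmem z hz)]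
        exact ⟨(hle x ⟨z, hmem z hz⟩).1 hz.1, (hlt ⟨z, hmem z hz⟩ y).1 hz.2⟩
      · intro z hz z' hz' h
        rw [hG z (hmem z hz), hG z' (hmem z' hz')] at h
        exact congrArg Subtype.val (φ.injective (Subtype.ext h))
      · intro z hz
        have hz' : z ∈ Set.Icc p p' :=
          ⟨(φ x).2.1.trans hz.1, hz.2.le.trans (φ y).2.2⟩
        obtain ⟨u, hu⟩ := φ.surjective ⟨z, hz'⟩
        have hu' : (φ u).1 = z := congrArg Subtype.val hu
        refine ⟨u.1, ⟨(hle x u).2 (hu' ▸ hz.1), (hlt u y).2 (hu' ▸ hz.2)⟩, ?_⟩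
        rw [hG u.1 u.2]
        exact hu'
      · intro z hz
        rw [hG z (hmem z hz), ih _ (hN ▸ AffMat.length_lt hz.2) ⟨z, hmem z hz⟩ rfl,
          hkl ⟨z, hmem z hz⟩ y]
    conv_lhs => rw [AffMat.klInv]
    conv_rhs => rw [AffMat.klInv]
    rw [hsum]
    simp only [heq]

/-! ### Subtraction of `e` on an interval of matrices -/

section Cancel

variable {n n' : ℕ} {b c : ℤ → ℕ} {i j : ℤ}

/-- Subtraction of `e` as an isomorphism of intervals, from its properties on matrices. -/
theorem AffMat.exists_orderIso_sub (hn : 1 ≤ n) (hn' : 1 ≤ n') {m m' : AffMat n b n' c}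
    (hmm : m ≤ m') (h1 : ∀ x : Set.Icc m m', 1 ≤ x.1.entry i j)
    (hle : ∀ x y : Set.Icc m m', x.1.sub hn hn' (h1 x) ≤ y.1.sub hn hn' (h1 y) ↔ x.1 ≤ y.1)
    (hsurj : ∀ q, m.sub hn hn' (h1 ⟨m, le_rfl, hmm⟩) ≤ q →
      q ≤ m'.sub hn hn' (h1 ⟨m', hmm, le_rfl⟩) →
      ∃ x : Set.Icc m m', x.1.sub hn hn' (h1 x) = q)
    (hlen : ∃ k : ℕ, ∀ x : Set.Icc m m', x.1.length = (x.1.sub hn hn' (h1 x)).length + k)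
    (hkl : ∀ x y : Set.Icc m m',
      AffMat.kl x.1 y.1 = AffMat.kl (x.1.sub hn hn' (h1 x)) (y.1.sub hn hn' (h1 y))) :
    ∃ (p p' : AffMat n (lower n b i) n' (lower n' c j)) (φ : Set.Icc m m' ≃o Set.Icc p p'),
      (∀ r s, (p.entry r s : ℤ) = m.entry r s - unitMat n n' i j r s) ∧
      (∀ r s, (p'.entry r s : ℤ) = m'.entry r s - unitMat n n' i j r s) ∧
      (∀ (x : Set.Icc m m') (r s : ℤ),
        ((φ x).1.entry r s : ℤ) = x.1.entry r s - unitMat n n' i j r s) ∧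
      (∃ k : ℕ, ∀ x : Set.Icc m m', x.1.length = (φ x).1.length + k) ∧
      (∀ x y : Set.Icc m m', AffMat.kl x.1 y.1 = AffMat.kl (φ x).1 (φ y).1) ∧
      (∀ x y : Set.Icc m m', AffMat.klInv x.1 y.1 = AffMat.klInv (φ x).1 (φ y).1) := by
  have hsub : ∀ (x : Set.Icc m m') r s, ((x.1.sub hn hn' (h1 x)).entry r s : ℤ)
      = x.1.entry r s - unitMat n n' i j r s := fun x r s =>
    Nat.cast_sub (x.1.unitMat_le (h1 x) r s)
  let f : Set.Icc m m' → Set.Icc (m.sub hn hn' (h1 ⟨m, le_rfl, hmm⟩))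
      (m'.sub hn hn' (h1 ⟨m', hmm, le_rfl⟩)) := fun x =>
    ⟨x.1.sub hn hn' (h1 x), (hle ⟨m, le_rfl, hmm⟩ x).2 x.2.1, (hle x ⟨m', hmm, le_rfl⟩).2 x.2.2⟩
  have hf : Function.Bijective f := by
    refine ⟨fun x y hxy => Subtype.ext (AffMat.ext ?_), fun q => ?_⟩
    · funext r s
      have e1 := hsub x r s
      have e2 := hsub y r s
      have e3 : x.1.sub hn hn' (h1 x) = y.1.sub hn hn' (h1 y) := congrArg Subtype.val hxy
      rw [e3] at e1
      omega
    · obtain ⟨x, hx⟩ := hsurj q.1 q.2.1 q.2.2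
      exact ⟨x, Subtype.ext hx⟩
  let φ : Set.Icc m m' ≃o Set.Icc (m.sub hn hn' (h1 ⟨m, le_rfl, hmm⟩))
      (m'.sub hn hn' (h1 ⟨m', hmm, le_rfl⟩)) :=
    ⟨Equiv.ofBijective f hf, fun {x y} => hle x y⟩
  exact ⟨_, _, φ, hsub ⟨m, le_rfl, hmm⟩, hsub ⟨m', hmm, le_rfl⟩, hsub, hlen, hkl,
    AffMat.klInv_eq_of_orderIso φ hkl⟩

variable {e : ℕ} {a v : ℤ} {α β : ℤ → ℤ}

/-- The longest element of `m - e` arises from the one of `m` by deleting a point. -/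
theorem AffMat.infl_sub (hb : IsBlocks n (e + 1) b) (hc : IsBlocks n' (e + 1) c) (he : 0 < e)
    (hα : Skip e a α) (hβ : Skip e v β)
    (hαb : ∀ p r, α p ∈ block b r ↔ p ∈ block (lower n b i) r)
    (hβc : ∀ p s, β p ∈ block c s ↔ p ∈ block (lower n' c j) s)
    (ha : a ∈ block b i) (hv : v ∈ block c j) (m : AffMat n b n' c) (h : 1 ≤ m.entry i j)
    (hm : m.perm a = v) :
    Infl a v α β (m.sub hb.one_le hc.one_le h).perm m.perm := by
  obtain ⟨hw, hpsi, hdec⟩ := m.perm_spec hb hc (Nat.succ_pos e)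
  obtain ⟨y, hy, hi⟩ := exists_infl_of_apply_eq he hα hβ hw hm
  have e1 : y = (m.sub hb.one_le hc.one_le h).perm := by
    refine AffMat.eq_perm (hb.lower (hb.one_le_of_mem ha)) (hc.lower (hc.one_le_of_mem hv)) he hy
      ?_ (hdec.of_infl hα hβ hαb hβc hi)
    funext r s
    have h2 := psi_infl hb hc hα hαb hβc hw hi ha hv r s
    rw [hpsi] at h2
    change _ = m.entry r s - unitMat n n' i j r s
    omega
  exact e1 ▸ hi

/-- The chain from `m - e` to `q` lifts to a chain from the longest element of `m` to an insertion
`u`, which lies below the longest element of `m'`. So `u` has the common point and rank, and the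
squeezed corner ranks make it decreasing by `Decr.infl`. Hence `u` is the longest element of `q +
e`. -/
theorem AffMat.exists_sub_eq (hb : IsBlocks n (e + 1) b) (hc : IsBlocks n' (e + 1) c) (he : 0 < e)
    (hα : Skip e a α) (hβ : Skip e v β)
    (hαb : ∀ p r, α p ∈ block b r ↔ p ∈ block (lower n b i) r)
    (hβc : ∀ p s, β p ∈ block c s ↔ p ∈ block (lower n' c j) s)
    (ha : a ∈ block b i) (hv : v ∈ block c j) {m m' : AffMat n b n' c}
    (hij : m.Cancellable m' i j) (hm : m.perm a = v) (hm' : m'.perm a = v)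
    (hr : rk m'.perm (a - 1) v = rk m.perm (a - 1) v) (h' : 1 ≤ m'.entry i j)
    {q : AffMat n (lower n b i) n' (lower n' c j)}
    (h1 : m.sub hb.one_le hc.one_le hij.one_le ≤ q)
    (h2 : q ≤ m'.sub hb.one_le hc.one_le h') :
    ∃ x : AffMat n b n' c, m ≤ x ∧ x ≤ m' ∧
      ∀ r s, x.entry r s = q.entry r s + unitMat n n' i j r s := by
  have hd := Nat.succ_pos e
  have hbl := hb.lower (hb.one_le_of_mem ha)
  have hcl := hc.lower (hc.one_le_of_mem hv)
  obtain ⟨hw, -, hdec⟩ := m.perm_spec hb hc hd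
  obtain ⟨hw', -, -⟩ := m'.perm_spec hb hc hd
  obtain ⟨-, hqpsi, hqdec⟩ := q.perm_spec hbl hcl he
  obtain ⟨u, hmu, hi⟩ := exists_infl_up he hα hβ
    (AffMat.infl_sub hb hc he hα hβ hαb hβc ha hv m hij.one_le hm) ((AffMat.le_iff hbl he).1 h1)
  have hu := mem_of_reflTransGen_up hmu hw
  have hum := reflTransGen_up_of_infl he hα hβ hu hw' hi
    (AffMat.infl_sub hb hc he hα hβ hαb hβc ha hv m' h' hm') ((AffMat.le_iff hbl he).1 h2)
  have hrk := apply_eq_of_between hd hw hmu hum hm hm' hr.symm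
  have hcor : ∀ r s, m.corner r s = m'.corner r s →
      rk u (blockEnd b r) (blockEnd c (s - 1)) = rk m.perm (blockEnd b r) (blockEnd c (s - 1)) := by
    intro r s h3
    rw [m.corner_eq_rk_perm hb hc hd, m'.corner_eq_rk_perm hb hc hd] at h3
    exact le_antisymm (h3 ▸ rk_le hd hu hum _ _) (rk_le hd hw hmu _ _)
  have h3 := hcor _ _ hij.above
  have h4 := hcor _ _ hij.right
  rw [add_sub_cancel_right] at h4
  have h5 := hdec.rk_eq_row hd hw ha (hm ▸ hv)
  have h6 := hdec.rk_eq_col hd hw ha (hm ▸ hv)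
  rw [hm] at h5 h6
  have hudec := Decr.infl hb hc hα hβ hαb hβc hu hi ha hv hqdec
    (by rw [h3, hrk.2, h5]) (by rw [h4, hrk.2, h6])
  let x := q.add hb.one_le hc.one_le
    (fun r h => by rw [hb.apply_of_modEq h]; exact hb.one_le_of_mem ha)
    (fun s h => by rw [hc.apply_of_modEq h]; exact hc.one_le_of_mem hv)
  have hux : u = x.perm := AffMat.eq_perm hb hc hd hu (by
    funext r s
    rw [psi_infl hb hc hα hαb hβc hu hi ha hv, hqpsi]
    rfl) hudec
  exact ⟨x, (AffMat.le_iff hb hd).2 (hux ▸ hmu), (AffMat.le_iff hb hd).2 (hux ▸ hum),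
    fun _ _ => rfl⟩

/-- The drop in `permLength_infl` depends only on the point, the rank and the offset, all constant
here. The truncated subtraction loses nothing because deletion does not increase length. -/
theorem AffMat.length_eq_of_infl (hb : IsBlocks n (e + 1) b) (hc : IsBlocks n' (e + 1) c)
    (he : 0 < e) (hα : Skip e a α) (hβ : Skip e v β) {g h : ℤ → ℕ} (hg : IsBlocks n e g)
    (hh : IsBlocks n' e h) {m x : AffMat n b n' c} {p y : AffMat n g n' h} (hmx : m ≤ x)
    (hp : Infl a v α β p.perm m.perm) (hy : Infl a v α β y.perm x.perm)
    (hr : rk x.perm (a - 1) v = rk m.perm (a - 1) v) :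
    x.length = y.length + (m.length - p.length) := by
  have hd := Nat.succ_pos e
  have h1 := permLength_infl he hα hβ (y := ⟨p.perm, (p.perm_spec hg hh he).1⟩)
    (w := ⟨m.perm, (m.perm_spec hb hc hd).1⟩) hp
  have h2 := permLength_infl he hα hβ (y := ⟨y.perm, (y.perm_spec hg hh he).1⟩)
    (w := ⟨x.perm, (x.perm_spec hb hc hd).1⟩) hy
  rw [offset_eq_of_reflTransGen_up (x := ⟨m.perm, (m.perm_spec hb hc hd).1⟩)
    (y := ⟨x.perm, (x.perm_spec hb hc hd).1⟩) ((AffMat.le_iff hb hd).1 hmx), ← hr] at h1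
  rw [AffMat.length_eq hb, AffMat.length_eq hb, AffMat.length_eq hg, AffMat.length_eq hg]
  simp only [← permLength_coe] at h1 h2
  omega

theorem AffMat.kl_eq_of_infl (hb : IsBlocks n (e + 1) b) (hc : IsBlocks n' (e + 1) c)
    (he : 0 < e) (hα : Skip e a α) (hβ : Skip e v β) {g h : ℤ → ℕ} (hg : IsBlocks n e g)
    (hh : IsBlocks n' e h) {m x y : AffMat n b n' c} {p z u : AffMat n g n' h} (hmx : m ≤ x)
    (hmy : m ≤ y) (hpz : p ≤ z) (hpu : p ≤ u)
    (hz : Infl a v α β z.perm x.perm) (hu : Infl a v α β u.perm y.perm)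
    (hr : rk x.perm (a - 1) v = rk y.perm (a - 1) v) : x.kl y = z.kl u := by
  have hd := Nat.succ_pos e
  have hoff : ∀ {x : AffMat n b n' c}, m ≤ x →
      offset (⟨m.perm, (m.perm_spec hb hc hd).1⟩ : extAffSym (e + 1))
        = offset ⟨x.perm, (x.perm_spec hb hc hd).1⟩ := fun h =>
    offset_eq_of_reflTransGen_up ((AffMat.le_iff hb hd).1 h)
  have hoff' : ∀ {z : AffMat n g n' h}, p ≤ z →
      offset (⟨p.perm, (p.perm_spec hg hh he).1⟩ : extAffSym e)
        = offset ⟨z.perm, (z.perm_spec hg hh he).1⟩ := fun h =>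
    offset_eq_of_reflTransGen_up ((AffMat.le_iff hg he).1 h)
  have h1 := extKLPoly_infl he hα hβ (z := ⟨z.perm, (z.perm_spec hg hh he).1⟩)
    (y := ⟨u.perm, (u.perm_spec hg hh he).1⟩) (x := ⟨x.perm, (x.perm_spec hb hc hd).1⟩)
    (w := ⟨y.perm, (y.perm_spec hb hc hd).1⟩) hz hu hr ((hoff hmx).symm.trans (hoff hmy))
    ((hoff' hpz).symm.trans (hoff' hpu))
  rw [← permKL_coe, ← permKL_coe] at h1
  rw [AffMat.kl_eq hb, AffMat.kl_eq hg]
  exact h1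

/-- Modulo `1` all integers are congruent, so there are no reflections and the order is trivial. -/
theorem AffMat.eq_of_le_of_total_one (hb : IsBlocks n 1 b) (hc : IsBlocks n' 1 c)
    {m m' : AffMat n b n' c} (h : m ≤ m') : m = m' := by
  refine AffMat.perm_injective hb hc Nat.one_pos ?_
  rcases ((AffMat.le_iff hb Nat.one_pos).1 h).cases_head with h1 | ⟨_, ⟨p, q, -, h2, -⟩, -⟩
  · exact h1
  · exact absurd (by simp [Int.ModEq]) h2

theorem AffMat.entry_eq_zero (hb : IsBlocks n 0 b) (m : AffMat n b n' c) (r s : ℤ) :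
    m.entry r s = 0 := by
  have h1 := m.entry_le_row r s
  have h2 := hb.le_sum r
  omega

theorem AffMat.length_eq_zero (hb : IsBlocks n 0 b) (m : AffMat n b n' c) : m.length = 0 := by
  have h1 : affPart m.longest = 1 := by
    apply Subtype.ext
    exact (affPart m.longest).2.1.2 hb.total_eq
  rw [AffMat.length, extLength, h1]
  exact len_one _

end Cancel

end AffineKL

/-! ### The proposition -/

theorem mainTheorem5 (n n' : ℕ) (hn : 1 ≤ n) (hn' : 1 ≤ n') (b c : ℤ → ℕ)
    (hb : ∀ i, b (i + n) = b i) (hc : ∀ j, c (j + n') = c j)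
    (hbc : AffineKL.total n b = AffineKL.total n' c)
    (m m' : AffineKL.AffMat n b n' c) (hmm' : m ≤ m') (i j : ℤ)
    (hij : m.Cancellable m' i j) :
    (∀ m₁ : AffineKL.AffMat n b n' c, m ≤ m₁ → m₁ ≤ m' →
      m.entry i j ≤ m₁.entry i j ∧
      m₁.corner (i - 1) j = m.corner (i - 1) j ∧
      m₁.corner i (j + 1) = m.corner i (j + 1)) ∧
    (∀ m₁ m₂ : AffineKL.AffMat n b n' c, m ≤ m₁ → m₁ ≤ m₂ → m₂ ≤ m' →
      m₁.Cancellable m₂ i j) ∧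
    ∃ (p p' : AffineKL.AffMat n (AffineKL.lower n b i) n' (AffineKL.lower n' c j))
      (φ : Set.Icc m m' ≃o Set.Icc p p'),
      (∀ r s, (p.entry r s : ℤ) = m.entry r s - AffineKL.unitMat n n' i j r s) ∧
      (∀ r s, (p'.entry r s : ℤ) = m'.entry r s - AffineKL.unitMat n n' i j r s) ∧
      (∀ (x : Set.Icc m m') (r s : ℤ),
        ((φ x).1.entry r s : ℤ) = x.1.entry r s - AffineKL.unitMat n n' i j r s) ∧
      (∃ k : ℕ, ∀ x : Set.Icc m m', x.1.length = (φ x).1.length + k) ∧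
      (∀ x y : Set.Icc m m', AffineKL.AffMat.kl x.1 y.1 = AffineKL.AffMat.kl (φ x).1 (φ y).1) ∧
      (∀ x y : Set.Icc m m',
        AffineKL.AffMat.klInv x.1 y.1 = AffineKL.AffMat.klInv (φ x).1 (φ y).1) := by
  have hB : AffineKL.IsBlocks n (AffineKL.total n b) b := ⟨hn, hb, rfl⟩
  have hC : AffineKL.IsBlocks n' (AffineKL.total n b) c := ⟨hn', hc, hbc.symm⟩
  have hbi : 1 ≤ b i := hij.one_le.trans (m.entry_le_row i j)
  have hcj : 1 ≤ c j := hij.one_le.trans (m.entry_le_col i j)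
  obtain ⟨e, he⟩ : ∃ e, AffineKL.total n b = e + 1 :=
    Nat.exists_eq_add_one.2 (hbi.trans (hB.le_sum i))
  rw [he] at hB hC
  have hd := Nat.succ_pos e
  have hbet : ∀ m₁, m ≤ m₁ → m₁ ≤ m' → _ := fun m₁ h1 h2 => hij.between hB hC hd h1 h2
  have h1 : ∀ x : Set.Icc m m', 1 ≤ x.1.entry i j := fun x =>
    hij.one_le.trans (hbet x.1 x.2.1 x.2.2).1
  refine ⟨hbet, fun m₁ m₂ h01 h12 h23 => ?_, ?_⟩
  · obtain ⟨-, e1, e2⟩ := hbet m₁ h01 (h12.trans h23)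
    obtain ⟨-, e3, e4⟩ := hbet m₂ (h01.trans h12) h23
    exact ⟨h1 ⟨m₁, h01, h12.trans h23⟩, e1.trans e3.symm, e2.trans e4.symm⟩
  have hBl := hB.lower hbi
  have hCl := hC.lower hcj
  -- For `e = 0` the reduced matrices are zero and deletion of a point is not available, but both
  -- intervals consist of a single element.
  rcases Nat.eq_zero_or_pos e with rfl | he0
  · have hx : ∀ x : Set.Icc m m', x = ⟨m, le_rfl, hmm'⟩ := fun x =>
      Subtype.ext (AffineKL.AffMat.eq_of_le_of_total_one hB hC x.2.1).symm
    have hq : ∀ p q : AffineKL.AffMat n (AffineKL.lower n b i) n' (AffineKL.lower n' c j),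
        p = q := fun p q => AffineKL.AffMat.ext (by
      funext r s
      rw [p.entry_eq_zero hBl, q.entry_eq_zero hBl])
    refine AffineKL.AffMat.exists_orderIso_sub hn hn' hmm' h1 (fun x y => ?_)
      (fun q _ _ => ⟨⟨m, le_rfl, hmm'⟩, hq _ _⟩) ⟨m.length, fun x => ?_⟩ (fun x y => ?_)
    · rw [hx x, hx y]
      exact ⟨fun _ => le_rfl, fun _ => le_rfl⟩
    · rw [AffineKL.AffMat.length_eq_zero hBl, hx x, zero_add]
    · rw [hx x, hx y, AffineKL.AffMat.kl_self, AffineKL.AffMat.kl_self]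
  · obtain ⟨a, v, ha, hv, hpt⟩ := hij.exists_point hB hC hd hmm'
    obtain ⟨α, hα, hαb⟩ := hB.exists_skip he0 ha
    obtain ⟨β, hβ, hβc⟩ := hC.exists_skip he0 hv
    have hinf : ∀ x : Set.Icc m m', AffineKL.Infl a v α β (x.1.sub hn hn' (h1 x)).perm x.1.perm :=
      fun x => AffineKL.AffMat.infl_sub hB hC he0 hα hβ hαb hβc ha hv x.1 (h1 x)
        (hpt x.1 x.2.1 x.2.2).1
    have hrk : ∀ x : Set.Icc m m', AffineKL.rk x.1.perm (a - 1) v = AffineKL.rk m.perm (a - 1) v :=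
      fun x => (hpt x.1 x.2.1 x.2.2).2
    have hle : ∀ x y : Set.Icc m m',
        x.1.sub hn hn' (h1 x) ≤ y.1.sub hn hn' (h1 y) ↔ x.1 ≤ y.1 := fun x y => by
      rw [AffineKL.AffMat.le_iff hBl he0, AffineKL.AffMat.le_iff hB hd]
      exact (AffineKL.reflTransGen_up_infl_iff he0 hα hβ (x.1.perm_spec hB hC hd).1
        (y.1.perm_spec hB hC hd).1 (hinf x) (hinf y) ((hrk x).trans (hrk y).symm)).symm
    let m₀ : Set.Icc m m' := ⟨m, le_rfl, hmm'⟩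
    let m₁ : Set.Icc m m' := ⟨m', hmm', le_rfl⟩
    refine AffineKL.AffMat.exists_orderIso_sub hn hn' hmm' h1 hle (fun q h2 h3 => ?_)
      ⟨m.length - (m.sub hn hn' hij.one_le).length, fun x => ?_⟩ (fun x y => ?_)
    · obtain ⟨x, hx1, hx2, hx⟩ := AffineKL.AffMat.exists_sub_eq hB hC he0 hα hβ hαb hβc ha hv
        hij (hinf m₀).point (hinf m₁).point (hrk m₁) (h1 m₁) h2 h3
      refine ⟨⟨x, hx1, hx2⟩, AffineKL.AffMat.ext ?_⟩
      funext r s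
      change x.entry r s - AffineKL.unitMat n n' i j r s = q.entry r s
      rw [hx, Nat.add_sub_cancel]
    · exact AffineKL.AffMat.length_eq_of_infl hB hC he0 hα hβ hBl hCl x.2.1 (hinf m₀) (hinf x)
        (hrk x)
    · exact AffineKL.AffMat.kl_eq_of_infl hB hC he0 hα hβ hBl hCl x.2.1 y.2.1
        ((hle m₀ x).2 x.2.1) ((hle m₀ y).2 y.2.1) (hinf x) (hinf y) ((hrk x).trans (hrk y).symm)
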